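/- Let $\mu,a\in\mathbb R$ and put $G(\tilde r)=1-\frac{\mu}{\tilde r^{2}}+\frac{\mu a^{2}}{\tilde r^{4}}$. Consider the five-dimensional Myers–Perry spacetime with equal angular momenta, i.e. the set of points of $\mathbb R_t\times(0,\infty)_{\tilde r}\times S^3$ with $\tilde r>|a|$ and $G(\tilde r)\neq 0$, with the metric $$g=-dt^{2}+\frac{d\tilde r^{2}}{G(\tilde r)}+\tilde r^{2}\big(\bar\sigma^{+}\bar\sigma^{-}+\bar\sigma^{-}\bar\sigma^{+}+\bar\sigma^{3}\bar\sigma^{3}\big)+\frac{\mu}{\tilde r^{2}}\big(dt-a\bar\sigma^{3}\big)^{2}.$$ Here $\bar\sigma^i=\frac12\sigma^i$, $\bar\sigma^{\pm}=\frac1{\sqrt2}(\bar\sigma^1\pm i\bar\sigma^2)$ and, in Euler angles $(\tilde\theta,\tilde\phi,\tilde\psi)$ on $S^3$, $\sigma^1=-\sin\tilde\phi\,d\tilde\theta+\cos\tilde\phi\sin\tilde\theta\,d\tilde\psi$, $\sigma^2=-\cos\tilde\phi\,d\tilde\theta-\sin\tilde\phi\sin\tilde\theta\,d\tilde\psi$,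 $\sigma^3=d\tilde\phi+\cos\tilde\theta\,d\tilde\psi$. Let $\sigma_i$ be the vector fields on $S^3$ dual to $\sigma^i$, and let $\xi_1=-\sin\tilde\psi\,\partial_{\tilde\theta}+\csc\tilde\theta\cos\tilde\psi\,\partial_{\tilde\phi}-\cot\tilde\theta\cos\tilde\psi\,\partial_{\tilde\psi}$, $\xi_2=-\cos\tilde\psi\,\partial_{\tilde\theta}-\csc\tilde\theta\sin\tilde\psi\,\partial_{\tilde\phi}+\cot\tilde\theta\sin\tilde\psi\,\partial_{\tilde\psi}$, $\xi_3=\partial_{\tilde\psi}$. Put $W_i=i\sigma_i$, $L_i=i\xi_i$, $W_\pm=W_1\pm iW_2$, $L_\pm=L_1\pm iL_2$. Let $$f=-a\tilde r\,dt\wedge d\tilde r\wedge\bar\sigma^3-i\tilde r^2\,\bar\sigma^+\wedge\bar\sigma^-\wedge(-a\,dt+\tilde r^2\bar\sigma^3)$$ be the Killing–Yano 3-form and, with $\nabla$ the Levi-Civita connection of $g$, let $$(\mathcal S h)_{\lambda\rho}=2f_{(\lambda}{}^{\kappa\tau}\nabla_{|\kappa|}h_{\rho)\tau}=f_\lambda{}^{\kappa\tau}\nabla_\kappa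 h_{\rho\tau}+f_\rho{}^{\kappa\tau}\nabla_\kappa h_{\lambda\tau}$$ be the associated symmetry operator on (complex) symmetric rank-2 tensor fields $h$, on which no field equation is imposed. For $J\in\{0,\frac12,1,\dots\}$ and $K,M\in\{-J,-J+1,\dots,J\}$ let $\mathbb D^J_{KM}$ be the Wigner functions on $S^3$: with $z=\sin\frac{\tilde\theta}2e^{i(\tilde\phi-\tilde\psi)/2}$ and $w=\cos\frac{\tilde\theta}2e^{i(\tilde\phi+\tilde\psi)/2}$, $\mathbb D^J_{KM}$ is $\sqrt{\frac{(J+K)!\,(J-K)!}{(J+M)!\,(J-M)!}}$ times the coefficient of $X^{J+K}$ in $(\bar wX+z)^{J+M}(\bar zX-w)^{J-M}$. Put $\mathbb D^J_{KM}=0$ for all other $(J,K,M)$. A mode with labels $(J,K,M)$ is a tensor field $$h^J_{KM}=h_{AB}\mathbb D^J_{KM}\bar\sigma^A\bar\sigma^B+2h_{+-}\mathbb D^J_{KM}\bar\sigma^+\bar\sigma^-+2h_{A+}\mathbb D^J_{K-1\,M}\bar\sigma^A\bar\sigma^++2h_{A-}\mathbb D^J_{K+1\,M}\bar\sigma^A\bar\sigma^-+h_{++}\mathbb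 D^J_{K-2\,M}\bar\sigma^+\bar\sigma^++h_{--}\mathbb D^J_{K+2\,M}\bar\sigma^-\bar\sigma^-,$$ with products of covectors symmetrized, $A,B\in\{t,\tilde r,3\}$, $\bar\sigma^t=dt$, $\bar\sigma^{\tilde r}=d\tilde r$, and coefficients that are functions of $(t,\tilde r)$ only and symmetric in their indices. Then: 1. The functions $\mathbb D^J_{KM}$ satisfy $W_3\mathbb D^J_{KM}=K\mathbb D^J_{KM}$, $L_3\mathbb D^J_{KM}=M\mathbb D^J_{KM}$, $W_\pm\mathbb D^J_{KM}=\sqrt{J(J+1)-K(K\pm1)}\,\mathbb D^J_{K\pm1\,M}$ and $L_\pm\mathbb D^J_{KM}=\sqrt{J(J+1)-M(M\pm1)}\,\mathbb D^J_{K\,M\pm1}$. 2. (Mode preservation.) For every $k\in\{0,1,\dots,\infty\}$, if $h$ is a mode with labels $(J,K,M)$ and coefficients of class $C^{k+1}$, then $\mathcal Sh$ is a mode with the same labels $(J,K,M)$ and coefficients of class $C^k$. 3. (Commutation.) On $C^2$ symmetric tensor fields $h$ on the spacetime, $\mathcal Sh$ is symmetric and, with $\mathcal W_3=\pounds_{W_3}$,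 $\mathcal L_i=\pounds_{L_i}$ $(i=1,2,3)$ and $\mathcal T=\pounds_{i\partial_t}$, $$[\mathcal S,\mathcal W_3]=[\mathcal S,\mathcal L_i]=[\mathcal S,\mathcal T]=0,\qquad[\mathcal W_3,\mathcal L_i]=[\mathcal W_3,\mathcal T]=[\mathcal L_i,\mathcal T]=0.$$ -/

import Mathlib

noncomputable section

namespace MyersPerry

open scoped BigOperators ContDiff

/-!
The five-dimensional Myers–Perry spacetime with equal angular momenta, described globally.

The radius `r̃ > 0` and the three-sphere together form `ℝ⁴ \ {0}`, so that the whole spacetime is an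
open subset of `ℝ⁵` with the single global chart `(t, x₁, x₂, x₃, x₄)`.  In terms of the Euler angles
`(θ̃, φ̃, ψ̃)` of the sphere,
`x₁ + i x₂ = r̃ sin (θ̃/2) exp (i (φ̃ - ψ̃)/2)`, `x₃ + i x₄ = r̃ cos (θ̃/2) exp (i (φ̃ + ψ̃)/2)`.
All tensors have complex components in this chart, with real tensors as a special case.
-/

/-- Points `(t, x₁, x₂, x₃, x₄)`. -/
abbrev Pt := Fin 5 → ℝ

/-- Vector fields (contravariant components) with complex components. -/
abbrev VField := Pt → Fin 5 → ℂ

/-- Covector fields (covariant components) with complex components. -/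
abbrev CoField := Pt → Fin 5 → ℂ

/-- Covariant rank-2 tensor fields with complex components. -/
abbrev Tensor2 := Pt → Fin 5 → Fin 5 → ℂ

/-- Symmetry of a rank-2 tensor field on a set. -/
def IsSymmOn (h : Tensor2) (s : Set Pt) : Prop :=
  ∀ x ∈ s, ∀ κ τ, h x κ τ = h x τ κ

/-- The radial coordinate `r̃`. -/
def rad (x : Pt) : ℝ := Real.sqrt (x 1 ^ 2 + x 2 ^ 2 + x 3 ^ 2 + x 4 ^ 2)

/-- `G(r̃) = 1 - μ / r̃² + μ a² / r̃⁴`. -/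
def G (μ a r : ℝ) : ℝ := 1 - μ / r ^ 2 + μ * a ^ 2 / r ^ 4

/-- The range of `(t, r̃)`: the Boyer–Lindquist radius `r`, with `r̃² = r² + a²`, is positive, and
`r̃` is not a zero of `G` (that is, the point is not on a horizon). -/
def orbitSpace (μ a : ℝ) : Set (ℝ × ℝ) := {p | |a| < p.2 ∧ G μ a p.2 ≠ 0}

/-- The spacetime. -/
def spacetime (μ a : ℝ) : Set Pt := {x | (x 0, rad x) ∈ orbitSpace μ a}

/-! ### The coframe -/

/-- The covector field `dt`. -/
def dt : CoField := fun _ => ![1, 0, 0, 0, 0]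

/-- The covector field `d r̃`. -/
def dr : CoField := fun x κ => (![0, x 1, x 2, x 3, x 4] κ : ℝ) / (rad x : ℂ)

/-- `σ¹ = -sin φ̃ dθ̃ + cos φ̃ sin θ̃ dψ̃`. -/
def sig1 : CoField := fun x κ => 2 * (![0, -x 4, -x 3, x 2, x 1] κ : ℝ) / (rad x : ℂ) ^ 2

/-- `σ² = -cos φ̃ dθ̃ - sin φ̃ sin θ̃ dψ̃`. -/
def sig2 : CoField := fun x κ => 2 * (![0, -x 3, x 4, x 1, -x 2] κ : ℝ) / (rad x : ℂ) ^ 2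

/-- `σ³ = dφ̃ + cos θ̃ dψ̃`. -/
def sig3 : CoField := fun x κ => 2 * (![0, -x 2, x 1, -x 4, x 3] κ : ℝ) / (rad x : ℂ) ^ 2

/-- `σ̄³ = σ³ / 2`. -/
def bsig3 : CoField := fun x κ => sig3 x κ / 2

/-- `σ̄⁺ = (σ̄¹ + i σ̄²) / √2`, where `σ̄ⁱ = σⁱ / 2`. -/
def bsigP : CoField := fun x κ =>
  (sig1 x κ / 2 + Complex.I * (sig2 x κ / 2)) / (Real.sqrt 2 : ℂ)

/-- `σ̄⁻ = (σ̄¹ - i σ̄²) / √2`, where `σ̄ⁱ = σⁱ / 2`. -/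
def bsigM : CoField := fun x κ =>
  (sig1 x κ / 2 - Complex.I * (sig2 x κ / 2)) / (Real.sqrt 2 : ℂ)

/-- The coframe `(dt, dr̃, σ̄⁺, σ̄⁻, σ̄³)`, in this order. -/
def coframe : Fin 5 → CoField := ![dt, dr, bsigP, bsigM, bsig3]

/-! ### Metric, Killing–Yano form, symmetry operator -/

/-- The Myers–Perry metric
`-dt² + dr̃² / G + r̃² (σ̄⁺ σ̄⁻ + σ̄⁻ σ̄⁺ + σ̄³ σ̄³) + (μ / r̃²) (dt - a σ̄³)²`. -/
def metric (μ a : ℝ) : Tensor2 := fun x κ τ =>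
  -(dt x κ * dt x τ) + dr x κ * dr x τ / (G μ a (rad x) : ℂ)
    + (rad x : ℂ) ^ 2 * (bsigP x κ * bsigM x τ + bsigM x κ * bsigP x τ + bsig3 x κ * bsig3 x τ)
    + (μ : ℂ) / (rad x : ℂ) ^ 2 *
        ((dt x κ - (a : ℂ) * bsig3 x κ) * (dt x τ - (a : ℂ) * bsig3 x τ))

/-- Components `(α ∧ β ∧ γ)_{κτν}` of the wedge product of three covectors. -/
def wedge3 (α β γ : Fin 5 → ℂ) (κ τ ν : Fin 5) : ℂ :=
  Matrix.det !![α κ, α τ, α ν; β κ, β τ, β ν; γ κ, γ τ, γ ν]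

/-- The Killing–Yano 3-form
`f = -a r̃ dt ∧ dr̃ ∧ σ̄³ - i r̃² σ̄⁺ ∧ σ̄⁻ ∧ (-a dt + r̃² σ̄³)`. -/
def killingYano (a : ℝ) : Pt → Fin 5 → Fin 5 → Fin 5 → ℂ := fun x κ τ ν =>
  -((a : ℂ) * (rad x : ℂ) * wedge3 (dt x) (dr x) (bsig3 x) κ τ ν)
    - Complex.I * (rad x : ℂ) ^ 2 *
      wedge3 (bsigP x) (bsigM x) (fun i => -(a : ℂ) * dt x i + (rad x : ℂ) ^ 2 * bsig3 x i) κ τ ν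

/-- The partial derivative `∂_κ F` in the global chart. -/
def pd (κ : Fin 5) (F : Pt → ℂ) (x : Pt) : ℂ := fderiv ℝ F x (Pi.single κ 1)

/-- Components `g^{κτ}` of the inverse metric. -/
def invMetric (μ a : ℝ) (x : Pt) (κ τ : Fin 5) : ℂ :=
  (Matrix.of (metric μ a x))⁻¹ κ τ

/-- Christoffel symbols `Γ^ρ_{κτ}` of the Levi-Civita connection. -/
def christoffel (μ a : ℝ) (x : Pt) (ρ κ τ : Fin 5) : ℂ :=
  (1 / 2) * ∑ ν, invMetric μ a x ρ ν *
    (pd κ (fun y => metric μ a y ν τ) x + pd τ (fun y => metric μ a y κ ν) x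
      - pd ν (fun y => metric μ a y κ τ) x)

/-- The covariant derivative `∇_κ h_{ρτ}`. -/
def covD (μ a : ℝ) (h : Tensor2) (x : Pt) (κ ρ τ : Fin 5) : ℂ :=
  pd κ (fun y => h y ρ τ) x
    - ∑ ν, (christoffel μ a x ν κ ρ * h x ν τ + christoffel μ a x ν κ τ * h x ρ ν)

/-- `f_λ{}^{κτ}`, the Killing–Yano form with its last two indices raised. -/
def killingYanoUp (μ a : ℝ) (x : Pt) (l κ τ : Fin 5) : ℂ :=
  ∑ α, ∑ β, killingYano a x l α β * invMetric μ a x α κ * invMetric μ a x β τ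

/-- The symmetry operator
`(S h)_{λρ} = 2 f_{(λ}{}^{κτ} ∇_{|κ|} h_{ρ)τ} = f_λ{}^{κτ} ∇_κ h_{ρτ} + f_ρ{}^{κτ} ∇_κ h_{λτ}`. -/
def symOp (μ a : ℝ) (h : Tensor2) : Tensor2 := fun x l ρ =>
  ∑ κ, ∑ τ, (killingYanoUp μ a x l κ τ * covD μ a h x κ ρ τ
    + killingYanoUp μ a x ρ κ τ * covD μ a h x κ l τ)

/-! ### The generators and their Lie derivatives -/

/-- The action `X^κ ∂_κ F` of a vector field on a function. -/
def vecAct (X : VField) (F : Pt → ℂ) (x : Pt) : ℂ := ∑ κ, X x κ * pd κ F x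

/-- The Lie derivative of a covariant rank-2 tensor field. -/
def lieD (X : VField) (h : Tensor2) : Tensor2 := fun x κ τ =>
  vecAct X (fun y => h y κ τ) x
    + ∑ ν, (pd κ (fun y => X y ν) x * h x ν τ + pd τ (fun y => X y ν) x * h x κ ν)

/-- The left-invariant fields `σ₁, σ₂, σ₃` of the sphere, dual to `σ¹, σ², σ³`:
`σ₁ = -sin φ̃ ∂_θ̃ - cot θ̃ cos φ̃ ∂_φ̃ + csc θ̃ cos φ̃ ∂_ψ̃`,
`σ₂ = -cos φ̃ ∂_θ̃ + cot θ̃ sin φ̃ ∂_φ̃ - csc θ̃ sin φ̃ ∂_ψ̃`, `σ₃ = ∂_φ̃`. -/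
def sigVec (i : Fin 3) : VField := fun x κ =>
  ((![![0, -x 4, -x 3, x 2, x 1],
      ![0, -x 3, x 4, x 1, -x 2],
      ![0, -x 2, x 1, -x 4, x 3]] i κ : ℝ) : ℂ) / 2

/-- The right-invariant fields `ξ₁, ξ₂, ξ₃` of the sphere:
`ξ₁ = -sin ψ̃ ∂_θ̃ + csc θ̃ cos ψ̃ ∂_φ̃ - cot θ̃ cos ψ̃ ∂_ψ̃`,
`ξ₂ = -cos ψ̃ ∂_θ̃ - csc θ̃ sin ψ̃ ∂_φ̃ + cot θ̃ sin ψ̃ ∂_ψ̃`, `ξ₃ = ∂_ψ̃`. -/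
def xiVec (i : Fin 3) : VField := fun x κ =>
  ((![![0, -x 4, x 3, -x 2, x 1],
      ![0, -x 3, -x 4, x 1, x 2],
      ![0, x 2, -x 1, -x 4, x 3]] i κ : ℝ) : ℂ) / 2

/-- `W_i = i σ_i`; the index `i = 0, 1, 2` stands for `W₁, W₂, W₃`. -/
def W (i : Fin 3) : VField := fun x κ => Complex.I * sigVec i x κ

/-- `L_i = i ξ_i`; the index `i = 0, 1, 2` stands for `L₁, L₂, L₃`. -/
def L (i : Fin 3) : VField := fun x κ => Complex.I * xiVec i x κ

/-- `i ∂_t`, the generator of time translations. -/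
def T : VField := fun _ => ![Complex.I, 0, 0, 0, 0]

/-! ### The global chart and the Euler angles

Helper facts: in the coordinates `(t, r̃, θ̃, φ̃, ψ̃)` the covector and vector fields above have the
components displayed in their descriptions. -/

/-- The change of coordinates `(t, r̃, θ̃, φ̃, ψ̃) ↦ (t, x₁, x₂, x₃, x₄)`. -/
def euler (y : Pt) : Pt :=
  ![y 0, y 1 * Real.sin (y 2 / 2) * Real.cos ((y 3 - y 4) / 2),
    y 1 * Real.sin (y 2 / 2) * Real.sin ((y 3 - y 4) / 2),
    y 1 * Real.cos (y 2 / 2) * Real.cos ((y 3 + y 4) / 2),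
    y 1 * Real.cos (y 2 / 2) * Real.sin ((y 3 + y 4) / 2)]

/-- The Jacobian `∂ x^κ / ∂ y^j` of the change of coordinates. -/
def jac (y : Pt) (j κ : Fin 5) : ℝ := deriv (fun s => euler (Function.update y j s) κ) (y j)

theorem jac_eq (y : Pt) (j κ : Fin 5) : jac y j κ =
    (![![1, 0, 0, 0, 0],
      ![0, Real.sin (y 2 / 2) * Real.cos ((y 3 - y 4) / 2),
        Real.sin (y 2 / 2) * Real.sin ((y 3 - y 4) / 2),
        Real.cos (y 2 / 2) * Real.cos ((y 3 + y 4) / 2),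
        Real.cos (y 2 / 2) * Real.sin ((y 3 + y 4) / 2)],
      ![0, y 1 * Real.cos (y 2 / 2) * Real.cos ((y 3 - y 4) / 2) / 2,
        y 1 * Real.cos (y 2 / 2) * Real.sin ((y 3 - y 4) / 2) / 2,
        -(y 1 * Real.sin (y 2 / 2) * Real.cos ((y 3 + y 4) / 2)) / 2,
        -(y 1 * Real.sin (y 2 / 2) * Real.sin ((y 3 + y 4) / 2)) / 2],
      ![0, -(y 1 * Real.sin (y 2 / 2) * Real.sin ((y 3 - y 4) / 2)) / 2,
        y 1 * Real.sin (y 2 / 2) * Real.cos ((y 3 - y 4) / 2) / 2,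
        -(y 1 * Real.cos (y 2 / 2) * Real.sin ((y 3 + y 4) / 2)) / 2,
        y 1 * Real.cos (y 2 / 2) * Real.cos ((y 3 + y 4) / 2) / 2],
      ![0, y 1 * Real.sin (y 2 / 2) * Real.sin ((y 3 - y 4) / 2) / 2,
        -(y 1 * Real.sin (y 2 / 2) * Real.cos ((y 3 - y 4) / 2)) / 2,
        -(y 1 * Real.cos (y 2 / 2) * Real.sin ((y 3 + y 4) / 2)) / 2,
        y 1 * Real.cos (y 2 / 2) * Real.cos ((y 3 + y 4) / 2) / 2]] : Fin 5 → Pt) j κ := by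
  have h1 : ∀ s : ℝ, HasDerivAt (fun u : ℝ => Real.sin (u / 2)) (Real.cos (s / 2) / 2) s := fun s => by
    simpa [div_eq_mul_inv] using ((hasDerivAt_id s).div_const 2).sin
  have h2 : ∀ s : ℝ, HasDerivAt (fun u : ℝ => Real.cos (u / 2)) (-Real.sin (s / 2) / 2) s := fun s => by
    simpa [div_eq_mul_inv] using ((hasDerivAt_id s).div_const 2).cos
  have h3 : ∀ c s : ℝ, HasDerivAt (fun u : ℝ => Real.sin ((u - c) / 2)) (Real.cos ((s - c) / 2) / 2) s :=
    fun c s => by simpa [div_eq_mul_inv] using (((hasDerivAt_id s).sub_const c).div_const 2).sin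
  have h4 : ∀ c s : ℝ, HasDerivAt (fun u : ℝ => Real.cos ((u - c) / 2)) (-Real.sin ((s - c) / 2) / 2) s :=
    fun c s => by simpa [div_eq_mul_inv] using (((hasDerivAt_id s).sub_const c).div_const 2).cos
  have h5 : ∀ c s : ℝ, HasDerivAt (fun u : ℝ => Real.sin ((c - u) / 2)) (-Real.cos ((c - s) / 2) / 2) s :=
    fun c s => by simpa [div_eq_mul_inv] using (((hasDerivAt_id s).const_sub c).div_const 2).sin
  have h6 : ∀ c s : ℝ, HasDerivAt (fun u : ℝ => Real.cos ((c - u) / 2)) (Real.sin ((c - s) / 2) / 2) s :=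
    fun c s => by simpa [div_eq_mul_inv] using (((hasDerivAt_id s).const_sub c).div_const 2).cos
  have h7 : ∀ c s : ℝ, HasDerivAt (fun u : ℝ => Real.sin ((u + c) / 2)) (Real.cos ((s + c) / 2) / 2) s :=
    fun c s => by simpa [div_eq_mul_inv] using (((hasDerivAt_id s).add_const c).div_const 2).sin
  have h8 : ∀ c s : ℝ, HasDerivAt (fun u : ℝ => Real.cos ((u + c) / 2)) (-Real.sin ((s + c) / 2) / 2) s :=
    fun c s => by simpa [div_eq_mul_inv] using (((hasDerivAt_id s).add_const c).div_const 2).cos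
  have h9 : ∀ c s : ℝ, HasDerivAt (fun u : ℝ => Real.sin ((c + u) / 2)) (Real.cos ((c + s) / 2) / 2) s :=
    fun c s => by simpa [div_eq_mul_inv] using (((hasDerivAt_id s).const_add c).div_const 2).sin
  have h10 : ∀ c s : ℝ, HasDerivAt (fun u : ℝ => Real.cos ((c + u) / 2)) (-Real.sin ((c + s) / 2) / 2) s :=
    fun c s => by simpa [div_eq_mul_inv] using (((hasDerivAt_id s).const_add c).div_const 2).cos
  fin_cases j <;> fin_cases κ <;>
    simp [jac, euler, Function.update, (h1 _).deriv, (h2 _).deriv, (h3 _ _).deriv, (h4 _ _).deriv,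
      (h5 _ _).deriv, (h6 _ _).deriv, (h7 _ _).deriv, (h8 _ _).deriv, (h9 _ _).deriv,
      (h10 _ _).deriv] <;> ring

theorem rad_euler (y : Pt) (hr : 0 < y 1) : rad (euler y) = y 1 := by
  have h : euler y 1 ^ 2 + euler y 2 ^ 2 + euler y 3 ^ 2 + euler y 4 ^ 2 = y 1 ^ 2 := by
    simp only [euler, Matrix.cons_val]
    linear_combination
      y 1 ^ 2 * Real.sin (y 2 / 2) ^ 2 * Real.sin_sq_add_cos_sq ((y 3 - y 4) / 2)
        + y 1 ^ 2 * Real.cos (y 2 / 2) ^ 2 * Real.sin_sq_add_cos_sq ((y 3 + y 4) / 2)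
        + y 1 ^ 2 * Real.sin_sq_add_cos_sq (y 2 / 2)
  rw [rad, h, Real.sqrt_sq hr.le]


theorem half_angles (y : Pt) : ∃ A B C : ℝ, (y 3 - y 4) / 2 = A ∧ (y 3 + y 4) / 2 = B ∧ y 2 / 2 = C ∧
    y 3 = A + B ∧ y 4 = B - A ∧ y 2 = 2 * C :=
  ⟨_, _, _, rfl, rfl, rfl, by ring, by ring, by ring⟩

/-- The pullbacks of `dr̃, σ¹, σ², σ³`. -/
theorem coframe_euler (y : Pt) (hr : 0 < y 1) (j : Fin 5) :
    ∑ κ, dr (euler y) κ * jac y j κ = ((![0, 1, 0, 0, 0] j : ℝ) : ℂ) ∧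
    ∑ κ, sig1 (euler y) κ * jac y j κ =
      ((![0, 0, -Real.sin (y 3), 0, Real.cos (y 3) * Real.sin (y 2)] j : ℝ) : ℂ) ∧
    ∑ κ, sig2 (euler y) κ * jac y j κ =
      ((![0, 0, -Real.cos (y 3), 0, -(Real.sin (y 3) * Real.sin (y 2))] j : ℝ) : ℂ) ∧
    ∑ κ, sig3 (euler y) κ * jac y j κ = ((![0, 0, 0, 1, Real.cos (y 2)] j : ℝ) : ℂ) := by
  simp only [dr, sig1, sig2, sig3, rad_euler y hr, jac_eq]
  simp only [euler]
  obtain ⟨A, B, C, hA, hB, hC, h3, h4, h2⟩ := half_angles y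
  rw [hA, hB, hC, h3, h2, Real.sin_add, Real.cos_add, Real.sin_two_mul, Real.cos_two_mul]
  have h0 := hr.ne'
  have pA := Real.sin_sq_add_cos_sq A
  have pB := Real.sin_sq_add_cos_sq B
  have pC := Real.sin_sq_add_cos_sq C
  norm_cast
  generalize y 1 = r at *
  generalize Real.sin A = sA at *
  generalize Real.cos A = cA at *
  generalize Real.sin B = sB at *
  generalize Real.cos B = cB at *
  generalize Real.sin C = sC at *
  generalize Real.cos C = cC at *
  refine ⟨?_, ?_, ?_, ?_⟩ <;> fin_cases j <;> simp [Fin.sum_univ_five] <;> field_simp <;> grind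

/-- The components of `σ₁, σ₂, σ₃` away from the poles. -/
theorem sigVec_euler (y : Pt) (hs : Real.sin (y 2) ≠ 0) (κ : Fin 5) :
    sigVec 0 (euler y) κ = ∑ j, ((![0, 0, -Real.sin (y 3), -(Real.cos (y 2) / Real.sin (y 2) * Real.cos (y 3)),
      1 / Real.sin (y 2) * Real.cos (y 3)] j * jac y j κ : ℝ) : ℂ) ∧
    sigVec 1 (euler y) κ = ∑ j, ((![0, 0, -Real.cos (y 3), Real.cos (y 2) / Real.sin (y 2) * Real.sin (y 3),
      -(1 / Real.sin (y 2) * Real.sin (y 3))] j * jac y j κ : ℝ) : ℂ) ∧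
    sigVec 2 (euler y) κ = ∑ j, ((![0, 0, 0, 1, 0] j * jac y j κ : ℝ) : ℂ) := by
  simp only [sigVec, jac_eq, euler]
  obtain ⟨A, B, C, hA, hB, hC, h3, h4, h2⟩ := half_angles y
  rw [h2, Real.sin_two_mul] at hs
  rw [hA, hB, hC, h3, h2, Real.sin_add, Real.cos_add, Real.sin_two_mul, Real.cos_two_mul]
  have pA := Real.sin_sq_add_cos_sq A
  have pB := Real.sin_sq_add_cos_sq B
  have pC := Real.sin_sq_add_cos_sq C
  norm_cast
  generalize y 1 = r at *
  generalize Real.sin A = sA at *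
  generalize Real.cos A = cA at *
  generalize Real.sin B = sB at *
  generalize Real.cos B = cB at *
  generalize Real.sin C = sC at *
  generalize Real.cos C = cC at *
  have hs1 : sC ≠ 0 := by rintro rfl; simp at hs
  have hs2 : cC ≠ 0 := by rintro rfl; simp at hs
  refine ⟨?_, ?_, ?_⟩ <;> fin_cases κ <;> simp [Fin.sum_univ_five] <;> norm_cast <;> field_simp <;> grind

/-- The components of `ξ₁, ξ₂, ξ₃` away from the poles. -/
theorem xiVec_euler (y : Pt) (hs : Real.sin (y 2) ≠ 0) (κ : Fin 5) :
    xiVec 0 (euler y) κ = ∑ j, ((![0, 0, -Real.sin (y 4), 1 / Real.sin (y 2) * Real.cos (y 4),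
      -(Real.cos (y 2) / Real.sin (y 2) * Real.cos (y 4))] j * jac y j κ : ℝ) : ℂ) ∧
    xiVec 1 (euler y) κ = ∑ j, ((![0, 0, -Real.cos (y 4), -(1 / Real.sin (y 2) * Real.sin (y 4)),
      Real.cos (y 2) / Real.sin (y 2) * Real.sin (y 4)] j * jac y j κ : ℝ) : ℂ) ∧
    xiVec 2 (euler y) κ = ∑ j, ((![0, 0, 0, 0, 1] j * jac y j κ : ℝ) : ℂ) := by
  simp only [xiVec, jac_eq, euler]
  obtain ⟨A, B, C, hA, hB, hC, h3, h4, h2⟩ := half_angles y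
  rw [h2, Real.sin_two_mul] at hs
  rw [hA, hB, hC, h4, h2, Real.sin_sub, Real.cos_sub, Real.sin_two_mul, Real.cos_two_mul]
  have pA := Real.sin_sq_add_cos_sq A
  have pB := Real.sin_sq_add_cos_sq B
  have pC := Real.sin_sq_add_cos_sq C
  norm_cast
  generalize y 1 = r at *
  generalize Real.sin A = sA at *
  generalize Real.cos A = cA at *
  generalize Real.sin B = sB at *
  generalize Real.cos B = cB at *
  generalize Real.sin C = sC at *
  generalize Real.cos C = cC at *
  have hs1 : sC ≠ 0 := by rintro rfl; simp at hs
  have hs2 : cC ≠ 0 := by rintro rfl; simp at hs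
  refine ⟨?_, ?_, ?_⟩ <;> fin_cases κ <;> simp [Fin.sum_univ_five] <;> norm_cast <;> field_simp <;> grind

/-! ### Wigner functions and modes -/

/-- `sin (θ̃/2) exp (i (φ̃ - ψ̃)/2)` as a function on the spacetime. -/
def zed (x : Pt) : ℂ := ((x 1 : ℂ) + Complex.I * x 2) / rad x

/-- `cos (θ̃/2) exp (i (φ̃ + ψ̃)/2)` as a function on the spacetime. -/
def wed (x : Pt) : ℂ := ((x 3 : ℂ) + Complex.I * x 4) / rad x

open Polynomial in
/-- The Wigner functions with integer indices `n = 2J`, `p = J + K`, `q = J + M`: up to the usual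
normalization, the coefficient of `X ^ p` in `(w̄ X + z) ^ q (z̄ X - w) ^ (n - q)`, i.e. a matrix element
of the spin-`J` representation of the element of `SU(2)` given by `(z, w)`. -/
def wignerNat (n p q : ℕ) (x : Pt) : ℂ :=
  (Real.sqrt ((p.factorial * (n - p).factorial : ℝ) / (q.factorial * (n - q).factorial)) : ℂ) *
    ((C (starRingEnd ℂ (wed x)) * X + C (zed x)) ^ q *
      (C (starRingEnd ℂ (zed x)) * X - C (wed x)) ^ (n - q)).coeff p

/-- The labels of the Wigner functions: `J ∈ {0, 1/2, 1, …}` and `K, M ∈ {-J, -J + 1, …, J}`. -/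
def IsLabel (J K M : ℝ) : Prop :=
  ∃ n p q : ℕ, p ≤ n ∧ q ≤ n ∧ J = (n : ℝ) / 2 ∧ K = p - (n : ℝ) / 2 ∧ M = q - (n : ℝ) / 2

open Classical in
/-- The Wigner functions `𝔻^J_{KM}`, with the convention that `𝔻^J_{KM} = 0` if `(J, K, M)` is not
one of the labels. -/
def wignerD (J K M : ℝ) (x : Pt) : ℂ :=
  if IsLabel J K M then wignerNat ⌊2 * J⌋₊ ⌊J + K⌋₊ ⌊J + M⌋₊ x else 0

/-- The `W₃`-charges of `(dt, dr̃, σ̄⁺, σ̄⁻, σ̄³)`. -/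
def charge : Fin 5 → ℝ := ![0, 0, 1, -1, 0]

/-- The mode `h^J_{KM}` with coefficients `H_{bc}(t, r̃)`: the sum over the coframe of
`H_{bc}(t, r̃) 𝔻^J_{K - charge b - charge c, M} σ̄^b ⊗ σ̄^c`. -/
def modeTensor (J K M : ℝ) (H : ℝ × ℝ → Fin 5 → Fin 5 → ℂ) : Tensor2 := fun x κ τ =>
  ∑ b, ∑ c, H (x 0, rad x) b c * wignerD J (K - charge b - charge c) M x *
    (coframe b x κ * coframe c x τ)

/-- On the spacetime `h` is a mode with labels `(J, K, M)` whose coefficients form a symmetric array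
of functions of `(t, r̃)` of class `C^k`. -/
def IsMode (μ a : ℝ) (k : ℕ∞) (J K M : ℝ) (h : Tensor2) : Prop :=
  ∃ H : ℝ × ℝ → Fin 5 → Fin 5 → ℂ,
    ContDiffOn ℝ k H (orbitSpace μ a) ∧ (∀ s ∈ orbitSpace μ a, ∀ b c, H s b c = H s c b) ∧
      ∀ x ∈ spacetime μ a, h x = modeTensor J K M H x

end MyersPerry

end

open MyersPerry

noncomputable section

namespace MyersPerry

open scoped BigOperators ContDiff Topology

/-! ### Partial derivatives -/

section Calculus

variable {x : Pt} {F F' : Pt → ℂ} {κ : Fin 5}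

/-! In the coframe `(dt, dr̃, σ̄⁺, σ̄⁻, σ̄³)` the components of the metric, of the Killing–Yano form
and of the derivatives of the coframe depend on `r̃` alone; hence so do those of the connection. All
these components are neutral: they vanish unless the charges of their indices (`+1` for `σ̄⁺`, `-1`
for `σ̄⁻`, `0` otherwise) balance. In this frame the symmetry operator becomes `symFrame`, a
first-order expression with smooth, radial, neutral coefficients (`symOp_eq`). Nothing else about it
is needed: no explicit connection is computed, and the Killing–Yano equation plays no role.

The pivot is `symFrame_charge`: multiplying the components and their frame derivatives by an
arbitrary function `u` of the total charge of their indices multiplies the result by `u` of the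
total charge of its own indices. It is used twice.

Modes: the frame vector `e_i` sends `𝔻^J_{KM}` to a multiple of `𝔻^J_{K - q_i, M}`
(`vecAct_frame_wignerD`). With `u q = 𝔻^J_{K - q, M}` all Wigner functions factor out, and functions
of `(t, r̃)` remain, with one derivative spent (`isMode_symOp`).

Commutation: `W₃`, `L_i` and `i ∂_t` preserve `r̃` and scale the coframe by `w` times the charge,
with `w = 1` for `W₃` and `w = 0` for the others (`IsGenerator`). So the Lie derivative acts on
components as `X + w (q_b + q_c)`, while `[X, e_i] = -w q_i e_i`. With `u q = w q` the charge terms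
match (`IsGenerator.symOp_lieD`). The commutators of the generators among themselves reduce to
vanishing Lie brackets (`IsGenerator.lieD_comm`).

Wigner functions: they are the coefficients of `A ^ q * B ^ (n - q)` with `A = w̄ X + z`, `B = z̄ X
- w`. The `W`'s act on `A` and `B` as the `sl₂` operators in the auxiliary variable, the `L`'s mix
`A` with `B`; the Leibniz rule and the square-root normalization give the ladder relations.

On `ℝ⁴` the fields `σ_i` and `ξ_i` are linear, namely multiplications by quaternion units on the two
sides, so the verifications become finite matrix identities. -/

theorem pd_congr (h : F =ᶠ[𝓝 x] F') : pd κ F x = pd κ F' x := by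
  simp only [pd, h.fderiv_eq]

theorem pd_const (c : ℂ) : pd κ (fun _ => c) x = 0 := by simp [pd]

theorem pd_add (h : DifferentiableAt ℝ F x) (h' : DifferentiableAt ℝ F' x) :
    pd κ (fun y => F y + F' y) x = pd κ F x + pd κ F' x := by
  simp [pd, fderiv_fun_add h h']

theorem pd_mul (h : DifferentiableAt ℝ F x) (h' : DifferentiableAt ℝ F' x) :
    pd κ (fun y => F y * F' y) x = pd κ F x * F' x + F x * pd κ F' x := by
  simp [pd, fderiv_fun_mul h h']; ring

theorem pd_const_mul (c : ℂ) (h : DifferentiableAt ℝ F x) :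
    pd κ (fun y => c * F y) x = c * pd κ F x := by
  rw [pd_mul (differentiableAt_const c) h, pd_const]; ring

theorem pd_sum {ι : Type*} {s : Finset ι} {F : ι → Pt → ℂ}
    (h : ∀ i ∈ s, DifferentiableAt ℝ (F i) x) :
    pd κ (fun y => ∑ i ∈ s, F i y) x = ∑ i ∈ s, pd κ (F i) x := by
  simp [pd, fderiv_fun_sum h]

variable {X : VField}

theorem vecAct_congr (h : F =ᶠ[𝓝 x] F') : vecAct X F x = vecAct X F' x := by
  simp only [vecAct, pd_congr h]

theorem vecAct_const (c : ℂ) : vecAct X (fun _ => c) x = 0 := by simp [vecAct, pd_const]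

theorem vecAct_add (h : DifferentiableAt ℝ F x) (h' : DifferentiableAt ℝ F' x) :
    vecAct X (fun y => F y + F' y) x = vecAct X F x + vecAct X F' x := by
  simp [vecAct, pd_add h h', mul_add, Finset.sum_add_distrib]

theorem vecAct_mul (h : DifferentiableAt ℝ F x) (h' : DifferentiableAt ℝ F' x) :
    vecAct X (fun y => F y * F' y) x = vecAct X F x * F' x + F x * vecAct X F' x := by
  simp only [vecAct, pd_mul h h', mul_add, Finset.sum_add_distrib, Finset.sum_mul, Finset.mul_sum]
  congr 1 <;> exact Finset.sum_congr rfl fun _ _ => by ring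

theorem vecAct_const_mul (c : ℂ) (h : DifferentiableAt ℝ F x) :
    vecAct X (fun y => c * F y) x = c * vecAct X F x := by
  rw [vecAct_mul (differentiableAt_const c) h, vecAct_const]; ring

theorem vecAct_sum {ι : Type*} {s : Finset ι} {F : ι → Pt → ℂ}
    (h : ∀ i ∈ s, DifferentiableAt ℝ (F i) x) :
    vecAct X (fun y => ∑ i ∈ s, F i y) x = ∑ i ∈ s, vecAct X (F i) x := by
  simp only [vecAct, pd_sum h, Finset.mul_sum]
  exact Finset.sum_comm

end Calculus

/-! ### Linear functions and the radius -/

/-- The components of a linear map, as functions on the chart. -/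
def lin (N : Matrix (Fin 5) (Fin 5) ℂ) (x : Pt) (κ : Fin 5) : ℂ := ∑ ν, N κ ν * (x ν : ℂ)

theorem contDiff_coord (ν : Fin 5) : ContDiff ℝ ∞ (fun x : Pt => (x ν : ℂ)) :=
  Complex.ofRealCLM.contDiff.comp (contDiff_apply ℝ ℝ ν)

theorem pd_coord (κ ν : Fin 5) (x : Pt) :
    pd κ (fun x : Pt => (x ν : ℂ)) x = if ν = κ then 1 else 0 := by
  have h : HasFDerivAt (fun x : Pt => (x ν : ℂ))
      (Complex.ofRealCLM.comp (ContinuousLinearMap.proj (R := ℝ) (φ := fun _ : Fin 5 => ℝ) ν)) x :=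
    (Complex.ofRealCLM.comp
      (ContinuousLinearMap.proj (R := ℝ) (φ := fun _ : Fin 5 => ℝ) ν)).hasFDerivAt
  simp [pd, h.fderiv, Pi.single_apply, apply_ite]

theorem contDiff_lin (N : Matrix (Fin 5) (Fin 5) ℂ) (κ : Fin 5) :
    ContDiff ℝ ∞ (fun x => lin N x κ) :=
  ContDiff.sum fun ν _ => contDiff_const.mul (contDiff_coord ν)

theorem differentiableAt_lin (N : Matrix (Fin 5) (Fin 5) ℂ) (κ : Fin 5) (x : Pt) :
    DifferentiableAt ℝ (fun x => lin N x κ) x :=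
  (contDiff_lin N κ).differentiable (by simp) x

theorem pd_lin (N : Matrix (Fin 5) (Fin 5) ℂ) (κ τ : Fin 5) (x : Pt) :
    pd κ (fun x => lin N x τ) x = N τ κ := by
  have hd : ∀ ν, DifferentiableAt ℝ (fun x : Pt => (x ν : ℂ)) x := fun ν =>
    (contDiff_coord ν).differentiable (by simp) x
  unfold lin
  rw [pd_sum fun ν _ => (hd ν).const_mul _]
  simp [pd_const_mul _ (hd _), pd_coord]

theorem vecAct_lin (X : VField) (N : Matrix (Fin 5) (Fin 5) ℂ) (τ : Fin 5) (x : Pt) :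
    vecAct X (fun x => lin N x τ) x = ∑ κ, N τ κ * X x κ := by
  simp only [vecAct, pd_lin, mul_comm]

/-- Orthogonal projection onto the spatial directions. -/
def matP : Matrix (Fin 5) (Fin 5) ℂ :=
  !![0, 0, 0, 0, 0; 0, 1, 0, 0, 0; 0, 0, 1, 0, 0; 0, 0, 0, 1, 0; 0, 0, 0, 0, 1]

theorem rad_sq_pos {x : Pt} (hx : 0 < rad x) : 0 < x 1 ^ 2 + x 2 ^ 2 + x 3 ^ 2 + x 4 ^ 2 :=
  Real.sqrt_pos.1 hx

theorem rad_sq (x : Pt) : rad x ^ 2 = x 1 ^ 2 + x 2 ^ 2 + x 3 ^ 2 + x 4 ^ 2 :=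
  Real.sq_sqrt (by positivity)

theorem radC_sq (x : Pt) : (rad x : ℂ) ^ 2 = x 1 ^ 2 + x 2 ^ 2 + x 3 ^ 2 + x 4 ^ 2 := by
  exact_mod_cast congrArg (fun r : ℝ => (r : ℂ)) (rad_sq x)

theorem continuous_rad : Continuous rad := by unfold rad; fun_prop

theorem contDiffAt_rad {x : Pt} (hx : 0 < rad x) {n : WithTop ℕ∞} : ContDiffAt ℝ n rad x := by
  have := rad_sq_pos hx
  exact ContDiffAt.sqrt (f := fun x : Pt => x 1 ^ 2 + x 2 ^ 2 + x 3 ^ 2 + x 4 ^ 2)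
    (by fun_prop) this.ne'

theorem hasFDerivAt_rad {x : Pt} (hx : 0 < rad x) :
    HasFDerivAt rad (∑ i : Fin 4, (x i.succ / rad x) •
      ContinuousLinearMap.proj (R := ℝ) (φ := fun _ : Fin 5 => ℝ) i.succ) x := by
  have hs := rad_sq_pos hx
  have hp : ∀ i : Fin 5, HasFDerivAt (fun y : Pt => y i)
      (ContinuousLinearMap.proj (R := ℝ) (φ := fun _ : Fin 5 => ℝ) i) x := fun i =>
    (ContinuousLinearMap.proj (R := ℝ) (φ := fun _ : Fin 5 => ℝ) i).hasFDerivAt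
  have h := (((((hp 1).pow 2).add ((hp 2).pow 2)).add ((hp 3).pow 2)).add ((hp 4).pow 2)).sqrt hs.ne'
  refine h.congr_fderiv ?_
  have hr : √(x 1 ^ 2 + x 2 ^ 2 + x 3 ^ 2 + x 4 ^ 2) = rad x := rfl
  have h0 := hx.ne'
  ext v
  simp [Fin.sum_univ_four]
  rw [hr]
  field_simp

theorem dr_eq (x : Pt) (κ : Fin 5) : dr x κ = lin matP x κ / (rad x : ℂ) := by
  fin_cases κ <;> simp [dr, lin, matP, Fin.sum_univ_five]

theorem pd_comp_rad {x : Pt} (hx : 0 < rad x) {f : ℝ → ℂ} (hf : DifferentiableAt ℝ f (rad x))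
    (κ : Fin 5) : pd κ (fun y => f (rad y)) x = deriv f (rad x) * dr x κ := by
  have h := hf.hasFDerivAt.comp x (hasFDerivAt_rad hx)
  have h2 : ∀ s : ℝ, fderiv ℝ f (rad x) s = s * deriv f (rad x) := fun s => by
    rw [← fderiv_apply_one_eq_deriv, ← Complex.real_smul, ← map_smul]; simp
  rw [pd, show (fun y => f (rad y)) = f ∘ rad from rfl, h.fderiv]
  fin_cases κ <;> simp [h2, dr, Fin.sum_univ_four] <;> ring

theorem differentiableAt_comp_rad {x : Pt} (hx : 0 < rad x) {f : ℝ → ℂ}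
    (hf : DifferentiableAt ℝ f (rad x)) : DifferentiableAt ℝ (fun y => f (rad y)) x :=
  hf.comp x ((contDiffAt_rad (n := 1) hx).differentiableAt (by simp))

/-! ### Frame and coframe -/

/-- The matrices of the linear fields `2 σ_i`. -/
def matS : Fin 3 → Matrix (Fin 5) (Fin 5) ℂ :=
  ![!![0, 0, 0, 0, 0; 0, 0, 0, 0, -1; 0, 0, 0, -1, 0; 0, 0, 1, 0, 0; 0, 1, 0, 0, 0],
    !![0, 0, 0, 0, 0; 0, 0, 0, -1, 0; 0, 0, 0, 0, 1; 0, 1, 0, 0, 0; 0, 0, -1, 0, 0],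
    !![0, 0, 0, 0, 0; 0, 0, -1, 0, 0; 0, 1, 0, 0, 0; 0, 0, 0, 0, -1; 0, 0, 0, 1, 0]]

/-- The matrices of the linear fields `2 ξ_i`. -/
def matXi : Fin 3 → Matrix (Fin 5) (Fin 5) ℂ :=
  ![!![0, 0, 0, 0, 0; 0, 0, 0, 0, -1; 0, 0, 0, 1, 0; 0, 0, -1, 0, 0; 0, 1, 0, 0, 0],
    !![0, 0, 0, 0, 0; 0, 0, 0, -1, 0; 0, 0, 0, 0, -1; 0, 1, 0, 0, 0; 0, 0, 1, 0, 0],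
    !![0, 0, 0, 0, 0; 0, 0, 1, 0, 0; 0, -1, 0, 0, 0; 0, 0, 0, 0, -1; 0, 0, 0, 1, 0]]

theorem sigVec_eq (i : Fin 3) (x : Pt) (κ : Fin 5) : sigVec i x κ = lin (matS i) x κ / 2 := by
  fin_cases i <;> fin_cases κ <;> simp [sigVec, lin, matS, Fin.sum_univ_five]

theorem xiVec_eq (i : Fin 3) (x : Pt) (κ : Fin 5) : xiVec i x κ = lin (matXi i) x κ / 2 := by
  fin_cases i <;> fin_cases κ <;> simp [xiVec, lin, matXi, Fin.sum_univ_five]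

theorem sig_eq (x : Pt) (κ : Fin 5) :
    sig1 x κ = 2 * lin (matS 0) x κ / (rad x : ℂ) ^ 2 ∧
    sig2 x κ = 2 * lin (matS 1) x κ / (rad x : ℂ) ^ 2 ∧
    sig3 x κ = 2 * lin (matS 2) x κ / (rad x : ℂ) ^ 2 := by
  refine ⟨?_, ?_, ?_⟩ <;> fin_cases κ <;>
    simp [sig1, sig2, sig3, lin, matS, Fin.sum_univ_five]

/-- `1 / √2`. -/
def rt : ℂ := ((Real.sqrt 2 : ℝ) : ℂ)⁻¹

theorem rt_sq : rt ^ 2 = 1 / 2 := by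
  have : ((Real.sqrt 2 : ℝ) : ℂ) ^ 2 = 2 := by
    exact_mod_cast congrArg (fun r : ℝ => (r : ℂ)) (Real.sq_sqrt (show (0 : ℝ) ≤ 2 by norm_num))
  rw [rt, inv_pow, this]; norm_num

/-- Matrices of the numerators of the coframe. -/
def matE : Fin 5 → Matrix (Fin 5) (Fin 5) ℂ :=
  ![0, matP, rt • (matS 0 + Complex.I • matS 1), rt • (matS 0 - Complex.I • matS 1), matS 2]

/-- Matrices of the numerators of the frame. -/
def matV : Fin 5 → Matrix (Fin 5) (Fin 5) ℂ :=
  ![0, matP, rt • (matS 0 - Complex.I • matS 1), rt • (matS 0 + Complex.I • matS 1), matS 2]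

/-- Denominators of the coframe. -/
def expE : Fin 5 → ℕ := ![0, 1, 2, 2, 2]

/-- Denominators of the frame. -/
def expV : Fin 5 → ℕ := ![0, 1, 0, 0, 0]

/-- The frame `(∂_t, ∂_r̃, e_+, e_-, e_3)` dual to the coframe. -/
def frame (b : Fin 5) : VField := fun x κ =>
  (if b = 0 ∧ κ = 0 then 1 else 0) + lin (matV b) x κ * ((rad x : ℂ) ^ expV b)⁻¹

theorem lin_add (N N' : Matrix (Fin 5) (Fin 5) ℂ) (x : Pt) (κ : Fin 5) :
    lin (N + N') x κ = lin N x κ + lin N' x κ := by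
  simp [lin, add_mul, Finset.sum_add_distrib]

theorem lin_sub (N N' : Matrix (Fin 5) (Fin 5) ℂ) (x : Pt) (κ : Fin 5) :
    lin (N - N') x κ = lin N x κ - lin N' x κ := by
  simp [lin, sub_mul, Finset.sum_sub_distrib]

theorem lin_smul (c : ℂ) (N : Matrix (Fin 5) (Fin 5) ℂ) (x : Pt) (κ : Fin 5) :
    lin (c • N) x κ = c * lin N x κ := by
  simp [lin, Finset.mul_sum, mul_assoc]

theorem lin_zero (x : Pt) (κ : Fin 5) : lin 0 x κ = 0 := by simp [lin]

/-- One shape for all five covectors, a constant plus a linear map times a power of the radius, so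
that a single derivative formula serves them all. The constant is there only for `dt`. -/
theorem coframe_eq (b : Fin 5) (x : Pt) (κ : Fin 5) : coframe b x κ =
    (if b = 0 ∧ κ = 0 then 1 else 0) + lin (matE b) x κ * ((rad x : ℂ) ^ expE b)⁻¹ := by
  fin_cases b
  · fin_cases κ <;> simp [coframe, dt, matE, lin_zero]
  · simp [coframe, dr_eq, matE, expE, div_eq_mul_inv]
  · simp [coframe, bsigP, matE, expE, div_eq_mul_inv, sig_eq, lin_add, lin_smul, rt]
    ring
  · simp [coframe, bsigM, matE, expE, div_eq_mul_inv, sig_eq, lin_sub, lin_smul, rt]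
    ring
  · simp [coframe, bsig3, matE, expE, div_eq_mul_inv, sig_eq]
    ring

theorem frame_zero_apply (x : Pt) (κ : Fin 5) : frame 0 x κ = if κ = 0 then 1 else 0 := by
  simp [frame, matV, lin_zero]

/-- The vectors `x` and `2 σ_i` are orthogonal of length `r̃`. The signs of `i` in `matE` and `matV`
are opposite because the bilinear pairing of `σ¹ + i σ²` with `σ₁ + i σ₂` vanishes, while with `σ₁ -
i σ₂` it does not; `rt ^ 2 = 1 / 2` normalizes it. -/
theorem frame_coframe {x : Pt} (hx : 0 < rad x) (b c : Fin 5) :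
    ∑ κ, frame b x κ * coframe c x κ = if b = c then 1 else 0 := by
  have h0 : (rad x : ℂ) ≠ 0 := by exact_mod_cast hx.ne'
  have hr := radC_sq x
  have hs := rt_sq
  have hI := Complex.I_sq
  simp only [frame, coframe_eq]
  fin_cases b <;> fin_cases c <;>
    simp [matV, matE, expV, expE, matS, matP, lin, Fin.sum_univ_five] <;> field_simp <;> grind

/-- A one-sided inverse of a square matrix is two-sided. -/
theorem coframe_frame {x : Pt} (hx : 0 < rad x) (κ τ : Fin 5) :
    ∑ b, coframe b x κ * frame b x τ = if κ = τ then 1 else 0 := by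
  have h : (Matrix.of fun b κ => frame b x κ) * (Matrix.of fun κ c => coframe c x κ) = 1 := by
    ext b c
    simp [Matrix.mul_apply, frame_coframe hx, Matrix.one_apply]
  have := congrArg (fun A : Matrix (Fin 5) (Fin 5) ℂ => A κ τ) (mul_eq_one_comm.1 h)
  simpa [Matrix.mul_apply, Matrix.one_apply] using this

/-! ### Derivatives of the coframe -/

/-- Frame components of the flat derivative of the coframe:
`∂_κ σ̄^b_τ = ∑ c d, Θ^b_{cd} σ̄^c_κ σ̄^d_τ`. -/
def flatCoeff (r : ℝ) : Fin 5 → Matrix (Fin 5) (Fin 5) ℂ :=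
  ![0,
    !![0, 0, 0, 0, 0; 0, 0, 0, 0, 0; 0, 0, 0, r, 0; 0, 0, r, 0, 0; 0, 0, 0, 0, r],
    !![0, 0, 0, 0, 0; 0, 0, -(r : ℂ)⁻¹, 0, 0; 0, -(r : ℂ)⁻¹, 0, 0, Complex.I; 0, 0, 0, 0, 0;
      0, 0, -Complex.I, 0, 0],
    !![0, 0, 0, 0, 0; 0, 0, 0, -(r : ℂ)⁻¹, 0; 0, 0, 0, 0, 0; 0, -(r : ℂ)⁻¹, 0, 0, -Complex.I;
      0, 0, 0, Complex.I, 0],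
    !![0, 0, 0, 0, 0; 0, 0, 0, 0, -(r : ℂ)⁻¹; 0, 0, 0, -Complex.I, 0; 0, 0, Complex.I, 0, 0;
      0, -(r : ℂ)⁻¹, 0, 0, 0]]

theorem hasDerivAt_inv_pow (n : ℕ) {r : ℝ} (hr : 0 < r) :
    HasDerivAt (fun s : ℝ => ((s : ℂ) ^ n)⁻¹) (-n * ((r : ℂ) ^ (n + 1))⁻¹) r := by
  have h0 : (r : ℂ) ≠ 0 := by exact_mod_cast hr.ne'
  have h := (((hasDerivAt_id r).ofReal_comp).pow n).inv (pow_ne_zero n h0)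
  refine h.congr_deriv ?_
  rcases n with _ | n
  · simp
  · simp
    field_simp
    ring

theorem differentiableAt_inv_pow_rad (n : ℕ) {x : Pt} (hx : 0 < rad x) :
    DifferentiableAt ℝ (fun y => ((rad y : ℂ) ^ n)⁻¹) x :=
  differentiableAt_comp_rad hx (hasDerivAt_inv_pow n hx).differentiableAt

theorem pd_inv_pow_rad (n : ℕ) {x : Pt} (hx : 0 < rad x) (κ : Fin 5) :
    pd κ (fun y => ((rad y : ℂ) ^ n)⁻¹) x = -n * lin matP x κ * ((rad x : ℂ) ^ (n + 2))⁻¹ := by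
  have h0 : (rad x : ℂ) ≠ 0 := by exact_mod_cast hx.ne'
  rw [pd_comp_rad hx (hasDerivAt_inv_pow n hx).differentiableAt, (hasDerivAt_inv_pow n hx).deriv,
    dr_eq]
  field_simp
  ring

/-- A field that is linear in the coordinates up to a power of the radius. -/
theorem pd_lin_mul_inv_pow (c : ℂ) (N : Matrix (Fin 5) (Fin 5) ℂ) (n : ℕ) {x : Pt} (hx : 0 < rad x)
    (κ τ : Fin 5) : pd κ (fun y => c + lin N y τ * ((rad y : ℂ) ^ n)⁻¹) x =
      N τ κ * ((rad x : ℂ) ^ n)⁻¹ - n * lin N x τ * lin matP x κ * ((rad x : ℂ) ^ (n + 2))⁻¹ := by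
  rw [pd_add (differentiableAt_const c)
      ((differentiableAt_lin N τ x).fun_mul (differentiableAt_inv_pow_rad n hx)), pd_const,
    pd_mul (differentiableAt_lin N τ x) (differentiableAt_inv_pow_rad n hx), pd_lin,
    pd_inv_pow_rad n hx]
  ring

theorem contDiffAt_lin_mul_inv_pow (c : ℂ) (N : Matrix (Fin 5) (Fin 5) ℂ) (n : ℕ) {x : Pt}
    (hx : 0 < rad x) (τ : Fin 5) :
    ContDiffAt ℝ ∞ (fun y => c + lin N y τ * ((rad y : ℂ) ^ n)⁻¹) x := by
  have h0 : (rad x : ℂ) ≠ 0 := by exact_mod_cast hx.ne'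
  refine contDiffAt_const.add ((contDiff_lin N τ).contDiffAt.mul (ContDiffAt.inv ?_ (pow_ne_zero n h0)))
  exact (Complex.ofRealCLM.contDiff.contDiffAt.comp x (contDiffAt_rad hx)).pow n

theorem contDiffAt_coframe {x : Pt} (hx : 0 < rad x) (b τ : Fin 5) :
    ContDiffAt ℝ ∞ (fun y => coframe b y τ) x := by
  simp only [coframe_eq]
  exact contDiffAt_lin_mul_inv_pow _ _ _ hx τ

theorem contDiffAt_frame {x : Pt} (hx : 0 < rad x) (b τ : Fin 5) :
    ContDiffAt ℝ ∞ (fun y => frame b y τ) x :=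
  contDiffAt_lin_mul_inv_pow _ _ _ hx τ

theorem differentiableAt_coframe {x : Pt} (hx : 0 < rad x) (b τ : Fin 5) :
    DifferentiableAt ℝ (fun y => coframe b y τ) x :=
  (contDiffAt_coframe hx b τ).differentiableAt (by simp)

theorem differentiableAt_frame {x : Pt} (hx : 0 < rad x) (b τ : Fin 5) :
    DifferentiableAt ℝ (fun y => frame b y τ) x :=
  (contDiffAt_frame hx b τ).differentiableAt (by simp)

/-- Completeness of the orthogonal basis `x`, `S₀ x`, `S₁ x`, `S₂ x` of `ℝ⁴`, whose members all have
length `r̃`. -/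
theorem lin_completeness (x : Pt) (κ τ : Fin 5) :
    matP τ κ * (rad x : ℂ) ^ 2 = lin matP x κ * lin matP x τ + lin (matS 0) x κ * lin (matS 0) x τ
      + lin (matS 1) x κ * lin (matS 1) x τ + lin (matS 2) x κ * lin (matS 2) x τ := by
  rw [radC_sq]
  fin_cases κ <;> fin_cases τ <;> simp [lin, matS, matP, Fin.sum_univ_five] <;> ring

/-- Each `S_i` permutes the basis `x`, `S₀ x`, `S₁ x`, `S₂ x` up to sign, as multiplication by a
quaternion unit; this is its expansion in that basis. -/
theorem lin_structure (x : Pt) (κ τ : Fin 5) :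
    (matS 0 τ κ * (rad x : ℂ) ^ 2 = lin (matS 0) x τ * lin matP x κ - lin matP x τ * lin (matS 0) x κ
      - lin (matS 1) x κ * lin (matS 2) x τ + lin (matS 2) x κ * lin (matS 1) x τ) ∧
    (matS 1 τ κ * (rad x : ℂ) ^ 2 = lin (matS 1) x τ * lin matP x κ - lin matP x τ * lin (matS 1) x κ
      - lin (matS 2) x κ * lin (matS 0) x τ + lin (matS 0) x κ * lin (matS 2) x τ) ∧
    (matS 2 τ κ * (rad x : ℂ) ^ 2 = lin (matS 2) x τ * lin matP x κ - lin matP x τ * lin (matS 2) x κ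
      - lin (matS 0) x κ * lin (matS 1) x τ + lin (matS 1) x κ * lin (matS 0) x τ) := by
  rw [radC_sq]
  refine ⟨?_, ?_, ?_⟩ <;>
  fin_cases κ <;> fin_cases τ <;> simp [lin, matS, matP, Fin.sum_univ_five] <;> ring

theorem matE_apply : matE 0 = 0 ∧ matE 1 = matP ∧ matE 2 = rt • (matS 0 + Complex.I • matS 1) ∧
    matE 3 = rt • (matS 0 - Complex.I • matS 1) ∧ matE 4 = matS 2 := ⟨rfl, rfl, rfl, rfl, rfl⟩

theorem matV_apply : matV 0 = 0 ∧ matV 1 = matP ∧ matV 2 = rt • (matS 0 - Complex.I • matS 1) ∧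
    matV 3 = rt • (matS 0 + Complex.I • matS 1) ∧ matV 4 = matS 2 := ⟨rfl, rfl, rfl, rfl, rfl⟩

theorem expE_apply : expE 0 = 0 ∧ expE 1 = 1 ∧ expE 2 = 2 ∧ expE 3 = 2 ∧ expE 4 = 2 :=
  ⟨rfl, rfl, rfl, rfl, rfl⟩

theorem expV_apply : expV 0 = 0 ∧ expV 1 = 1 ∧ expV 2 = 0 ∧ expV 3 = 0 ∧ expV 4 = 0 :=
  ⟨rfl, rfl, rfl, rfl, rfl⟩

theorem flatCoeff_sum (r : ℝ) (u v : Fin 5 → ℂ) :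
    (∑ c, ∑ d, flatCoeff r 0 c d * u c * v d = 0) ∧
    (∑ c, ∑ d, flatCoeff r 1 c d * u c * v d = r * (u 2 * v 3 + u 3 * v 2 + u 4 * v 4)) ∧
    (∑ c, ∑ d, flatCoeff r 2 c d * u c * v d =
      -(r : ℂ)⁻¹ * (u 1 * v 2 + u 2 * v 1) + Complex.I * (u 2 * v 4 - u 4 * v 2)) ∧
    (∑ c, ∑ d, flatCoeff r 3 c d * u c * v d =
      -(r : ℂ)⁻¹ * (u 1 * v 3 + u 3 * v 1) - Complex.I * (u 3 * v 4 - u 4 * v 3)) ∧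
    (∑ c, ∑ d, flatCoeff r 4 c d * u c * v d =
      -(r : ℂ)⁻¹ * (u 1 * v 4 + u 4 * v 1) - Complex.I * (u 2 * v 3 - u 3 * v 2)) := by
  refine ⟨by simp only [show flatCoeff r 0 = 0 from rfl, Matrix.zero_apply]; simp, ?_, ?_, ?_, ?_⟩
  all_goals
    simp [flatCoeff, Fin.sum_univ_five]
    ring

/-- Differentiating the numerators gives constant matrices, which `lin_completeness` and
`lin_structure` turn back into products of coframe members; differentiating the powers of `r̃` gives
multiples of `dr̃`. -/
theorem pd_coframe {x : Pt} (hx : 0 < rad x) (b κ τ : Fin 5) :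
    pd κ (fun y => coframe b y τ) x =
      ∑ c, ∑ d, flatCoeff (rad x) b c d * coframe c x κ * coframe d x τ := by
  have h0 : (rad x : ℂ) ≠ 0 := by exact_mod_cast hx.ne'
  have hs := rt_sq
  have hI := Complex.I_sq
  simp only [coframe_eq, pd_lin_mul_inv_pow _ _ _ hx]
  have h1 := lin_completeness x κ τ
  obtain ⟨hS0, hS1, hS2⟩ := lin_structure x κ τ
  rw [← eq_div_iff (pow_ne_zero 2 h0)] at h1 hS0 hS1 hS2
  obtain ⟨e0, e1, e2, e3, e4⟩ := matE_apply
  obtain ⟨n0, n1, n2, n3, n4⟩ := expE_apply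
  obtain ⟨f0, f1, f2, f3, f4⟩ := flatCoeff_sum (rad x)
    (fun c => (if c = 0 ∧ κ = 0 then 1 else 0) + lin (matE c) x κ * ((rad x : ℂ) ^ expE c)⁻¹)
    (fun c => (if c = 0 ∧ τ = 0 then 1 else 0) + lin (matE c) x τ * ((rad x : ℂ) ^ expE c)⁻¹)
  match b with
  | 0 => rw [f0, e0]; simp [lin_zero]
  | 1 =>
    rw [f1]
    simp [e1, e2, e3, e4, n1, n2, n3, n4, lin_add, lin_sub, lin_smul]
    rw [h1]
    field_simp
    linear_combination (-2 * lin (matS 0) x κ * lin (matS 0) x τ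
      - 2 * lin (matS 1) x κ * lin (matS 1) x τ) * hs
      + 2 * rt ^ 2 * lin (matS 1) x κ * lin (matS 1) x τ * hI
  | 2 =>
    rw [f2]
    simp [e1, e2, e4, n1, n2, n4, lin_add, lin_smul]
    rw [hS0, hS1]
    field_simp
    grind
  | 3 =>
    rw [f3]
    simp [e1, e3, e4, n1, n3, n4, lin_sub, lin_smul]
    rw [hS0, hS1]
    field_simp
    grind
  | 4 =>
    rw [f4]
    simp [e1, e2, e3, e4, n1, n2, n3, n4, lin_add, lin_sub, lin_smul]
    rw [hS2]
    field_simp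
    grind

/-! ### Expansions in a basis -/

/-- Expansion `∑ b, A_b E^b_κ` of a component. -/
def low (E : Fin 5 → Fin 5 → ℂ) (κ : Fin 5) (A : Fin 5 → ℂ) : ℂ := ∑ b, A b * E b κ

section Low

variable (E F : Fin 5 → Fin 5 → ℂ) (κ τ : Fin 5) (A B : Fin 5 → ℂ) (c : ℂ)

theorem low_add : low E κ (fun b => A b + B b) = low E κ A + low E κ B := by
  simp [low, add_mul, Finset.sum_add_distrib]

theorem low_sub : low E κ (fun b => A b - B b) = low E κ A - low E κ B := by
  simp [low, sub_mul, Finset.sum_sub_distrib]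

theorem low_mul_left : low E κ (fun b => c * A b) = c * low E κ A := by
  simp [low, Finset.mul_sum, mul_assoc]

theorem low_mul_right : low E κ (fun b => A b * c) = low E κ A * c := by
  simp [low, Finset.sum_mul, mul_right_comm]

theorem low_sum (f : Fin 5 → Fin 5 → ℂ) :
    low E κ (fun b => ∑ i, f i b) = ∑ i, low E κ (f i) := by
  simp only [low, Finset.sum_mul]
  exact Finset.sum_comm

/-- Nested expansions may be reordered; this replaces all manipulation of multiple sums over tensor
indices below. -/
theorem low_comm (f : Fin 5 → Fin 5 → ℂ) :
    low E κ (fun a => low F τ (fun b => f a b)) = low F τ (fun b => low E κ (fun a => f a b)) := by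
  simp only [low, Finset.sum_mul]
  rw [Finset.sum_comm]
  simp only [mul_right_comm]

variable {E F}

theorem low_contract (h : ∀ b c, ∑ κ, E b κ * F c κ = if b = c then 1 else 0) :
    ∑ κ, low E κ A * low F κ B = ∑ b, A b * B b := by
  calc ∑ κ, low E κ A * low F κ B = ∑ b, ∑ c, A b * B c * ∑ κ, E b κ * F c κ := by
        simp only [low, Finset.sum_mul_sum]
        rw [Finset.sum_comm]
        refine Finset.sum_congr rfl fun b _ => ?_
        rw [Finset.sum_comm]
        refine Finset.sum_congr rfl fun c _ => ?_
        rw [Finset.mul_sum]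
        exact Finset.sum_congr rfl fun κ _ => by ring
    _ = _ := by simp [h]

end Low

/-- Expansion of a covariant index in the coframe. -/
abbrev lo (x : Pt) (κ : Fin 5) (A : Fin 5 → ℂ) : ℂ := low (fun b => coframe b x) κ A

/-- Expansion of a contravariant index in the frame. -/
abbrev up (x : Pt) (κ : Fin 5) (A : Fin 5 → ℂ) : ℂ := low (fun b => frame b x) κ A

theorem up_lo_contract {x : Pt} (hx : 0 < rad x) (A B : Fin 5 → ℂ) :
    ∑ κ, up x κ A * lo x κ B = ∑ b, A b * B b :=
  low_contract A B (frame_coframe hx)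

theorem pd_eq_lo {x : Pt} (hx : 0 < rad x) (κ : Fin 5) (F : Pt → ℂ) :
    pd κ F x = lo x κ (fun a => vecAct (frame a) F x) := by
  simp only [low, vecAct, Finset.sum_mul]
  rw [Finset.sum_comm]
  calc pd κ F x = ∑ ν, (if κ = ν then 1 else 0) * pd ν F x := by simp
    _ = _ := by
      refine Finset.sum_congr rfl fun ν _ => ?_
      rw [← coframe_frame hx, Finset.sum_mul]
      exact Finset.sum_congr rfl fun b _ => by ring

theorem vecAct_frame_comp_rad {x : Pt} (hx : 0 < rad x) {f : ℝ → ℂ}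
    (hf : DifferentiableAt ℝ f (rad x)) (a : Fin 5) :
    vecAct (frame a) (fun y => f (rad y)) x = if a = 1 then deriv f (rad x) else 0 := by
  have h := frame_coframe hx a 1
  simp only [vecAct, pd_comp_rad hx hf]
  calc _ = deriv f (rad x) * ∑ κ, frame a x κ * coframe 1 x κ := by
        rw [Finset.mul_sum]
        exact Finset.sum_congr rfl fun κ _ => by simp only [coframe, Matrix.cons_val]; ring
    _ = _ := by rw [h]; simp

theorem pd_coframe_lo {x : Pt} (hx : 0 < rad x) (b κ τ : Fin 5) :
    pd κ (fun y => coframe b y τ) x =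
      lo x κ (fun c => lo x τ (fun d => flatCoeff (rad x) b c d)) := by
  rw [pd_coframe hx]
  simp only [low, Finset.sum_mul]
  exact Finset.sum_congr rfl fun c _ => Finset.sum_congr rfl fun d _ => by ring

/-- Derivatives of a rank-2 tensor field in terms of its frame components. -/
theorem pd_expand {x : Pt} (hx : 0 < rad x) {h : Tensor2} {H : Pt → Fin 5 → Fin 5 → ℂ}
    (hH : ∀ b c, DifferentiableAt ℝ (fun y => H y b c) x)
    (hh : ∀ᶠ y in 𝓝 x, ∀ ρ τ, h y ρ τ = lo y ρ fun b => lo y τ fun c => H y b c) (κ ρ τ : Fin 5) :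
    pd κ (fun y => h y ρ τ) x = lo x κ fun a => lo x ρ fun b => lo x τ fun c =>
      vecAct (frame a) (fun y => H y b c) x
        + ∑ d, (H x d c * flatCoeff (rad x) d a b + H x b d * flatCoeff (rad x) d a c) := by
  have hE := differentiableAt_coframe hx
  have h1 : ∀ b, DifferentiableAt ℝ (fun y => ∑ c, H y b c * coframe c y τ) x := fun b =>
    DifferentiableAt.fun_sum fun c _ => (hH b c).fun_mul (hE c τ)
  rw [pd_congr (F' := fun y => ∑ b, (∑ c, H y b c * coframe c y τ) * coframe b y ρ)
    (hh.mono fun y hy => hy ρ τ)]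
  rw [pd_sum fun b _ => (h1 b).fun_mul (hE b ρ)]
  have hl : ∀ ρ (A : Fin 5 → ℂ), ∑ b, A b * coframe b x ρ = lo x ρ A := fun _ _ => rfl
  have h2 : ∀ b, pd κ (fun y => (∑ c, H y b c * coframe c y τ) * coframe b y ρ) x =
      (lo x τ fun c => lo x κ fun a => vecAct (frame a) (fun y => H y b c) x) * coframe b x ρ
      + (∑ c, H x b c * lo x κ fun a => lo x τ fun d => flatCoeff (rad x) c a d) * coframe b x ρ
      + (lo x τ fun c => H x b c) * (lo x κ fun a => lo x ρ fun d => flatCoeff (rad x) b a d) := by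
    intro b
    rw [pd_mul (h1 b) (hE b ρ), pd_sum fun c _ => (hH b c).fun_mul (hE c τ)]
    simp only [pd_mul (hH b _) (hE _ τ), pd_coframe_lo hx, pd_eq_lo hx κ (fun y => H y b _),
      Finset.sum_add_distrib, hl, add_mul]
  simp only [h2, Finset.sum_add_distrib, low_add, hl]
  -- The three identities bring each term to the order `κ`, `ρ`, `τ` of the expansions: derivative
  -- of the components, then derivative of the second and of the first coframe factor.
  have t1 : (lo x ρ fun b => lo x τ fun c => lo x κ fun a => vecAct (frame a) (fun y => H y b c) x) =
      lo x κ fun a => lo x ρ fun b => lo x τ fun c => vecAct (frame a) (fun y => H y b c) x := by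
    refine Eq.trans ?_ (low_comm _ _ _ _ _)
    congr 1
    ext b
    exact low_comm _ _ _ _ _
  have t2 : (lo x ρ fun b => ∑ c, H x b c * lo x κ fun a => lo x τ fun d => flatCoeff (rad x) c a d) =
      lo x κ fun a => lo x ρ fun b => lo x τ fun c => ∑ d, H x b d * flatCoeff (rad x) d a c := by
    refine Eq.trans ?_ (low_comm _ _ _ _ _)
    simp only [low_sum, low_mul_left]
  have t3 : (∑ b, (lo x τ fun c => H x b c) * lo x κ fun a => lo x ρ fun d => flatCoeff (rad x) b a d) =
      lo x κ fun a => lo x ρ fun b => lo x τ fun c => ∑ d, H x d c * flatCoeff (rad x) d a b := by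
    simp only [low_sum, low_mul_left, low_mul_right]
  rw [t1, t2, t3]
  ring

/-! ### Frame components of the metric and of the Killing–Yano form -/

variable (μ a : ℝ)

/-- Frame components of the metric. -/
def metricCoeff (r : ℝ) : Matrix (Fin 5) (Fin 5) ℂ :=
  !![-1 + μ / r ^ 2, 0, 0, 0, -(μ * a) / r ^ 2;
    0, (G μ a r : ℂ)⁻¹, 0, 0, 0;
    0, 0, 0, r ^ 2, 0;
    0, 0, r ^ 2, 0, 0;
    -(μ * a) / r ^ 2, 0, 0, 0, r ^ 2 + μ * a ^ 2 / r ^ 2]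

/-- Frame components of the inverse metric. -/
def invCoeff (r : ℝ) : Matrix (Fin 5) (Fin 5) ℂ :=
  !![-(1 + μ * a ^ 2 / r ^ 4) / (G μ a r : ℂ), 0, 0, 0, -(μ * a) / (r ^ 4 * (G μ a r : ℂ));
    0, (G μ a r : ℂ), 0, 0, 0;
    0, 0, 0, ((r : ℂ) ^ 2)⁻¹, 0;
    0, 0, ((r : ℂ) ^ 2)⁻¹, 0, 0;
    -(μ * a) / (r ^ 4 * (G μ a r : ℂ)), 0, 0, 0, (1 - μ / r ^ 2) / (r ^ 2 * (G μ a r : ℂ))]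

theorem metric_eq (x : Pt) (κ τ : Fin 5) :
    metric μ a x κ τ = lo x κ fun b => lo x τ fun c => metricCoeff μ a (rad x) b c := by
  simp [metric, low, Fin.sum_univ_five, metricCoeff, coframe]
  ring

/-- The `(t, 3)` block has determinant `-r² G`, whence the factor `G` in the denominators of
`invCoeff`. -/
theorem metricCoeff_mul_invCoeff {r : ℝ} (hr : 0 < r) (hG : G μ a r ≠ 0) :
    metricCoeff μ a r * invCoeff μ a r = 1 := by
  have h0 : (r : ℂ) ≠ 0 := by exact_mod_cast hr.ne'
  have hG' : (G μ a r : ℂ) ≠ 0 := by exact_mod_cast hG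
  have hg : (G μ a r : ℂ) = 1 - μ / r ^ 2 + μ * a ^ 2 / r ^ 4 := by
    simp [G]
  have hg' : (G μ a r : ℂ) * r ^ 4 = r ^ 4 - μ * r ^ 2 + μ * a ^ 2 := by
    rw [hg]; field_simp
  ext i j
  fin_cases i <;> fin_cases j <;>
    simp [Matrix.mul_apply, Fin.sum_univ_five, metricCoeff, invCoeff, h0, hG'] <;>
    field_simp <;> first | linear_combination (-(r : ℂ) ^ 2) * hg' | linear_combination -hg' | ring

/-- The metric is `Eᵀ g E` with `E` the coframe matrix, and `E` is inverted by the transpose of the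
frame matrix, so only the matrix of frame components has to be inverted. -/
theorem invMetric_eq {x : Pt} (hx : 0 < rad x) (hG : G μ a (rad x) ≠ 0) (κ τ : Fin 5) :
    invMetric μ a x κ τ = up x κ fun b => up x τ fun c => invCoeff μ a (rad x) b c := by
  set E : Matrix (Fin 5) (Fin 5) ℂ := Matrix.of fun b κ => coframe b x κ with hE
  set V : Matrix (Fin 5) (Fin 5) ℂ := Matrix.of fun b κ => frame b x κ with hV
  have h1 : Matrix.of (metric μ a x) = E.transpose * metricCoeff μ a (rad x) * E := by
    ext κ τ
    simp only [Matrix.of_apply, metric_eq, low, Matrix.mul_apply, hE, Matrix.transpose_apply,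
      Finset.sum_mul]
    rw [Finset.sum_comm]
    exact Finset.sum_congr rfl fun c _ => Finset.sum_congr rfl fun d _ => by ring
  have h2 : E * V.transpose = 1 := by
    ext b c
    simp only [Matrix.mul_apply, hE, hV, Matrix.transpose_apply, Matrix.of_apply, Matrix.one_apply]
    rw [show (if b = c then (1 : ℂ) else 0) = if c = b then 1 else 0 by simp only [eq_comm],
      ← frame_coframe hx c b]
    exact Finset.sum_congr rfl fun κ _ => mul_comm _ _
  have h3 : E.transpose * V = 1 := by
    have := congrArg Matrix.transpose (mul_eq_one_comm.1 h2)
    simpa using this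
  have h4 : (Matrix.of (metric μ a x))⁻¹ = V.transpose * invCoeff μ a (rad x) * V := by
    apply Matrix.inv_eq_right_inv
    calc _ = E.transpose * metricCoeff μ a (rad x) * (E * V.transpose) * invCoeff μ a (rad x) * V := by
          rw [h1]; simp only [Matrix.mul_assoc]
      _ = E.transpose * (metricCoeff μ a (rad x) * invCoeff μ a (rad x)) * V := by
          rw [h2]; simp only [Matrix.mul_assoc, Matrix.one_mul]
      _ = 1 := by rw [metricCoeff_mul_invCoeff μ a hx hG, Matrix.mul_one, h3]
  simp only [invMetric, h4, low, Matrix.mul_apply, hV, Matrix.transpose_apply, Matrix.of_apply,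
      Finset.sum_mul]
  rw [Finset.sum_comm]
  exact Finset.sum_congr rfl fun c _ => Finset.sum_congr rfl fun d _ => by ring

theorem wedge3_low (E : Fin 5 → Fin 5 → ℂ) (α β γ : Fin 5 → ℂ) (κ τ ν : Fin 5) :
    wedge3 (fun i => low E i α) (fun i => low E i β) (fun i => low E i γ) κ τ ν =
      low E κ fun b => low E τ fun c => low E ν fun d => wedge3 α β γ b c d := by
  simp only [wedge3, Matrix.det_fin_three, Matrix.of_apply, Matrix.cons_val, low_add, low_sub,
    low_mul_left, low_mul_right]

/-- Frame components of the Killing–Yano form. -/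
def yanoCoeff (r : ℝ) (b c d : Fin 5) : ℂ :=
  -((a : ℂ) * r * wedge3 ![1, 0, 0, 0, 0] ![0, 1, 0, 0, 0] ![0, 0, 0, 0, 1] b c d)
    - Complex.I * (r : ℂ) ^ 2 *
      wedge3 ![0, 0, 1, 0, 0] ![0, 0, 0, 1, 0] ![-(a : ℂ), 0, 0, 0, (r : ℂ) ^ 2] b c d

theorem killingYano_eq (x : Pt) (κ τ ν : Fin 5) :
    killingYano a x κ τ ν =
      lo x κ fun b => lo x τ fun c => lo x ν fun d => yanoCoeff a (rad x) b c d := by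
  have h0 : dt x = fun i => lo x i ![1, 0, 0, 0, 0] := by
    ext i; simp [low, Fin.sum_univ_five, coframe]
  have h1 : dr x = fun i => lo x i ![0, 1, 0, 0, 0] := by
    ext i; simp [low, Fin.sum_univ_five, coframe]
  have h2 : bsigP x = fun i => lo x i ![0, 0, 1, 0, 0] := by
    ext i; simp [low, Fin.sum_univ_five, coframe]
  have h3 : bsigM x = fun i => lo x i ![0, 0, 0, 1, 0] := by
    ext i; simp [low, Fin.sum_univ_five, coframe]
  have h4 : bsig3 x = fun i => lo x i ![0, 0, 0, 0, 1] := by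
    ext i; simp [low, Fin.sum_univ_five, coframe]
  have h5 : (fun i => -(a : ℂ) * dt x i + (rad x : ℂ) ^ 2 * bsig3 x i)
      = fun i => lo x i ![-(a : ℂ), 0, 0, 0, (rad x : ℂ) ^ 2] := by
    ext i; simp [low, Fin.sum_univ_five, coframe]
  have hneg : ∀ (E : Fin 5 → Fin 5 → ℂ) (κ : Fin 5) (A : Fin 5 → ℂ),
      low E κ (fun b => -A b) = -low E κ A := fun E κ A => by simp [low]
  rw [killingYano, h5, h0, h1, h2, h3, h4]
  simp only [wedge3_low, yanoCoeff, low_sub, hneg, low_mul_left]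

section

/-! ### Neutrality of the frame components -/

variable (μ a : ℝ)

/-- This and the next lemmas express invariance under the rotation `σ̄^± ↦ e^{±iα} σ̄^±`. A raised
index counts with the opposite sign, so here the charge of the upper index equals the sum of the
lower ones. -/
theorem flatCoeff_neutral (r : ℝ) (b c d : Fin 5) :
    flatCoeff r b c d = 0 ∨ charge b = charge c + charge d := by
  match b with
  | 0 => exact Or.inl rfl
  | 1 | 2 | 3 | 4 => fin_cases c <;> fin_cases d <;> simp [flatCoeff, charge]

/-- The vanishing is asserted for all radii at once, so that it passes to the radial derivative in
`metricDeriv`. -/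
theorem metricCoeff_neutral (b c : Fin 5) :
    (∀ r, metricCoeff μ a r b c = 0) ∨ charge b + charge c = 0 := by
  fin_cases b <;> fin_cases c <;> simp [metricCoeff, charge]

theorem invCoeff_neutral (r : ℝ) (b c : Fin 5) :
    invCoeff μ a r b c = 0 ∨ charge b + charge c = 0 := by
  fin_cases b <;> fin_cases c <;> simp [invCoeff, charge]

theorem yanoCoeff_neutral (r : ℝ) (b c d : Fin 5) :
    yanoCoeff a r b c d = 0 ∨ charge b + charge c + charge d = 0 := by
  fin_cases b <;> fin_cases c <;> fin_cases d <;>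
    simp [yanoCoeff, charge, wedge3, Matrix.det_fin_three]

/-- Frame components of the flat derivative of the metric. -/
def metricDeriv (r : ℝ) (i b c : Fin 5) : ℂ :=
  (if i = 1 then deriv (fun s => metricCoeff μ a s b c) r else 0)
    + ∑ d, (metricCoeff μ a r d c * flatCoeff r d i b + metricCoeff μ a r b d * flatCoeff r d i c)

/-- Frame components of the Christoffel symbols. -/
def christoffelCoeff (r : ℝ) (m i b : Fin 5) : ℂ :=
  (1 / 2) * ∑ n, invCoeff μ a r m n *
    (metricDeriv μ a r i n b + metricDeriv μ a r b i n - metricDeriv μ a r n i b)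

/-- Frame components of the Killing–Yano form with two raised indices. -/
def yanoUpCoeff (r : ℝ) (l c d : Fin 5) : ℂ :=
  ∑ m, ∑ n, yanoCoeff a r l m n * invCoeff μ a r m c * invCoeff μ a r n d

/-- Connection coefficients in the frame. -/
def connCoeff (r : ℝ) (m i b : Fin 5) : ℂ := flatCoeff r m i b - christoffelCoeff μ a r m i b

theorem metricDeriv_neutral (r : ℝ) (i b c : Fin 5) :
    metricDeriv μ a r i b c = 0 ∨ charge i + charge b + charge c = 0 := by
  by_cases hq : charge i + charge b + charge c = 0
  · exact Or.inr hq
  refine Or.inl ?_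
  -- The only direction in which the coefficients vary is `r̃`, and this direction has charge zero.
  have h1 : (if i = 1 then deriv (fun s => metricCoeff μ a s b c) r else 0) = 0 := by
    split_ifs with hi
    · rcases metricCoeff_neutral μ a b c with h | h
      · simp [h]
      · exact absurd (by rw [hi, show charge 1 = 0 from rfl]; linarith) hq
    · rfl
  rw [metricDeriv, h1, zero_add]
  refine Finset.sum_eq_zero fun d _ => ?_
  have h2 : metricCoeff μ a r d c * flatCoeff r d i b = 0 := by
    rcases metricCoeff_neutral μ a d c with h | h
    · simp [h]
    rcases flatCoeff_neutral r d i b with h' | h'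
    · simp [h']
    · exact absurd (by linarith) hq
  have h3 : metricCoeff μ a r b d * flatCoeff r d i c = 0 := by
    rcases metricCoeff_neutral μ a b d with h | h
    · simp [h]
    rcases flatCoeff_neutral r d i c with h' | h'
    · simp [h']
    · exact absurd (by linarith) hq
  rw [h2, h3, add_zero]

theorem christoffelCoeff_neutral (r : ℝ) (m i b : Fin 5) :
    christoffelCoeff μ a r m i b = 0 ∨ charge m = charge i + charge b := by
  by_cases hq : charge m = charge i + charge b
  · exact Or.inr hq
  refine Or.inl ?_
  rw [christoffelCoeff, Finset.sum_eq_zero, mul_zero]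
  intro n _
  rcases invCoeff_neutral μ a r m n with h | h
  · simp [h]
  have h1 := (metricDeriv_neutral μ a r i n b).resolve_right fun h' => hq (by linarith)
  have h2 := (metricDeriv_neutral μ a r b i n).resolve_right fun h' => hq (by linarith)
  have h3 := (metricDeriv_neutral μ a r n i b).resolve_right fun h' => hq (by linarith)
  simp [h1, h2, h3]

theorem connCoeff_neutral (r : ℝ) (m i b : Fin 5) :
    connCoeff μ a r m i b = 0 ∨ charge m = charge i + charge b := by
  by_cases hq : charge m = charge i + charge b
  · exact Or.inr hq
  · rw [connCoeff, (flatCoeff_neutral r m i b).resolve_right hq,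
      (christoffelCoeff_neutral μ a r m i b).resolve_right hq]
    simp

theorem yanoUpCoeff_neutral (r : ℝ) (l c d : Fin 5) :
    yanoUpCoeff μ a r l c d = 0 ∨ charge l = charge c + charge d := by
  by_cases hq : charge l = charge c + charge d
  · exact Or.inr hq
  refine Or.inl (Finset.sum_eq_zero fun m _ => Finset.sum_eq_zero fun n _ => ?_)
  rcases yanoCoeff_neutral a r l m n with h | h
  · simp [h]
  rcases invCoeff_neutral μ a r m c with h' | h'
  · simp [h']
  rcases invCoeff_neutral μ a r n d with h'' | h''
  · simp [h'']
  · exact absurd (by linarith) hq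

/-! ### Regularity of the frame components -/

/-- The radii off the horizons. -/
def radii : Set ℝ := {r | 0 < r ∧ G μ a r ≠ 0}

theorem contDiffOn_G : ContDiffOn ℝ ∞ (G μ a) {r | 0 < r} := by
  intro r hr
  have h0 : r ≠ 0 := ne_of_gt hr
  unfold G
  have hp : ∀ n : ℕ, ContDiffAt ℝ ∞ (fun r : ℝ => r ^ n) r := fun n => contDiffAt_id.pow n
  exact ((contDiffAt_const.sub (contDiffAt_const.div (hp 2) (pow_ne_zero 2 h0))).add
    (contDiffAt_const.div (hp 4) (pow_ne_zero 4 h0))).contDiffWithinAt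

theorem isOpen_radii : IsOpen (radii μ a) :=
  (contDiffOn_G μ a).continuousOn.isOpen_inter_preimage isOpen_Ioi isOpen_compl_singleton

theorem contDiffOn_radius_inv_pow (n : ℕ) :
    ContDiffOn ℝ ∞ (fun r : ℝ => ((r : ℂ) ^ n)⁻¹) (radii μ a) := by
  intro r hr
  have h0 : (r : ℂ) ≠ 0 := by exact_mod_cast hr.1.ne'
  exact ((Complex.ofRealCLM.contDiff.contDiffAt.pow n).inv (pow_ne_zero n h0)).contDiffWithinAt

theorem contDiffOn_radius_pow (n : ℕ) :
    ContDiffOn ℝ ∞ (fun r : ℝ => (r : ℂ) ^ n) (radii μ a) :=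
  (Complex.ofRealCLM.contDiff.pow n).contDiffOn

theorem contDiffOn_G_complex : ContDiffOn ℝ ∞ (fun r : ℝ => (G μ a r : ℂ)) (radii μ a) :=
  Complex.ofRealCLM.contDiff.comp_contDiffOn ((contDiffOn_G μ a).mono fun _ h => h.1)

theorem contDiffOn_G_inv : ContDiffOn ℝ ∞ (fun r : ℝ => (G μ a r : ℂ)⁻¹) (radii μ a) :=
  (contDiffOn_G_complex μ a).inv fun _ h => by exact_mod_cast h.2

theorem contDiffOn_flatCoeff (b c d : Fin 5) :
    ContDiffOn ℝ ∞ (fun r => flatCoeff r b c d) (radii μ a) := by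
  have h1 : ContDiffOn ℝ ∞ (fun r : ℝ => (r : ℂ)) (radii μ a) := by
    simpa using contDiffOn_radius_pow μ a 1
  have h2 : ContDiffOn ℝ ∞ (fun r : ℝ => -(r : ℂ)⁻¹) (radii μ a) := by
    simpa using (contDiffOn_radius_inv_pow μ a 1).neg
  match b with
  | 0 => exact contDiffOn_const
  | 1 | 2 | 3 | 4 =>
    fin_cases c <;> fin_cases d <;> first | exact contDiffOn_const | exact h1 | exact h2

theorem contDiffOn_metricCoeff (b c : Fin 5) :
    ContDiffOn ℝ ∞ (fun r => metricCoeff μ a r b c) (radii μ a) := by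
  have h1 : ContDiffOn ℝ ∞ (fun r : ℝ => (-1 + μ / r ^ 2 : ℂ)) (radii μ a) := by
    simpa only [div_eq_mul_inv] using
      contDiffOn_const.add (contDiffOn_const.mul (contDiffOn_radius_inv_pow μ a 2))
  have h2 : ContDiffOn ℝ ∞ (fun r : ℝ => (-(μ * a) / r ^ 2 : ℂ)) (radii μ a) := by
    simpa only [div_eq_mul_inv] using contDiffOn_const.mul (contDiffOn_radius_inv_pow μ a 2)
  have h3 := contDiffOn_radius_pow μ a 2
  have h4 : ContDiffOn ℝ ∞ (fun r : ℝ => (r ^ 2 + μ * a ^ 2 / r ^ 2 : ℂ)) (radii μ a) := by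
    simpa only [div_eq_mul_inv] using
      h3.add (contDiffOn_const.mul (contDiffOn_radius_inv_pow μ a 2))
  have h5 := contDiffOn_G_inv μ a
  fin_cases b <;> fin_cases c <;>
    first | exact contDiffOn_const | exact h1 | exact h2 | exact h3 | exact h4 | exact h5

theorem contDiffOn_invCoeff (b c : Fin 5) :
    ContDiffOn ℝ ∞ (fun r => invCoeff μ a r b c) (radii μ a) := by
  have h0 := contDiffOn_G_inv μ a
  have h1 : ContDiffOn ℝ ∞ (fun r : ℝ => (-(1 + μ * a ^ 2 / r ^ 4) / (G μ a r : ℂ) : ℂ))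
      (radii μ a) := by
    simpa only [div_eq_mul_inv] using
      (contDiffOn_const.add (contDiffOn_const.mul (contDiffOn_radius_inv_pow μ a 4))).neg.mul h0
  have h2 : ContDiffOn ℝ ∞ (fun r : ℝ => (-(μ * a) / (r ^ 4 * (G μ a r : ℂ)) : ℂ))
      (radii μ a) := by
    simpa only [div_eq_mul_inv, mul_inv] using
      contDiffOn_const.mul ((contDiffOn_radius_inv_pow μ a 4).mul h0)
  have h3 := contDiffOn_radius_inv_pow μ a 2
  have h4 : ContDiffOn ℝ ∞ (fun r : ℝ => ((1 - μ / r ^ 2) / (r ^ 2 * (G μ a r : ℂ)) : ℂ))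
      (radii μ a) := by
    simpa only [div_eq_mul_inv, mul_inv] using
      (contDiffOn_const.sub (contDiffOn_const.mul h3)).mul (h3.mul h0)
  have h5 := contDiffOn_G_complex μ a
  fin_cases b <;> fin_cases c <;>
    first | exact contDiffOn_const | exact h1 | exact h2 | exact h3 | exact h4 | exact h5

theorem contDiffOn_yanoCoeff (b c d : Fin 5) :
    ContDiffOn ℝ ∞ (fun r => yanoCoeff a r b c d) (radii μ a) := by
  have h1 : ContDiffOn ℝ ∞ (fun r : ℝ => (r : ℂ)) (radii μ a) := by
    simpa using contDiffOn_radius_pow μ a 1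
  have h2 := contDiffOn_radius_pow μ a 2
  have h3 : ∀ i : Fin 5,
      ContDiffOn ℝ ∞ (fun r : ℝ => (![-(a : ℂ), 0, 0, 0, (r : ℂ) ^ 2] : Fin 5 → ℂ) i) (radii μ a) := by
    intro i
    fin_cases i <;> first | exact contDiffOn_const | exact h2
  simp only [yanoCoeff, wedge3, Matrix.det_fin_three, Matrix.of_apply, Matrix.cons_val]
  have c0 : ∀ z : ℂ, ContDiffOn ℝ ∞ (fun _ : ℝ => z) (radii μ a) := fun z => contDiffOn_const
  refine ContDiffOn.sub (ContDiffOn.neg (((c0 _).mul h1).mul (c0 _))) (((c0 _).mul h2).mul ?_)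
  exact ((((((c0 _).mul (h3 d)).sub ((c0 _).mul (h3 c))).sub ((c0 _).mul (h3 d))).add
    ((c0 _).mul (h3 b))).add ((c0 _).mul (h3 c))).sub ((c0 _).mul (h3 b))

theorem contDiffOn_metricDeriv (i b c : Fin 5) :
    ContDiffOn ℝ ∞ (fun r => metricDeriv μ a r i b c) (radii μ a) := by
  refine ContDiffOn.add ?_ (ContDiffOn.sum fun d _ =>
    ((contDiffOn_metricCoeff μ a d c).mul (contDiffOn_flatCoeff μ a d i b)).add
      ((contDiffOn_metricCoeff μ a b d).mul (contDiffOn_flatCoeff μ a d i c)))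
  split_ifs
  · exact (contDiffOn_metricCoeff μ a b c).deriv_of_isOpen (isOpen_radii μ a) (by simp)
  · exact contDiffOn_const

theorem contDiffOn_connCoeff (m i b : Fin 5) :
    ContDiffOn ℝ ∞ (fun r => connCoeff μ a r m i b) (radii μ a) :=
  (contDiffOn_flatCoeff μ a m i b).sub (contDiffOn_const.mul (ContDiffOn.sum fun n _ =>
    (contDiffOn_invCoeff μ a m n).mul (((contDiffOn_metricDeriv μ a i n b).add
      (contDiffOn_metricDeriv μ a b i n)).sub (contDiffOn_metricDeriv μ a n i b))))

theorem contDiffOn_yanoUpCoeff (l c d : Fin 5) :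
    ContDiffOn ℝ ∞ (fun r => yanoUpCoeff μ a r l c d) (radii μ a) :=
  ContDiffOn.sum fun m _ => ContDiffOn.sum fun n _ =>
    ((contDiffOn_yanoCoeff μ a l m n).mul (contDiffOn_invCoeff μ a m c)).mul
      (contDiffOn_invCoeff μ a n d)

/-! ### The symmetry operator in the frame -/

/-- Frame components of the symmetry operator, in terms of the frame derivatives `D` and the
components `H` of the tensor field. -/
def symFrame (r : ℝ) (D : Fin 5 → Fin 5 → Fin 5 → ℂ) (H : Fin 5 → Fin 5 → ℂ) (l m : Fin 5) : ℂ :=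
  ∑ c, ∑ d,
    (yanoUpCoeff μ a r l c d *
        (D c m d + ∑ e, (H e d * connCoeff μ a r e c m + H m e * connCoeff μ a r e c d))
      + yanoUpCoeff μ a r m c d *
        (D c l d + ∑ e, (H e d * connCoeff μ a r e c l + H l e * connCoeff μ a r e c d)))

theorem symFrame_comm (r : ℝ) (D : Fin 5 → Fin 5 → Fin 5 → ℂ) (H : Fin 5 → Fin 5 → ℂ)
    (l m : Fin 5) : symFrame μ a r D H l m = symFrame μ a r D H m l :=
  Finset.sum_congr rfl fun _ _ => Finset.sum_congr rfl fun _ _ => add_comm _ _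

/-- The derivative array and the component array are treated as independent data; the expression is
jointly linear in them. -/
theorem symFrame_add (r : ℝ) (D D' : Fin 5 → Fin 5 → Fin 5 → ℂ) (H H' : Fin 5 → Fin 5 → ℂ)
    (l m : Fin 5) : symFrame μ a r (fun i b c => D i b c + D' i b c) (fun b c => H b c + H' b c) l m =
      symFrame μ a r D H l m + symFrame μ a r D' H' l m := by
  simp only [symFrame, ← Finset.sum_add_distrib]
  refine Finset.sum_congr rfl fun c _ => Finset.sum_congr rfl fun d _ => ?_
  simp only [add_mul, Finset.sum_add_distrib]
  ring

/-- The symmetry operator carries no charge. -/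
theorem symFrame_charge (r : ℝ) (D : Fin 5 → Fin 5 → Fin 5 → ℂ) (H : Fin 5 → Fin 5 → ℂ)
    (u : ℝ → ℂ) (l m : Fin 5) :
    symFrame μ a r (fun i b c => D i b c * u (charge i + charge b + charge c))
      (fun b c => H b c * u (charge b + charge c)) l m =
      symFrame μ a r D H l m * u (charge l + charge m) := by
  -- Where `yanoUpCoeff` is nonzero, `q_l = q_c + q_d`, so the derivative term has total charge `q_l
  -- + q_m`. Where `connCoeff` is nonzero too, replacing a lower index by `e` absorbs the charge of
  -- the derivative index, so the connection terms have the same total charge.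
  have key : ∀ l m c d : Fin 5, yanoUpCoeff μ a r l c d *
      (D c m d * u (charge c + charge m + charge d)
        + ∑ e, (H e d * u (charge e + charge d) * connCoeff μ a r e c m
          + H m e * u (charge m + charge e) * connCoeff μ a r e c d)) =
      yanoUpCoeff μ a r l c d *
        (D c m d + ∑ e, (H e d * connCoeff μ a r e c m + H m e * connCoeff μ a r e c d))
        * u (charge l + charge m) := by
    intro l m c d
    rcases yanoUpCoeff_neutral μ a r l c d with h | h
    · simp [h]
    rw [mul_assoc, add_mul, Finset.sum_mul]
    refine congrArg _ (congrArg₂ _ ?_ ?_)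
    · rw [h, add_right_comm]
    · refine Finset.sum_congr rfl fun e _ => ?_
      rw [add_mul]
      refine congrArg₂ _ ?_ ?_
      · rcases connCoeff_neutral μ a r e c m with h' | h'
        · simp [h']
        · rw [show charge e + charge d = charge l + charge m by rw [h, h']; ring]; ring
      · rcases connCoeff_neutral μ a r e c d with h' | h'
        · simp [h']
        · rw [show charge m + charge e = charge l + charge m by rw [h, h']; ring]; ring
  simp only [symFrame, Finset.sum_mul]
  refine Finset.sum_congr rfl fun c _ => Finset.sum_congr rfl fun d _ => ?_
  rw [key l m c d, key m l c d, add_comm (charge m) (charge l), add_mul]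

/-! ### Covariant derivative and symmetry operator in frame components -/

section

variable {μ a} {x : Pt}

theorem pd_metric_eq (hx : 0 < rad x) (hG : G μ a (rad x) ≠ 0) (κ ρ τ : Fin 5) :
    pd κ (fun y => metric μ a y ρ τ) x =
      lo x κ fun i => lo x ρ fun b => lo x τ fun c => metricDeriv μ a (rad x) i b c := by
  have hd : ∀ b c, DifferentiableAt ℝ (fun r => metricCoeff μ a r b c) (rad x) := fun b c =>
    ((contDiffOn_metricCoeff μ a b c).contDiffAt
      ((isOpen_radii μ a).mem_nhds ⟨hx, hG⟩)).differentiableAt (by simp)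
  rw [pd_expand hx (H := fun y b c => metricCoeff μ a (rad y) b c)
    (fun b c => differentiableAt_comp_rad hx (hd b c))
    (Filter.Eventually.of_forall fun y ρ τ => metric_eq μ a y ρ τ)]
  simp only [vecAct_frame_comp_rad hx (hd _ _)]
  rfl

theorem up_lo_contract₂ (hx : 0 < rad x) (P Q : Fin 5 → Fin 5 → ℂ) :
    ∑ κ, ∑ τ, (up x κ fun c => up x τ fun d => P c d) * (lo x κ fun c => lo x τ fun d => Q c d) =
      ∑ c, ∑ d, P c d * Q c d := by
  have h1 : ∀ κ, ∑ τ, (up x κ fun c => up x τ fun d => P c d) *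
      (lo x κ fun c => lo x τ fun d => Q c d) =
      ∑ d, (up x κ fun c => P c d) * (lo x κ fun c => Q c d) := by
    intro κ
    rw [← up_lo_contract hx (fun d => up x κ fun c => P c d) (fun d => lo x κ fun c => Q c d)]
    refine Finset.sum_congr rfl fun τ _ => ?_
    exact congrArg₂ _ (low_comm _ _ _ _ _) (low_comm _ _ _ _ _)
  simp only [h1]
  rw [Finset.sum_comm]
  simp only [up_lo_contract hx]
  exact Finset.sum_comm

theorem christoffel_eq (hx : 0 < rad x) (hG : G μ a (rad x) ≠ 0) (ρ κ τ : Fin 5) :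
    christoffel μ a x ρ κ τ =
      up x ρ fun m => lo x κ fun i => lo x τ fun b => christoffelCoeff μ a (rad x) m i b := by
  set g := invCoeff μ a (rad x) with hg
  set T := metricDeriv μ a (rad x) with hT
  have hB : ∀ ν, pd κ (fun y => metric μ a y ν τ) x + pd τ (fun y => metric μ a y κ ν) x
      - pd ν (fun y => metric μ a y κ τ) x =
      lo x ν fun n => lo x κ fun i => lo x τ fun b => T i n b + T b i n - T n i b := by
    intro ν
    simp only [pd_metric_eq hx hG, low_sub, low_add]
    congr 2
    · exact low_comm _ _ _ _ _
    · refine (low_comm _ _ _ _ _).trans ?_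
      refine Eq.trans ?_ (low_comm _ _ _ _ _)
      congr 1
      ext i
      exact low_comm _ _ _ _ _
  have hL : ∀ ν, invMetric μ a x ρ ν = up x ν fun n => up x ρ fun m => g m n := fun ν =>
    (invMetric_eq μ a hx hG ρ ν).trans (low_comm _ _ _ _ _)
  simp only [christoffel, hB, hL]
  rw [up_lo_contract hx]
  simp only [christoffelCoeff, ← hg, ← hT, low_mul_left, low_sum, low_mul_right]

/-- Partial derivatives of the coframe contribute `flatCoeff`, and the Christoffel symbols are
subtracted; only the difference `connCoeff` remains. -/
theorem covD_eq (hx : 0 < rad x) (hG : G μ a (rad x) ≠ 0) {h : Tensor2}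
    {H : Pt → Fin 5 → Fin 5 → ℂ} (hH : ∀ b c, DifferentiableAt ℝ (fun y => H y b c) x)
    (hh : ∀ᶠ y in 𝓝 x, ∀ ρ τ, h y ρ τ = lo y ρ fun b => lo y τ fun c => H y b c) (κ ρ τ : Fin 5) :
    covD μ a h x κ ρ τ = lo x κ fun i => lo x ρ fun b => lo x τ fun c =>
      vecAct (frame i) (fun y => H y b c) x
        + ∑ d, (H x d c * connCoeff μ a (rad x) d i b + H x b d * connCoeff μ a (rad x) d i c) := by
  have h0 := hh.self_of_nhds
  have h1 : ∑ ν, christoffel μ a x ν κ ρ * h x ν τ =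
      ∑ m, (lo x κ fun i => lo x ρ fun b => christoffelCoeff μ a (rad x) m i b) *
        lo x τ fun c => H x m c := by
    simp only [christoffel_eq hx hG, h0]
    exact up_lo_contract hx _ _
  have h2 : ∑ ν, christoffel μ a x ν κ τ * h x ρ ν =
      ∑ m, (lo x κ fun i => lo x τ fun b => christoffelCoeff μ a (rad x) m i b) *
        lo x ρ fun b => H x b m := by
    rw [← up_lo_contract hx (fun m => lo x κ fun i => lo x τ fun b =>
      christoffelCoeff μ a (rad x) m i b) (fun m => lo x ρ fun b => H x b m)]
    refine Finset.sum_congr rfl fun ν _ => ?_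
    rw [christoffel_eq hx hG, h0]
    exact congrArg _ (low_comm _ _ _ _ _)
  rw [covD, pd_expand hx hH hh, Finset.sum_add_distrib, h1, h2]
  simp only [connCoeff, mul_sub, Finset.sum_add_distrib, Finset.sum_sub_distrib, low_add, low_sub,
    low_sum, low_mul_left, low_mul_right]
  have h3 : ∀ u v : Fin 5 → ℂ, ∑ m, u m * v m = ∑ m, v m * u m := fun u v =>
    Finset.sum_congr rfl fun _ _ => mul_comm _ _
  rw [h3 (fun m => lo x κ fun i => lo x ρ fun b => christoffelCoeff μ a (rad x) m i b),
    h3 (fun m => lo x κ fun i => lo x τ fun b => christoffelCoeff μ a (rad x) m i b)]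
  ring

theorem killingYanoUp_eq (hx : 0 < rad x) (hG : G μ a (rad x) ≠ 0) (l κ τ : Fin 5) :
    killingYanoUp μ a x l κ τ =
      lo x l fun b => up x κ fun c => up x τ fun d => yanoUpCoeff μ a (rad x) b c d := by
  set g := invCoeff μ a (rad x) with hg
  set Y := yanoCoeff a (rad x) with hY
  have hA : ∀ α β, killingYano a x l α β =
      lo x α fun m => lo x β fun n => lo x l fun b => Y b m n := by
    intro α β
    refine (killingYano_eq a x l α β).trans ((low_comm _ _ _ _ _).trans ?_)
    congr 1
    ext m
    exact low_comm _ _ _ _ _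
  have hg2 : ∀ α β, invMetric μ a x α κ * invMetric μ a x β τ =
      up x α fun m => up x β fun n => (up x κ fun c => g m c) * (up x τ fun d => g n d) := by
    intro α β
    rw [invMetric_eq μ a hx hG, invMetric_eq μ a hx hG]
    simp only [low_mul_left, low_mul_right]
    rfl
  have h1 : ∀ α β, killingYano a x l α β * invMetric μ a x α κ * invMetric μ a x β τ =
      (up x α fun m => up x β fun n => (up x κ fun c => g m c) * (up x τ fun d => g n d)) *
        (lo x α fun m => lo x β fun n => lo x l fun b => Y b m n) := by
    intro α β
    rw [mul_assoc, hA, hg2, mul_comm]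
  simp only [killingYanoUp, h1]
  rw [up_lo_contract₂ hx]
  simp only [yanoUpCoeff, ← hg, ← hY, low_sum, low_mul_left, low_mul_right]
  exact Finset.sum_congr rfl fun m _ => Finset.sum_congr rfl fun n _ => by ring

/-- The symmetry operator in terms of frame components. -/
theorem symOp_eq (hx : 0 < rad x) (hG : G μ a (rad x) ≠ 0) {h : Tensor2}
    {H : Pt → Fin 5 → Fin 5 → ℂ} (hH : ∀ b c, DifferentiableAt ℝ (fun y => H y b c) x)
    (hh : ∀ᶠ y in 𝓝 x, ∀ ρ τ, h y ρ τ = lo y ρ fun b => lo y τ fun c => H y b c) (l m : Fin 5) :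
    symOp μ a h x l m = lo x l fun b => lo x m fun c =>
      symFrame μ a (rad x) (fun i b c => vecAct (frame i) (fun y => H y b c) x) (H x) b c := by
  set φ := yanoUpCoeff μ a (rad x) with hφ
  set N : Fin 5 → Fin 5 → Fin 5 → ℂ := fun i b c => vecAct (frame i) (fun y => H y b c) x
    + ∑ d, (H x d c * connCoeff μ a (rad x) d i b + H x b d * connCoeff μ a (rad x) d i c) with hN
  have h1 : ∀ l m, ∑ κ, ∑ τ, killingYanoUp μ a x l κ τ * covD μ a h x κ m τ =
      ∑ c, ∑ d, (lo x l fun b => φ b c d) * (lo x m fun b => N c b d) := by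
    intro l m
    have hP : ∀ κ τ, killingYanoUp μ a x l κ τ =
        up x κ fun c => up x τ fun d => lo x l fun b => φ b c d := by
      intro κ τ
      refine (killingYanoUp_eq hx hG l κ τ).trans ((low_comm _ _ _ _ _).trans ?_)
      exact congrArg _ (funext fun c => low_comm _ _ _ _ _)
    have hQ : ∀ κ τ, covD μ a h x κ m τ = lo x κ fun c => lo x τ fun d => lo x m fun b => N c b d := by
      intro κ τ
      refine (covD_eq hx hG hH hh κ m τ).trans ?_
      exact congrArg _ (funext fun c => low_comm _ _ _ _ _)
    simp only [hP, hQ]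
    exact up_lo_contract₂ hx (fun c d => lo x l fun b => φ b c d) (fun c d => lo x m fun b => N c b d)
  have h2 : symFrame μ a (rad x) (fun i b c => vecAct (frame i) (fun y => H y b c) x) (H x) =
      fun l m => ∑ c, ∑ d, (φ l c d * N c m d + φ m c d * N c l d) := rfl
  rw [h2]
  -- From here only multilinearity matters, so the coefficient arrays are made opaque.
  clear_value φ N
  simp only [symOp, Finset.sum_add_distrib, h1, low_add, low_sum, low_mul_left, low_mul_right]

end

end

/-! ### Commutators of vector fields -/

section

variable {x : Pt} {F : Pt → ℂ}

theorem ContDiffAt.pd {m n : WithTop ℕ∞} (hF : ContDiffAt ℝ n F x) (hmn : m + 1 ≤ n) (κ : Fin 5) :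
    ContDiffAt ℝ m (pd κ F) x :=
  (hF.fderiv_right hmn).clm_apply contDiffAt_const

theorem ContDiffAt.vecAct {m n : WithTop ℕ∞} {X : VField} (hX : ∀ κ, ContDiffAt ℝ m (fun y => X y κ) x)
    (hF : ContDiffAt ℝ n F x) (hmn : m + 1 ≤ n) : ContDiffAt ℝ m (vecAct X F) x :=
  ContDiffAt.sum fun κ _ => (hX κ).mul (ContDiffAt.pd hF hmn κ)

theorem pd_comm (hF : ContDiffAt ℝ 2 F x) (κ ν : Fin 5) : pd κ (pd ν F) x = pd ν (pd κ F) x := by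
  have hd : DifferentiableAt ℝ (fderiv ℝ F) x :=
    (hF.fderiv_right (m := 1) (by norm_num)).differentiableAt (by simp)
  have h : ∀ κ ν, pd κ (pd ν F) x = fderiv ℝ (fderiv ℝ F) x (Pi.single κ 1) (Pi.single ν 1) := by
    intro κ ν
    have : pd ν F = fun y => fderiv ℝ F y (Pi.single ν 1) := rfl
    rw [this, pd, fderiv_clm_apply hd (differentiableAt_const _)]
    simp
  rw [h, h]
  exact (hF.isSymmSndFDerivAt (by simp)).eq _ _

/-- Second-order terms cancel by symmetry of second derivatives, which leaves the Lie bracket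
applied to `F`. -/
theorem vecAct_comm {X Y : VField} (hX : ∀ κ, DifferentiableAt ℝ (fun y => X y κ) x)
    (hY : ∀ κ, DifferentiableAt ℝ (fun y => Y y κ) x) (hF : ContDiffAt ℝ 2 F x) :
    vecAct X (vecAct Y F) x - vecAct Y (vecAct X F) x =
      ∑ κ, (vecAct X (fun y => Y y κ) x - vecAct Y (fun y => X y κ) x) * pd κ F x := by
  have hp : ∀ κ, DifferentiableAt ℝ (pd κ F) x := fun κ =>
    (ContDiffAt.pd (m := 1) hF (by norm_num) κ).differentiableAt (by simp)
  have h : ∀ {X Y : VField}, (∀ κ, DifferentiableAt ℝ (fun y => Y y κ) x) →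
      vecAct X (vecAct Y F) x = ∑ κ, vecAct X (fun y => Y y κ) x * pd κ F x
        + ∑ κ, ∑ ν, Y x κ * X x ν * pd ν (pd κ F) x := by
    intro X Y hY
    have : vecAct Y F = fun y => ∑ κ, Y y κ * pd κ F y := rfl
    rw [this, vecAct_sum fun κ _ => (hY κ).fun_mul (hp κ), ← Finset.sum_add_distrib]
    refine Finset.sum_congr rfl fun κ _ => ?_
    rw [vecAct_mul (hY κ) (hp κ)]
    congr 1
    simp only [vecAct, Finset.mul_sum]
    exact Finset.sum_congr rfl fun ν _ => by ring
  rw [h hY, h hX]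
  have h2 : ∑ κ, ∑ ν, Y x κ * X x ν * pd ν (pd κ F) x =
      ∑ κ, ∑ ν, X x κ * Y x ν * pd ν (pd κ F) x := by
    rw [Finset.sum_comm]
    refine Finset.sum_congr rfl fun κ _ => Finset.sum_congr rfl fun ν _ => ?_
    rw [pd_comm hF]
    ring
  rw [h2, add_sub_add_right_eq_sub, ← Finset.sum_sub_distrib]
  exact Finset.sum_congr rfl fun κ _ => by ring

end

/-! ### Generators of symmetries -/

/-- A vector field that preserves the radius and acts on the coframe by `w` times the charge. -/
structure IsGenerator (X : VField) (w : ℂ) : Prop where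
  contDiff : ∀ κ, ContDiff ℝ ∞ (fun x => X x κ)
  radius : ∀ x, 0 < rad x → ∑ κ, X x κ * dr x κ = 0
  coframe : ∀ x, 0 < rad x → ∀ b τ, vecAct X (fun y => coframe b y τ) x
    + ∑ ν, pd τ (fun y => X y ν) x * coframe b x ν = w * charge b * coframe b x τ
  frame : ∀ x, 0 < rad x → ∀ b κ, vecAct X (fun y => frame b y κ) x
    - vecAct (frame b) (fun y => X y κ) x = -(w * charge b) * frame b x κ

section

variable {X Y : VField} {w w' : ℂ} {x : Pt}

theorem IsGenerator.differentiableAt (hX : IsGenerator X w) (κ : Fin 5) (x : Pt) :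
    DifferentiableAt ℝ (fun y => X y κ) x := (hX.contDiff κ).differentiable (by simp) x

theorem IsGenerator.vecAct_comp_rad (hX : IsGenerator X w) (hx : 0 < rad x) {f : ℝ → ℂ}
    (hf : DifferentiableAt ℝ f (rad x)) : vecAct X (fun y => f (rad y)) x = 0 := by
  simp only [vecAct, pd_comp_rad hx hf]
  calc _ = deriv f (rad x) * ∑ κ, X x κ * dr x κ := by
        rw [Finset.mul_sum]
        exact Finset.sum_congr rfl fun κ _ => by ring
    _ = 0 := by rw [hX.radius x hx, mul_zero]

/-- This is `[X, e_b] = -w q_b e_b` applied to a function. -/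
theorem IsGenerator.vecAct_frame_comm (hX : IsGenerator X w) (hx : 0 < rad x) {F : Pt → ℂ}
    (hF : ContDiffAt ℝ 2 F x) (b : Fin 5) :
    vecAct X (vecAct (MyersPerry.frame b) F) x = vecAct (MyersPerry.frame b) (vecAct X F) x
      - w * charge b * vecAct (MyersPerry.frame b) F x := by
  have h := vecAct_comm (fun κ => hX.differentiableAt κ x) (differentiableAt_frame hx b) hF
  simp only [hX.frame x hx] at h
  rw [sub_eq_iff_eq_add] at h
  rw [h, sub_eq_neg_add, ← neg_mul]
  congr 1
  simp only [vecAct, Finset.mul_sum, mul_assoc, neg_mul, Finset.sum_neg_distrib]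

/-- The Lie derivative in terms of frame components. -/
theorem IsGenerator.lieD_eq (hX : IsGenerator X w) (hx : 0 < rad x) {h : Tensor2}
    {H : Pt → Fin 5 → Fin 5 → ℂ} (hH : ∀ b c, DifferentiableAt ℝ (fun y => H y b c) x)
    (hh : ∀ᶠ y in 𝓝 x, ∀ ρ τ, h y ρ τ = lo y ρ fun b => lo y τ fun c => H y b c) (ρ τ : Fin 5) :
    lieD X h x ρ τ = lo x ρ fun b => lo x τ fun c =>
      vecAct X (fun y => H y b c) x + w * (charge b + charge c : ℝ) * H x b c := by
  have hE := differentiableAt_coframe hx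
  have h0 := hh.self_of_nhds
  have hlo : ∀ f : Fin 5 → Fin 5 → ℂ, (lo x ρ fun b => lo x τ fun c => f b c) = ∑ b, ∑ c,
      f b c * (MyersPerry.coframe b x ρ * MyersPerry.coframe c x τ) := by
    intro f
    simp only [low, Finset.sum_mul]
    exact Finset.sum_congr rfl fun b _ => Finset.sum_congr rfl fun c _ => by ring
  have hEE : ∀ b c, DifferentiableAt ℝ (fun y => MyersPerry.coframe b y ρ * MyersPerry.coframe c y τ) x :=
    fun b c => (hE b ρ).fun_mul (hE c τ)
  have h1 : vecAct X (fun y => h y ρ τ) x = ∑ b, ∑ c, vecAct X (fun y =>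
      H y b c * (MyersPerry.coframe b y ρ * MyersPerry.coframe c y τ)) x := by
    rw [vecAct_congr (F' := fun y => ∑ b, ∑ c, H y b c *
      (MyersPerry.coframe b y ρ * MyersPerry.coframe c y τ)) (hh.mono fun y hy => ?_)]
    · rw [vecAct_sum fun b _ => DifferentiableAt.fun_sum fun c _ => (hH b c).fun_mul (hEE b c)]
      exact Finset.sum_congr rfl fun b _ => vecAct_sum fun c _ => (hH b c).fun_mul (hEE b c)
    · simp only [hy ρ τ, low, Finset.sum_mul]
      exact Finset.sum_congr rfl fun b _ => Finset.sum_congr rfl fun c _ => by ring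
  have h2 : ∀ ρ τ, ∑ ν, pd ρ (fun y => X y ν) x * h x ν τ = ∑ b, ∑ c, H x b c *
      ((∑ ν, pd ρ (fun y => X y ν) x * MyersPerry.coframe b x ν) * MyersPerry.coframe c x τ) := by
    intro ρ τ
    simp only [h0, low, Finset.mul_sum, Finset.sum_mul]
    rw [Finset.sum_comm]
    refine Finset.sum_congr rfl fun b _ => ?_
    rw [Finset.sum_comm]
    exact Finset.sum_congr rfl fun c _ => Finset.sum_congr rfl fun ν _ => by ring
  have h3 : ∀ ρ τ, ∑ ν, pd τ (fun y => X y ν) x * h x ρ ν = ∑ b, ∑ c, H x b c *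
      (MyersPerry.coframe b x ρ * (∑ ν, pd τ (fun y => X y ν) x * MyersPerry.coframe c x ν)) := by
    intro ρ τ
    simp only [h0, low, Finset.mul_sum, Finset.sum_mul]
    rw [Finset.sum_comm]
    refine Finset.sum_congr rfl fun b _ => ?_
    rw [Finset.sum_comm]
    exact Finset.sum_congr rfl fun c _ => Finset.sum_congr rfl fun ν _ => by ring
  rw [lieD, h1, Finset.sum_add_distrib, h2, h3]
  rw [hlo]
  simp only [← Finset.sum_add_distrib]
  refine Finset.sum_congr rfl fun b _ => Finset.sum_congr rfl fun c _ => ?_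
  rw [vecAct_mul (hH b c) (hEE b c), vecAct_mul (hE b ρ) (hE c τ),
    eq_sub_of_add_eq (hX.coframe x hx b ρ), eq_sub_of_add_eq (hX.coframe x hx c τ)]
  push_cast
  ring

end

/-! ### Frame components of tensor fields on the spacetime -/

/-- The frame components of a tensor field. -/
def comp (h : Tensor2) (x : Pt) (b c : Fin 5) : ℂ := ∑ κ, ∑ τ, h x κ τ * frame b x κ * frame c x τ

/-- Completeness of the frame, applied once to each index. -/
theorem eq_lo_comp (h : Tensor2) {x : Pt} (hx : 0 < rad x) (ρ τ : Fin 5) :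
    h x ρ τ = lo x ρ fun b => lo x τ fun c => comp h x b c := by
  have h1 : ∀ (E : Fin 5 → ℂ) τ, ∑ c, (∑ ν, E ν * frame c x ν) * coframe c x τ = E τ := by
    intro E τ
    calc _ = ∑ ν, E ν * ∑ c, coframe c x τ * frame c x ν := by
          simp only [Finset.sum_mul, Finset.mul_sum]
          rw [Finset.sum_comm]
          exact Finset.sum_congr rfl fun c _ => Finset.sum_congr rfl fun ν _ => by ring
      _ = _ := by simp [coframe_frame hx]
  have h2 : ∀ b, (lo x τ fun c => comp h x b c) = ∑ κ, h x κ τ * frame b x κ := by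
    intro b
    rw [← h1 (fun τ => ∑ κ, h x κ τ * frame b x κ) τ]
    refine Finset.sum_congr rfl fun c _ => ?_
    congr 1
    simp only [comp, Finset.sum_mul]
    exact Finset.sum_comm
  simp only [h2]
  exact (h1 (fun κ => h x κ τ) ρ).symm

section

variable {μ a : ℝ} {x : Pt}

theorem rad_pos_of_mem (hx : x ∈ spacetime μ a) : 0 < rad x := (abs_nonneg a).trans_lt hx.1

theorem isOpen_orbitSpace (μ a : ℝ) : IsOpen (orbitSpace μ a) := by
  have h : orbitSpace μ a = Prod.snd ⁻¹' (radii μ a ∩ Set.Ioi |a|) := by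
    ext p
    simp only [orbitSpace, radii, Set.mem_ofPred_eq, Set.mem_preimage, Set.mem_inter_iff, Set.mem_Ioi]
    exact ⟨fun hp => ⟨⟨(abs_nonneg a).trans_lt hp.1, hp.2⟩, hp.1⟩, fun hp => ⟨hp.2, hp.1.2⟩⟩
  rw [h]
  exact ((isOpen_radii μ a).inter isOpen_Ioi).preimage continuous_snd

theorem isOpen_spacetime (μ a : ℝ) : IsOpen (spacetime μ a) :=
  (isOpen_orbitSpace μ a).preimage ((continuous_apply 0).prodMk continuous_rad)

theorem radii_mem_nhds (hx : x ∈ spacetime μ a) : radii μ a ∈ 𝓝 (rad x) :=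
  (isOpen_radii μ a).mem_nhds ⟨rad_pos_of_mem hx, hx.2⟩

theorem contDiffAt_comp {h : Tensor2} {n : ℕ} (hh : ContDiffOn ℝ n h (spacetime μ a))
    (hx : x ∈ spacetime μ a) (b c : Fin 5) : ContDiffAt ℝ n (fun y => comp h y b c) x := by
  have h1 := hh.contDiffAt ((isOpen_spacetime μ a).mem_nhds hx)
  have h2 : ∀ b κ, ContDiffAt ℝ n (fun y => frame b y κ) x := fun b κ =>
    (contDiffAt_frame (rad_pos_of_mem hx) b κ).of_le (by exact_mod_cast le_top)
  exact ContDiffAt.sum fun κ _ => ContDiffAt.sum fun τ _ =>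
    ((contDiffAt_pi.1 (contDiffAt_pi.1 h1 κ) τ).mul (h2 b κ)).mul (h2 c τ)

theorem eventually_eq_lo {h : Tensor2} {H : Pt → Fin 5 → Fin 5 → ℂ} (hx : x ∈ spacetime μ a)
    (hh : ∀ y ∈ spacetime μ a, ∀ ρ τ, h y ρ τ = lo y ρ fun b => lo y τ fun c => H y b c) :
    ∀ᶠ y in 𝓝 x, ∀ ρ τ, h y ρ τ = lo y ρ fun b => lo y τ fun c => H y b c :=
  ((isOpen_spacetime μ a).eventually_mem hx).mono hh

variable {X Y : VField} {w w' : ℂ}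

theorem IsGenerator.contDiffAt {n : ℕ} (hX : IsGenerator X w) (κ : Fin 5) :
    ContDiffAt ℝ n (fun y => X y κ) x :=
  (hX.contDiff κ).contDiffAt.of_le (by exact_mod_cast le_top)

theorem IsGenerator.lieD_eq_on (hX : IsGenerator X w) {h : Tensor2}
    (hh : ContDiffOn ℝ 2 h (spacetime μ a)) (hx : x ∈ spacetime μ a) (ρ τ : Fin 5) :
    lieD X h x ρ τ = lo x ρ fun b => lo x τ fun c =>
      vecAct X (fun y => comp h y b c) x + w * (charge b + charge c : ℝ) * comp h x b c :=
  hX.lieD_eq (rad_pos_of_mem hx)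
    (fun b c => (contDiffAt_comp (n := 2) hh hx b c).differentiableAt (by simp))
    (eventually_eq_lo hx fun _ hy => eq_lo_comp h (rad_pos_of_mem hy)) ρ τ

theorem IsGenerator.contDiffAt_vecAct (hX : IsGenerator X w) {F : Pt → ℂ} (hF : ContDiffAt ℝ 2 F x) :
    ContDiffAt ℝ 1 (MyersPerry.vecAct X F) x :=
  ContDiffAt.vecAct (fun κ => hX.contDiffAt (n := 1) κ) hF (by norm_num)

/-- On components both Lie derivatives are a vector field plus a constant depending only on the
charges. The constants commute with everything, so only the Lie bracket matters, and `hXY` says that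
it vanishes. -/
theorem IsGenerator.lieD_comm (hX : IsGenerator X w) (hY : IsGenerator Y w')
    (hXY : ∀ x κ, vecAct X (fun y => Y y κ) x = vecAct Y (fun y => X y κ) x) {h : Tensor2}
    (hh : ContDiffOn ℝ 2 h (spacetime μ a)) (hx : x ∈ spacetime μ a) :
    lieD X (lieD Y h) x = lieD Y (lieD X h) x := by
  have hc : ∀ b c, ContDiffAt ℝ 2 (fun y => comp h y b c) x := contDiffAt_comp (n := 2) hh hx
  have hd : ∀ b c, DifferentiableAt ℝ (fun y => comp h y b c) x := fun b c =>
    (hc b c).differentiableAt (by simp)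
  have hvd : ∀ {X : VField} {w : ℂ}, IsGenerator X w → ∀ b c,
      DifferentiableAt ℝ (vecAct X fun y => comp h y b c) x := fun hX b c =>
    (hX.contDiffAt_vecAct (hc b c)).differentiableAt (by simp)
  have key : ∀ {X Y : VField} {w w' : ℂ}, IsGenerator X w → IsGenerator Y w' → ∀ ρ τ,
      lieD X (lieD Y h) x ρ τ = lo x ρ fun b => lo x τ fun c =>
        (vecAct X (vecAct Y fun y => comp h y b c) x
          + w' * (charge b + charge c : ℝ) * vecAct X (fun y => comp h y b c) x)
        + w * (charge b + charge c : ℝ) * (vecAct Y (fun y => comp h y b c) x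
          + w' * (charge b + charge c : ℝ) * comp h x b c) := by
    intro X Y w w' hX hY ρ τ
    rw [hX.lieD_eq (rad_pos_of_mem hx)
      (H := fun y b c => vecAct Y (fun y => comp h y b c) y
        + w' * (charge b + charge c : ℝ) * comp h y b c)
      (fun b c => (hvd hY b c).fun_add ((hd b c).const_mul _))
      (eventually_eq_lo hx fun _ hy => hY.lieD_eq_on hh hy)]
    simp only [vecAct_add (hvd hY _ _) ((hd _ _).const_mul _), vecAct_const_mul _ (hd _ _)]
  ext ρ τ
  rw [key hX hY, key hY hX]
  have hz : ∀ b c, vecAct X (vecAct Y fun y => comp h y b c) x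
      = vecAct Y (vecAct X fun y => comp h y b c) x := by
    intro b c
    have := vecAct_comm (fun κ => hX.differentiableAt κ x) (fun κ => hY.differentiableAt κ x) (hc b c)
    simpa [hXY, sub_eq_zero] using this
  simp only [hz]
  refine congrArg _ (funext fun b => congrArg _ (funext fun c => ?_))
  ring

/-- Both sides are expanded in the frame. `X` annihilates the radial coefficients, so it acts only
on the components and their frame derivatives; the remaining terms are counted by charge. -/
theorem IsGenerator.symOp_lieD (hX : IsGenerator X w) {h : Tensor2}
    (hh : ContDiffOn ℝ 2 h (spacetime μ a)) (hx : x ∈ spacetime μ a) :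
    symOp μ a (lieD X h) x = lieD X (symOp μ a h) x := by
  have hr := rad_pos_of_mem hx
  have hc : ∀ y ∈ spacetime μ a, ∀ b c, ContDiffAt ℝ 2 (fun y => comp h y b c) y := fun y hy =>
    contDiffAt_comp (n := 2) hh hy
  have hd : ∀ y ∈ spacetime μ a, ∀ b c, DifferentiableAt ℝ (fun y => comp h y b c) y :=
    fun y hy b c => (hc y hy b c).differentiableAt (by simp)
  have hvd : ∀ b c, DifferentiableAt ℝ (vecAct X fun y => comp h y b c) x := fun b c =>
    (hX.contDiffAt_vecAct (hc x hx b c)).differentiableAt (by simp)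
  have hfd : ∀ i b c, DifferentiableAt ℝ (vecAct (MyersPerry.frame i) fun y => comp h y b c) x :=
    fun i b c => (ContDiffAt.vecAct (m := 1) (fun κ => (contDiffAt_frame hr i κ).of_le
      (by exact_mod_cast le_top)) (hc x hx b c) (by norm_num)).differentiableAt (by simp)
  have hφ : ∀ l c d, DifferentiableAt ℝ (fun r => yanoUpCoeff μ a r l c d) (rad x) := fun l c d =>
    ((contDiffOn_yanoUpCoeff μ a l c d).contDiffAt (radii_mem_nhds hx)).differentiableAt (by simp)
  have hω : ∀ l c d, DifferentiableAt ℝ (fun r => connCoeff μ a r l c d) (rad x) := fun l c d =>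
    ((contDiffOn_connCoeff μ a l c d).contDiffAt (radii_mem_nhds hx)).differentiableAt (by simp)
  have hφ' := fun l c d => differentiableAt_comp_rad hr (hφ l c d)
  have hω' := fun l c d => differentiableAt_comp_rad hr (hω l c d)
  have hφ0 := fun l c d => hX.vecAct_comp_rad hr (hφ l c d)
  have hω0 := fun l c d => hX.vecAct_comp_rad hr (hω l c d)
  set D : Pt → Fin 5 → Fin 5 → Fin 5 → ℂ := fun y i b c =>
    vecAct (MyersPerry.frame i) (fun y => comp h y b c) y with hD
  have hS : ∀ y ∈ spacetime μ a, ∀ l m, symOp μ a h y l m = lo y l fun b => lo y m fun c =>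
      symFrame μ a (rad y) (D y) (comp h y) b c := fun y hy =>
    symOp_eq (rad_pos_of_mem hy) hy.2 (hd y hy)
      (eventually_eq_lo hy fun _ hz => eq_lo_comp h (rad_pos_of_mem hz))
  have hin : ∀ c m d, DifferentiableAt ℝ (fun y => D y c m d + ∑ e,
      (comp h y e d * connCoeff μ a (rad y) e c m + comp h y m e * connCoeff μ a (rad y) e c d)) x :=
    fun c m d => (hfd c m d).fun_add (DifferentiableAt.fun_sum fun e _ =>
      ((hd x hx e d).fun_mul (hω' e c m)).fun_add ((hd x hx m e).fun_mul (hω' e c d)))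
  have hin0 : ∀ c m d, vecAct X (fun y => D y c m d + ∑ e,
      (comp h y e d * connCoeff μ a (rad y) e c m + comp h y m e * connCoeff μ a (rad y) e c d)) x =
      vecAct X (fun y => D y c m d) x + ∑ e, (vecAct X (fun y => comp h y e d) x
        * connCoeff μ a (rad x) e c m
        + vecAct X (fun y => comp h y m e) x * connCoeff μ a (rad x) e c d) := by
    intro c m d
    have hs : ∀ e, DifferentiableAt ℝ (fun y => comp h y e d * connCoeff μ a (rad y) e c m
        + comp h y m e * connCoeff μ a (rad y) e c d) x := fun e =>
      ((hd x hx e d).fun_mul (hω' e c m)).fun_add ((hd x hx m e).fun_mul (hω' e c d))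
    rw [vecAct_add (hfd c m d) (DifferentiableAt.fun_sum fun e _ => hs e),
      vecAct_sum fun e _ => hs e]
    congr 1
    refine Finset.sum_congr rfl fun e _ => ?_
    rw [vecAct_add ((hd x hx e d).fun_mul (hω' e c m)) ((hd x hx m e).fun_mul (hω' e c d)),
      vecAct_mul (hd x hx e d) (hω' e c m), vecAct_mul (hd x hx m e) (hω' e c d), hω0, hω0]
    ring
  have hterm : ∀ l m c d, DifferentiableAt ℝ (fun y => yanoUpCoeff μ a (rad y) l c d *
        (D y c m d + ∑ e, (comp h y e d * connCoeff μ a (rad y) e c m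
          + comp h y m e * connCoeff μ a (rad y) e c d))
      + yanoUpCoeff μ a (rad y) m c d *
        (D y c l d + ∑ e, (comp h y e d * connCoeff μ a (rad y) e c l
          + comp h y l e * connCoeff μ a (rad y) e c d))) x := fun l m c d =>
    ((hφ' l c d).fun_mul (hin c m d)).fun_add ((hφ' m c d).fun_mul (hin c l d))
  have hXS : ∀ l m, vecAct X (fun y => symFrame μ a (rad y) (D y) (comp h y) l m) x =
      symFrame μ a (rad x) (fun i b c => vecAct X (fun y => D y i b c) x)
        (fun b c => vecAct X (fun y => comp h y b c) x) l m := by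
    intro l m
    simp only [symFrame]
    rw [vecAct_sum fun c _ => DifferentiableAt.fun_sum fun d _ => hterm l m c d]
    refine Finset.sum_congr rfl fun c _ => ?_
    rw [vecAct_sum fun d _ => hterm l m c d]
    refine Finset.sum_congr rfl fun d _ => ?_
    rw [vecAct_add ((hφ' l c d).fun_mul (hin c m d)) ((hφ' m c d).fun_mul (hin c l d)),
      vecAct_mul (hφ' l c d) (hin c m d), vecAct_mul (hφ' m c d) (hin c l d), hφ0, hφ0, hin0, hin0]
    ring
  have hDS : ∀ l m, DifferentiableAt ℝ (fun y => symFrame μ a (rad y) (D y) (comp h y) l m) x :=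
    fun l m => DifferentiableAt.fun_sum fun c _ => DifferentiableAt.fun_sum fun d _ => hterm l m c d
  ext ρ τ
  rw [hX.lieD_eq hr hDS (eventually_eq_lo hx hS), symOp_eq hr hx.2
    (H := fun y b c => vecAct X (fun y => comp h y b c) y
        + w * (charge b + charge c : ℝ) * comp h y b c)
    (fun b c => (hvd b c).fun_add ((hd x hx b c).const_mul _))
    (eventually_eq_lo hx fun _ hy => hX.lieD_eq_on hh hy)]
  refine congrArg _ (funext fun l => congrArg _ (funext fun m => ?_))
  rw [hXS]
  -- The outer term `w (q_l + q_m)` is moved inside, where it becomes `w (q_i + q_b + q_c)` on frame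
  -- derivatives and `w (q_b + q_c)` on components. The excess `w q_i` is exactly the commutator of
  -- `X` with `e_i`.
  have h1 := symFrame_charge μ a (rad x) (D x) (comp h x) (fun q => w * (q : ℂ)) l m
  rw [mul_comm (w * _), ← h1, ← symFrame_add]
  congr 1
  · ext i b c
    rw [vecAct_add (hvd b c) ((hd x hx b c).const_mul _), vecAct_const_mul _ (hd x hx b c)]
    simp only [hD]
    rw [hX.vecAct_frame_comm hr (hc x hx b c)]
    push_cast
    ring
  · ext b c
    ring

end

/-! ### The symmetry generators -/

/-- Antisymmetry makes the fields rotations, and `matP * M = M` says that they have no time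
component; together these make them tangent to the spheres `r̃ = const`. -/
theorem matE_antisymm : (∀ i, (matS i).transpose = -matS i ∧ matP * matS i = matS i) ∧
    ∀ i, (matXi i).transpose = -matXi i ∧ matP * matXi i = matXi i := by
  refine ⟨fun i => ⟨?_, ?_⟩, fun i => ⟨?_, ?_⟩⟩ <;> fin_cases i <;> ext κ τ <;>
    fin_cases κ <;> fin_cases τ <;> simp [matS, matXi, matP, Matrix.mul_apply, Fin.sum_univ_five]

/-- Left and right quaternion multiplications commute. -/
theorem matS_comm_matXi (i j : Fin 3) : matS i * matXi j = matXi j * matS i := by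
  fin_cases i <;> fin_cases j <;> ext κ τ <;>
    fin_cases κ <;> fin_cases τ <;> simp [matS, matXi, Matrix.mul_apply, Fin.sum_univ_five]

theorem matS_comm : matS 0 * matS 2 - matS 2 * matS 0 = (2 : ℂ) • matS 1 ∧
    matS 1 * matS 2 - matS 2 * matS 1 = (-2 : ℂ) • matS 0 := by
  constructor <;> ext κ τ <;> fin_cases κ <;> fin_cases τ <;>
    simp [matS] <;> norm_num

theorem lin_mul (N M : Matrix (Fin 5) (Fin 5) ℂ) (x : Pt) (κ : Fin 5) :
    lin (N * M) x κ = ∑ ν, N κ ν * lin M x ν := by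
  simp only [lin, Matrix.mul_apply, Finset.sum_mul, Finset.mul_sum]
  rw [Finset.sum_comm]
  exact Finset.sum_congr rfl fun _ _ => Finset.sum_congr rfl fun _ _ => by ring

theorem sum_lin_mul_lin_matP {M : Matrix (Fin 5) (Fin 5) ℂ} (hM : M.transpose = -M)
    (hP : matP * M = M) (x : Pt) : ∑ κ, lin M x κ * lin matP x κ = 0 := by
  have hM' : ∀ κ τ, M τ κ = -M κ τ := fun κ τ => congrFun (congrFun hM κ) τ
  have h1 : ∑ κ, lin M x κ * lin matP x κ = ∑ κ, ∑ ν, M κ ν * x ν * x κ := by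
    have hr : lin M x 0 = 0 := by
      rw [← hP, lin_mul]
      simp [matP, Fin.sum_univ_five]
    calc _ = ∑ κ, lin M x κ * x κ := by
          refine Finset.sum_congr rfl fun κ _ => ?_
          fin_cases κ
          · simp [hr]
          all_goals simp [lin, matP, Fin.sum_univ_five]
      _ = _ := by simp only [lin, Finset.sum_mul]
  have h2 : ∑ κ, ∑ ν, M κ ν * x ν * x κ = -∑ κ, ∑ ν, M κ ν * x ν * x κ := by
    conv_lhs => rw [Finset.sum_comm]
    rw [← Finset.sum_neg_distrib]
    refine Finset.sum_congr rfl fun κ _ => ?_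
    rw [← Finset.sum_neg_distrib]
    refine Finset.sum_congr rfl fun ν _ => ?_
    rw [hM']
    ring
  rw [h1]
  linear_combination h2 / 2

/-- A rotation does not see the radius, so only the linear numerator is differentiated. -/
theorem vecAct_lin_mul_inv_pow {M : Matrix (Fin 5) (Fin 5) ℂ} (hM : M.transpose = -M)
    (hP : matP * M = M) (c : ℂ) (N : Matrix (Fin 5) (Fin 5) ℂ) (n : ℕ) {x : Pt} (hx : 0 < rad x)
    (τ : Fin 5) : vecAct (lin M) (fun y => c + lin N y τ * ((rad y : ℂ) ^ n)⁻¹) x =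
      lin (N * M) x τ * ((rad x : ℂ) ^ n)⁻¹ := by
  simp only [vecAct, pd_lin_mul_inv_pow c N n hx, lin_mul]
  calc _ = (∑ κ, N τ κ * lin M x κ) * ((rad x : ℂ) ^ n)⁻¹
        - n * lin N x τ * ((rad x : ℂ) ^ (n + 2))⁻¹ * ∑ κ, lin M x κ * lin matP x κ := by
        rw [Finset.sum_mul, Finset.mul_sum, ← Finset.sum_sub_distrib]
        exact Finset.sum_congr rfl fun κ _ => by ring
    _ = _ := by rw [sum_lin_mul_lin_matP hM hP, mul_zero, sub_zero]

/-- For a linear field `M` the Lie derivative of a covector with numerator `N` has numerator `N M +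
Mᵀ N = N M - M N` by antisymmetry, and the bracket with a frame vector is again `N M - M N`. The
conditions on a generator thus become eigenvalue equations for matrix commutators. -/
theorem isGenerator_lin {X : VField} {w : ℂ} {M : Matrix (Fin 5) (Fin 5) ℂ}
    (hX : ∀ x κ, X x κ = lin M x κ) (hM : M.transpose = -M) (hP : matP * M = M)
    (hE : ∀ b, matE b * M - M * matE b = (w * charge b) • matE b)
    (hV : ∀ b, matV b * M - M * matV b = -(w * charge b) • matV b) : IsGenerator X w := by
  obtain rfl : X = lin M := by ext x κ; exact hX x κ
  have hM' : ∀ κ τ, M τ κ = -M κ τ := fun κ τ => congrFun (congrFun hM κ) τ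
  have hP0 := sum_lin_mul_lin_matP hM hP
  have hact := fun c N n x (hx : 0 < rad x) τ => vecAct_lin_mul_inv_pow hM hP c N n (x := x) hx τ
  have hM0 : ∀ τ, M 0 τ = 0 ∧ M τ 0 = 0 := by
    intro τ
    have : M 0 τ = 0 := by
      rw [← hP, Matrix.mul_apply]
      simp [matP, Fin.sum_univ_five]
    exact ⟨this, by rw [hM' 0 τ, this, neg_zero]⟩
  refine ⟨contDiff_lin M, ?_, ?_, ?_⟩
  · intro x hx
    simp only [dr_eq, mul_div_assoc']
    rw [← Finset.sum_div, hP0, zero_div]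
  · intro x hx b τ
    simp only [coframe_eq, hact _ _ _ x hx, pd_lin]
    have h1 : ∑ ν, M ν τ * ((if b = 0 ∧ ν = 0 then 1 else 0)
        + lin (matE b) x ν * ((rad x : ℂ) ^ expE b)⁻¹) =
        -(lin (M * matE b) x τ * ((rad x : ℂ) ^ expE b)⁻¹) := by
      simp only [mul_add, Finset.sum_add_distrib, lin_mul]
      have : ∑ ν, M ν τ * (if b = 0 ∧ ν = 0 then (1 : ℂ) else 0) = 0 :=
        Finset.sum_eq_zero fun ν _ => by
          by_cases hν : b = 0 ∧ ν = 0
          · rw [hν.2, (hM0 τ).1, zero_mul]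
          · rw [if_neg hν, mul_zero]
      rw [this, zero_add, Finset.sum_mul, ← Finset.sum_neg_distrib]
      exact Finset.sum_congr rfl fun ν _ => by rw [hM' τ ν]; ring
    have h2 := congrArg (fun N => lin N x τ) (hE b)
    simp only [lin_sub, lin_smul] at h2
    -- The constant part belongs to `dt` alone, which has charge zero.
    have h3 : charge b * (if b = 0 ∧ τ = 0 then (1 : ℂ) else 0) = 0 := by
      by_cases hν : b = 0 ∧ τ = 0
      · rw [hν.1]; simp [charge]
      · rw [if_neg hν, mul_zero]
    rw [h1]
    linear_combination ((rad x : ℂ) ^ expE b)⁻¹ * h2 - w * h3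
  · intro x hx b κ
    have h1 : vecAct (frame b) (fun y => lin M y κ) x =
        lin (M * matV b) x κ * ((rad x : ℂ) ^ expV b)⁻¹ := by
      rw [vecAct_lin]
      simp only [frame, mul_add, Finset.sum_add_distrib, lin_mul]
      have : ∑ ν, M κ ν * (if b = 0 ∧ ν = 0 then (1 : ℂ) else 0) = 0 :=
        Finset.sum_eq_zero fun ν _ => by
          by_cases hν : b = 0 ∧ ν = 0
          · rw [hν.2, (hM0 κ).2, zero_mul]
          · rw [if_neg hν, mul_zero]
      rw [this, zero_add, Finset.sum_mul]
      exact Finset.sum_congr rfl fun ν _ => by ring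
    have h2 := congrArg (fun N => lin N x κ) (hV b)
    simp only [lin_sub, lin_smul] at h2
    have h3 : charge b * (if b = 0 ∧ κ = 0 then (1 : ℂ) else 0) = 0 := by
      by_cases hν : b = 0 ∧ κ = 0
      · rw [hν.1]; simp [charge]
      · rw [if_neg hν, mul_zero]
    rw [h1]
    simp only [frame, hact _ _ _ x hx]
    linear_combination ((rad x : ℂ) ^ expV b)⁻¹ * h2 + w * h3

theorem matP_comm {M : Matrix (Fin 5) (Fin 5) ℂ} (hM : M.transpose = -M) (hP : matP * M = M) :
    M * matP = M := by
  have h : matP.transpose = matP := by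
    ext κ τ
    fin_cases κ <;> fin_cases τ <;> simp [matP]
  have := congrArg Matrix.transpose hP
  rw [Matrix.transpose_mul, h, hM] at this
  simpa using this

theorem W_eq (i : Fin 3) (x : Pt) (κ : Fin 5) : W i x κ = lin ((Complex.I / 2) • matS i) x κ := by
  rw [W, sigVec_eq, lin_smul]; ring

theorem L_eq (i : Fin 3) (x : Pt) (κ : Fin 5) : L i x κ = lin ((Complex.I / 2) • matXi i) x κ := by
  rw [L, xiVec_eq, lin_smul]; ring

theorem isGenerator_L (i : Fin 3) : IsGenerator (L i) 0 := by
  obtain ⟨h1, h2⟩ := matE_antisymm.2 i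
  refine isGenerator_lin (L_eq i) (by simp [h1]) (by simp [h2]) ?_ ?_
  · intro b
    obtain ⟨e0, e1, e2, e3, e4⟩ := matE_apply
    match b with
    | 0 => simp [e0]
    | 1 => simp [e1, h2, matP_comm h1 h2]
    | 2 => simp [e2, mul_add, add_mul, matS_comm_matXi]; module
    | 3 => simp [e3, mul_sub, sub_mul, matS_comm_matXi]; module
    | 4 => simp [e4, matS_comm_matXi]
  · intro b
    obtain ⟨e0, e1, e2, e3, e4⟩ := matV_apply
    match b with
    | 0 => simp [e0]
    | 1 => simp [e1, h2, matP_comm h1 h2]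
    | 2 => simp [e2, mul_sub, sub_mul, matS_comm_matXi]; module
    | 3 => simp [e3, mul_add, add_mul, matS_comm_matXi]; module
    | 4 => simp [e4, matS_comm_matXi]

/-- `S₀ ± i S₁` are eigenvectors of the commutator with `S₂`; the sign `ε = ±1` treats both at once.
-/
theorem matS_ladder (ε : ℂ) (hε : ε * ε = 1) :
    (rt • (matS 0 + (ε * Complex.I) • matS 1)) * ((Complex.I / 2) • matS 2)
      - ((Complex.I / 2) • matS 2) * (rt • (matS 0 + (ε * Complex.I) • matS 1)) =
      ε • (rt • (matS 0 + (ε * Complex.I) • matS 1)) := by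
  obtain ⟨c0, c1⟩ := matS_comm
  have hI := Complex.I_mul_I
  calc _ = (rt * Complex.I / 2) • (matS 0 * matS 2 - matS 2 * matS 0)
        + (rt * ε * (Complex.I * Complex.I) / 2) • (matS 1 * matS 2 - matS 2 * matS 1) := by
        simp only [Matrix.mul_smul, Matrix.smul_mul, mul_add, add_mul]
        module
    _ = (ε * ε * rt * Complex.I) • matS 1 + (rt * ε) • matS 0 := by
        rw [c0, c1, hI, hε]
        module
    _ = _ := by module

theorem isGenerator_W : IsGenerator (W 2) 1 := by
  obtain ⟨h1, h2⟩ := matE_antisymm.1 2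
  have l1 := matS_ladder 1 (by norm_num)
  have l2 := matS_ladder (-1) (by norm_num)
  simp only [one_mul, neg_mul, neg_smul, one_smul, ← sub_eq_add_neg] at l1 l2
  refine isGenerator_lin (W_eq 2) (by simp [h1]) (by simp [h2]) ?_ ?_
  · intro b
    obtain ⟨e0, e1, e2, e3, e4⟩ := matE_apply
    match b with
    | 0 => simp [e0]
    | 1 => simp [e1, h2, matP_comm h1 h2, charge]
    | 2 => rw [e2, l1]; simp [charge]
    | 3 => rw [e3, l2]; simp [charge]
    | 4 => simp [e4, charge]
  · intro b
    obtain ⟨e0, e1, e2, e3, e4⟩ := matV_apply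
    match b with
    | 0 => simp [e0]
    | 1 => simp [e1, h2, matP_comm h1 h2, charge]
    -- The frame member dual to `σ̄⁺` has the conjugate numerator, so `l1` and `l2` change places
    -- here.
    | 2 => rw [e2, l2]; simp [charge]
    | 3 => rw [e3, l1]; simp [charge]
    | 4 => simp [e4, charge]

/-- `T` is constant rather than linear, so `isGenerator_lin` does not apply; frame and coframe do
not depend on `t`, since the time columns of their matrices vanish. -/
theorem isGenerator_T : IsGenerator T 0 := by
  have hT : ∀ x κ, T x κ = if κ = 0 then Complex.I else 0 := by
    intro x κ
    fin_cases κ <;> simp [T]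
  have h0 : ∀ b κ, matE b κ 0 = 0 ∧ matV b κ 0 = 0 := by
    obtain ⟨e0, e1, e2, e3, e4⟩ := matE_apply
    obtain ⟨f0, f1, f2, f3, f4⟩ := matV_apply
    intro b κ
    match b with
    | 0 => simp [e0, f0]
    | 1 => rw [e1, f1]; fin_cases κ <;> simp [matP]
    | 2 => rw [e2, f2]; fin_cases κ <;> simp [matS]
    | 3 => rw [e3, f3]; fin_cases κ <;> simp [matS]
    | 4 => rw [e4, f4]; fin_cases κ <;> simp [matS]
  have hP : ∀ x, lin matP x 0 = 0 := fun x => by simp [lin, matP, Fin.sum_univ_five]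
  refine ⟨fun κ => contDiff_const, ?_, ?_, ?_⟩
  · intro x _
    simp [hT, dr_eq, hP]
  · intro x hx b τ
    have h1 : ∀ ν, pd τ (fun y => T y ν) x = 0 := fun ν => pd_const _
    simp only [h1, coframe_eq, vecAct, pd_lin_mul_inv_pow _ _ _ hx]
    simp [hT, h0, hP]
  · intro x hx b κ
    have h1 : vecAct (frame b) (fun y => T y κ) x = 0 := vecAct_const _
    rw [h1]
    simp only [frame, vecAct, pd_lin_mul_inv_pow _ _ _ hx]
    simp [hT, h0, hP]

theorem vecAct_W_L (i : Fin 3) (x : Pt) (κ : Fin 5) :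
    vecAct (W 2) (fun y => L i y κ) x = vecAct (L i) (fun y => W 2 y κ) x := by
  simp only [W_eq, L_eq, vecAct_lin, ← lin_mul]
  simp [matS_comm_matXi]

theorem vecAct_lin_T (M : Matrix (Fin 5) (Fin 5) ℂ) (hM : ∀ κ, M κ 0 = 0) {X : VField}
    (hX : ∀ x κ, X x κ = lin M x κ) (x : Pt) (κ : Fin 5) :
    vecAct X (fun y => T y κ) x = vecAct T (fun y => X y κ) x := by
  have h1 : vecAct X (fun y => T y κ) x = 0 := vecAct_const _
  simp only [h1, hX, vecAct_lin]
  simp [T, Fin.sum_univ_five, hM]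

section

open Polynomial

/-! ### Derivatives of polynomial-valued functions -/

/-- The coefficients of `Q` are differentiable at `x`, and `X` maps them to those of `Q'`. -/
def HasPolyDeriv (X : VField) (x : Pt) (Q : Pt → ℂ[X]) (Q' : ℂ[X]) : Prop :=
  ∀ p, DifferentiableAt ℝ (fun y => (Q y).coeff p) x ∧
    vecAct X (fun y => (Q y).coeff p) x = Q'.coeff p

section

variable {X : VField} {x : Pt} {Q R : Pt → ℂ[X]} {Q' R' : ℂ[X]}

theorem HasPolyDeriv.mul (hQ : HasPolyDeriv X x Q Q') (hR : HasPolyDeriv X x R R') :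
    HasPolyDeriv X x (fun y => Q y * R y) (Q' * R x + Q x * R') := by
  intro p
  have hd : ∀ ij : ℕ × ℕ, DifferentiableAt ℝ (fun y => (Q y).coeff ij.1 * (R y).coeff ij.2) x :=
    fun ij => (hQ ij.1).1.fun_mul (hR ij.2).1
  simp only [coeff_mul, coeff_add]
  refine ⟨DifferentiableAt.fun_sum fun ij _ => hd ij, ?_⟩
  rw [vecAct_sum fun ij _ => hd ij, ← Finset.sum_add_distrib]
  refine Finset.sum_congr rfl fun ij _ => ?_
  rw [vecAct_mul (hQ ij.1).1 (hR ij.2).1, (hQ ij.1).2, (hR ij.2).2]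

theorem HasPolyDeriv.pow (hQ : HasPolyDeriv X x Q Q') (n : ℕ) :
    HasPolyDeriv X x (fun y => Q y ^ n) (n * Q x ^ (n - 1) * Q') := by
  induction n with
  | zero =>
    intro p
    simp only [pow_zero]
    exact ⟨differentiableAt_const _, by simp [vecAct_const]⟩
  | succ n ih =>
    have h := ih.mul hQ
    have e : (n * Q x ^ (n - 1) * Q') * Q x + Q x ^ n * Q' =
        ((n + 1 : ℕ) : ℂ[X]) * Q x ^ (n + 1 - 1) * Q' := by
      -- For `n = 0` the truncated exponent `n - 1` is harmless, because the factor `n` vanishes.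
      rcases n with _ | n
      · simp
      · simp only [Nat.add_sub_cancel]
        push_cast
        ring
    rw [e] at h
    simpa only [pow_succ] using h

theorem hasPolyDeriv_linear {f g : Pt → ℂ} (hf : DifferentiableAt ℝ f x)
    (hg : DifferentiableAt ℝ g x) : HasPolyDeriv X x (fun y => C (f y) * Polynomial.X + C (g y))
      (C (vecAct X f x) * Polynomial.X + C (vecAct X g x)) := by
  intro p
  rcases p with _ | _ | p
  · simpa using hg
  · simpa [coeff_C] using hf
  · simp [vecAct_const]

end

/-! ### Action of vector fields on the Wigner functions -/

/-- The rows of the linear forms `x₁ ± i x₂`. -/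
def rowZ (ε : ℂ) : Matrix (Fin 5) (Fin 5) ℂ := Matrix.of fun _ => ![0, 1, ε * Complex.I, 0, 0]

/-- The rows of the linear forms `x₃ ± i x₄`. -/
def rowW (ε : ℂ) : Matrix (Fin 5) (Fin 5) ℂ := Matrix.of fun _ => ![0, 0, 0, 1, ε * Complex.I]

/-- The redundant `0 +` and `^ 1` match the form in `pd_lin_mul_inv_pow`. All rows of `rowZ` are
equal, and only component `0` is read. -/
theorem zed_eq (x : Pt) : zed x = 0 + lin (rowZ 1) x 0 * ((rad x : ℂ) ^ 1)⁻¹ := by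
  simp [zed, lin, rowZ, Fin.sum_univ_five, div_eq_mul_inv]

theorem wed_eq (x : Pt) : wed x = 0 + lin (rowW 1) x 0 * ((rad x : ℂ) ^ 1)⁻¹ := by
  simp [wed, lin, rowW, Fin.sum_univ_five, div_eq_mul_inv]

theorem conj_zed_eq (x : Pt) :
    starRingEnd ℂ (zed x) = 0 + lin (rowZ (-1)) x 0 * ((rad x : ℂ) ^ 1)⁻¹ := by
  simp [zed, lin, rowZ, Fin.sum_univ_five, div_eq_mul_inv]

theorem conj_wed_eq (x : Pt) :
    starRingEnd ℂ (wed x) = 0 + lin (rowW (-1)) x 0 * ((rad x : ℂ) ^ 1)⁻¹ := by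
  simp [wed, lin, rowW, Fin.sum_univ_five, div_eq_mul_inv]

/-- The normalization of the Wigner functions. -/
def wignerNorm (n p q : ℕ) : ℝ :=
  Real.sqrt ((p.factorial * (n - p).factorial : ℝ) / (q.factorial * (n - q).factorial))

/-- The first linear factor of the generating polynomial. -/
def polyA (x : Pt) : ℂ[X] := C (starRingEnd ℂ (wed x)) * Polynomial.X + C (zed x)

/-- The second linear factor of the generating polynomial. -/
def polyB (x : Pt) : ℂ[X] := C (starRingEnd ℂ (zed x)) * Polynomial.X + C (-wed x)

theorem wignerNat_eq (n p q : ℕ) (x : Pt) :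
    wignerNat n p q x = wignerNorm n p q * (polyA x ^ q * polyB x ^ (n - q)).coeff p := by
  simp [wignerNat, wignerNorm, polyA, polyB, sub_eq_add_neg]

section

variable {x : Pt}

theorem differentiableAt_lin_div (hx : 0 < rad x) (N : Matrix (Fin 5) (Fin 5) ℂ) :
    DifferentiableAt ℝ (fun y => 0 + lin N y 0 * ((rad y : ℂ) ^ 1)⁻¹) x :=
  (contDiffAt_lin_mul_inv_pow 0 N 1 hx 0).differentiableAt (by simp)

theorem hasPolyDeriv_polyA (hx : 0 < rad x) (X : VField) : HasPolyDeriv X x polyA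
    (C (vecAct X (fun y => 0 + lin (rowW (-1)) y 0 * ((rad y : ℂ) ^ 1)⁻¹) x) * Polynomial.X
      + C (vecAct X (fun y => 0 + lin (rowZ 1) y 0 * ((rad y : ℂ) ^ 1)⁻¹) x)) := by
  have h : polyA = fun y => C (0 + lin (rowW (-1)) y 0 * ((rad y : ℂ) ^ 1)⁻¹) * Polynomial.X
      + C (0 + lin (rowZ 1) y 0 * ((rad y : ℂ) ^ 1)⁻¹) := by
    ext1 y; rw [polyA, conj_wed_eq, zed_eq]
  rw [h]
  exact hasPolyDeriv_linear (differentiableAt_lin_div hx _) (differentiableAt_lin_div hx _)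

theorem hasPolyDeriv_polyB (hx : 0 < rad x) (X : VField) : HasPolyDeriv X x polyB
    (C (vecAct X (fun y => 0 + lin (rowZ (-1)) y 0 * ((rad y : ℂ) ^ 1)⁻¹) x) * Polynomial.X
      + C (-vecAct X (fun y => 0 + lin (rowW 1) y 0 * ((rad y : ℂ) ^ 1)⁻¹) x)) := by
  have h : polyB = fun y => C (0 + lin (rowZ (-1)) y 0 * ((rad y : ℂ) ^ 1)⁻¹) * Polynomial.X
      + C (-1 * (0 + lin (rowW 1) y 0 * ((rad y : ℂ) ^ 1)⁻¹)) := by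
    ext1 y; rw [polyB, conj_zed_eq, wed_eq, neg_one_mul]
  rw [h, ← neg_one_mul (vecAct X _ x), ← vecAct_const_mul (-1) (differentiableAt_lin_div hx (rowW 1))]
  exact hasPolyDeriv_linear (differentiableAt_lin_div hx _)
    ((differentiableAt_lin_div hx _).const_mul _)

/-- Action of a vector field on a Wigner function, given its action on the linear factors. -/
theorem vecAct_wignerNat {X : VField} {A' B' : ℂ[X]} (hA : HasPolyDeriv X x polyA A')
    (hB : HasPolyDeriv X x polyB B') (n p q : ℕ) : vecAct X (wignerNat n p q) x =
      wignerNorm n p q * ((q * polyA x ^ (q - 1) * A') * polyB x ^ (n - q)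
        + polyA x ^ q * (((n - q : ℕ) : ℂ[X]) * polyB x ^ (n - q - 1) * B')).coeff p := by
  have h := ((hA.pow q).mul (hB.pow (n - q))) p
  have e : wignerNat n p q = fun y => wignerNorm n p q *
    (polyA y ^ q * polyB y ^ (n - q)).coeff p := funext fun y => wignerNat_eq n p q y
  rw [e, vecAct_const_mul _ h.1, h.2]

theorem differentiableAt_wignerNat (hx : 0 < rad x) (n p q : ℕ) : DifferentiableAt ℝ (wignerNat n p q) x := by
  have h := (((hasPolyDeriv_polyA hx 0).pow q).mul ((hasPolyDeriv_polyB hx 0).pow (n - q))) p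
  have e : wignerNat n p q = fun y => wignerNorm n p q *
    (polyA y ^ q * polyB y ^ (n - q)).coeff p := funext fun y => wignerNat_eq n p q y
  rw [e]
  exact h.1.const_mul _

end

/-! ### The two actions on the linear factors of the generating polynomial -/

section

variable {x : Pt}

theorem hasPolyDeriv_lin (hx : 0 < rad x) {M : Matrix (Fin 5) (Fin 5) ℂ} (hM : M.transpose = -M)
    (hP : matP * M = M) :
    HasPolyDeriv (lin M) x polyA (C (lin (rowW (-1) * M) x 0 * (rad x : ℂ)⁻¹) * X
      + C (lin (rowZ 1 * M) x 0 * (rad x : ℂ)⁻¹)) ∧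
    HasPolyDeriv (lin M) x polyB (C (lin (rowZ (-1) * M) x 0 * (rad x : ℂ)⁻¹) * X
      + C (-(lin (rowW 1 * M) x 0 * (rad x : ℂ)⁻¹))) := by
  have hA := hasPolyDeriv_polyA hx (lin M)
  have hB := hasPolyDeriv_polyB hx (lin M)
  simp only [vecAct_lin_mul_inv_pow hM hP 0 _ 1 hx] at hA hB
  simp only [pow_one] at hA hB
  exact ⟨hA, hB⟩

/-- Matrices of `W₃`, `W₊`, `W₋`. -/
def matW : Fin 3 → Matrix (Fin 5) (Fin 5) ℂ :=
  ![(Complex.I / 2) • matS 2, (Complex.I / 2) • (matS 0 + Complex.I • matS 1),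
    (Complex.I / 2) • (matS 0 - Complex.I • matS 1)]

/-- Matrices of `L₃`, `L₊`, `L₋`. -/
def matL : Fin 3 → Matrix (Fin 5) (Fin 5) ℂ :=
  ![(Complex.I / 2) • matXi 2, (Complex.I / 2) • (matXi 0 + Complex.I • matXi 1),
    (Complex.I / 2) • (matXi 0 - Complex.I • matXi 1)]

theorem matW_antisymm (i : Fin 3) : (matW i).transpose = -matW i ∧ matP * matW i = matW i := by
  have h := matE_antisymm.1
  fin_cases i <;> simp [matW, (h _).1, (h _).2, mul_add, mul_sub] <;> module

theorem matL_antisymm (i : Fin 3) : (matL i).transpose = -matL i ∧ matP * matL i = matL i := by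
  have h := matE_antisymm.2
  fin_cases i <;> simp [matL, (h _).1, (h _).2, mul_add, mul_sub] <;> module

theorem lin_rowZ (ε : ℂ) (x : Pt) : lin (rowZ ε) x 0 = x 1 + ε * Complex.I * x 2 := by
  simp [lin, rowZ, Fin.sum_univ_five]

theorem lin_rowW (ε : ℂ) (x : Pt) : lin (rowW ε) x 0 = x 3 + ε * Complex.I * x 4 := by
  simp [lin, rowW, Fin.sum_univ_five]

theorem lin_row_mul (ε : ℂ) (M : Matrix (Fin 5) (Fin 5) ℂ) (x : Pt) :
    lin (rowZ ε * M) x 0 = lin M x 1 + ε * Complex.I * lin M x 2 ∧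
    lin (rowW ε * M) x 0 = lin M x 3 + ε * Complex.I * lin M x 4 := by
  simp [lin_mul, rowZ, rowW, Fin.sum_univ_five]

theorem lin_matS (x : Pt) :
    (lin (matS 0) x 1 = -x 4 ∧ lin (matS 0) x 2 = -x 3 ∧ lin (matS 0) x 3 = x 2 ∧
      lin (matS 0) x 4 = x 1) ∧
    (lin (matS 1) x 1 = -x 3 ∧ lin (matS 1) x 2 = x 4 ∧ lin (matS 1) x 3 = x 1 ∧
      lin (matS 1) x 4 = -x 2) ∧
    (lin (matS 2) x 1 = -x 2 ∧ lin (matS 2) x 2 = x 1 ∧ lin (matS 2) x 3 = -x 4 ∧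
      lin (matS 2) x 4 = x 3) := by
  simp [lin, matS, Fin.sum_univ_five]

theorem lin_matXi (x : Pt) :
    (lin (matXi 0) x 1 = -x 4 ∧ lin (matXi 0) x 2 = x 3 ∧ lin (matXi 0) x 3 = -x 2 ∧
      lin (matXi 0) x 4 = x 1) ∧
    (lin (matXi 1) x 1 = -x 3 ∧ lin (matXi 1) x 2 = -x 4 ∧ lin (matXi 1) x 3 = x 1 ∧
      lin (matXi 1) x 4 = x 2) ∧
    (lin (matXi 2) x 1 = x 2 ∧ lin (matXi 2) x 2 = -x 1 ∧ lin (matXi 2) x 3 = -x 4 ∧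
      lin (matXi 2) x 4 = x 3) := by
  simp [lin, matXi, Fin.sum_univ_five]

theorem HasPolyDeriv.congr_coeff {P : Pt → ℂ[X]} {Y : VField} {u v u' v' : ℂ} {Q : ℂ[X]}
    (h : HasPolyDeriv Y x P (C u * X + C v)) (hu : u = u') (hv : v = v')
    (hQ : Q = C u' * X + C v') : HasPolyDeriv Y x P Q := by
  subst hu hv hQ; exact h

theorem polyA_eq (x : Pt) : polyA x = C (lin (rowW (-1)) x 0 * (rad x : ℂ)⁻¹) * X
    + C (lin (rowZ 1) x 0 * (rad x : ℂ)⁻¹) := by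
  rw [polyA, conj_wed_eq, zed_eq, zero_add, zero_add, pow_one]

theorem polyB_eq (x : Pt) : polyB x = C (lin (rowZ (-1)) x 0 * (rad x : ℂ)⁻¹) * X
    + C (-(lin (rowW 1) x 0 * (rad x : ℂ)⁻¹)) := by
  rw [polyB, conj_zed_eq, wed_eq, zero_add, zero_add, pow_one]

theorem weight_linear (u v : ℂ) : X * derivative (C u * X + C v) - C (1 / 2) * (C u * X + C v) =
    C (u / 2) * X + C (-v / 2) := by
  have h : C (1 / 2 : ℂ) + C (1 / 2 : ℂ) = 1 := by rw [← C_add]; norm_num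
  rw [show u / 2 = u * (1 / 2) by ring, show -v / 2 = -(1 / 2 * v) by ring]
  simp only [derivative_add, derivative_mul, derivative_C, derivative_X, C_mul, C_neg]
  linear_combination -X * C u * h

theorem raise_linear (u v : ℂ) : derivative (C u * X + C v) = C 0 * X + C u := by
  simp

theorem lower_linear (u v : ℂ) : X * (C u * X + C v) - X ^ 2 * derivative (C u * X + C v) =
    C v * X + C 0 := by
  simp; ring

/-- On polynomials of degree at most one, `X d/dX - 1/2`, `d/dX` and `X - X² d/dX` realize the
spin-1/2 representation; the fields `W` act on both factors through it. -/
theorem hasPolyDeriv_matW (hx : 0 < rad x) :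
    (HasPolyDeriv (lin (matW 0)) x polyA (X * derivative (polyA x) - C (1 / 2) * polyA x) ∧
      HasPolyDeriv (lin (matW 0)) x polyB (X * derivative (polyB x) - C (1 / 2) * polyB x)) ∧
    (HasPolyDeriv (lin (matW 1)) x polyA (derivative (polyA x)) ∧
      HasPolyDeriv (lin (matW 1)) x polyB (derivative (polyB x))) ∧
    (HasPolyDeriv (lin (matW 2)) x polyA (X * polyA x - X ^ 2 * derivative (polyA x)) ∧
      HasPolyDeriv (lin (matW 2)) x polyB (X * polyB x - X ^ 2 * derivative (polyB x))) := by
  have hI := Complex.I_sq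
  obtain ⟨⟨a1, a2, a3, a4⟩, ⟨b1, b2, b3, b4⟩, ⟨c1, c2, c3, c4⟩⟩ := lin_matS x
  have h := fun i => hasPolyDeriv_lin hx (matW_antisymm i).1 (matW_antisymm i).2
  have m0 : matW 0 = (Complex.I / 2) • matS 2 := rfl
  have m1 : matW 1 = (Complex.I / 2) • (matS 0 + Complex.I • matS 1) := rfl
  have m2 : matW 2 = (Complex.I / 2) • (matS 0 - Complex.I • matS 1) := rfl
  rw [polyA_eq x, polyB_eq x]
  refine ⟨⟨(h 0).1.congr_coeff ?_ ?_ (weight_linear _ _), (h 0).2.congr_coeff ?_ ?_ (weight_linear _ _)⟩,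
    ⟨(h 1).1.congr_coeff ?_ ?_ (raise_linear _ _), (h 1).2.congr_coeff ?_ ?_ (raise_linear _ _)⟩,
    ⟨(h 2).1.congr_coeff ?_ ?_ (lower_linear _ _), (h 2).2.congr_coeff ?_ ?_ (lower_linear _ _)⟩⟩ <;>
  simp only [(lin_row_mul _ _ x).1, (lin_row_mul _ _ x).2, lin_rowZ, lin_rowW, m0, m1, m2, lin_smul,
    lin_add, lin_sub, a1, a2, a3, a4, b1, b2, b3, b4, c1, c2, c3, c4] <;>
  ring_nf <;> simp only [Complex.I_sq, show Complex.I ^ 3 = -Complex.I from Complex.I_pow_three] <;> ring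

/-- The pair `(polyA, polyB)` is a spin-1/2 doublet for the fields `L`, with weights `±1/2`. -/
theorem hasPolyDeriv_matL (hx : 0 < rad x) :
    (HasPolyDeriv (lin (matL 0)) x polyA (C (1 / 2) * polyA x) ∧
      HasPolyDeriv (lin (matL 0)) x polyB (C (-1 / 2) * polyB x)) ∧
    (HasPolyDeriv (lin (matL 1)) x polyA 0 ∧ HasPolyDeriv (lin (matL 1)) x polyB (polyA x)) ∧
    (HasPolyDeriv (lin (matL 2)) x polyA (polyB x) ∧ HasPolyDeriv (lin (matL 2)) x polyB 0) := by
  have hI := Complex.I_sq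
  obtain ⟨⟨a1, a2, a3, a4⟩, ⟨b1, b2, b3, b4⟩, ⟨c1, c2, c3, c4⟩⟩ := lin_matXi x
  have h := fun i => hasPolyDeriv_lin hx (matL_antisymm i).1 (matL_antisymm i).2
  have m0 : matL 0 = (Complex.I / 2) • matXi 2 := rfl
  have m1 : matL 1 = (Complex.I / 2) • (matXi 0 + Complex.I • matXi 1) := rfl
  have m2 : matL 2 = (Complex.I / 2) • (matXi 0 - Complex.I • matXi 1) := rfl
  have hz : (0 : ℂ[X]) = C 0 * X + C 0 := by simp
  have hc : ∀ c u v : ℂ, C c * (C u * X + C v) = C (c * u) * X + C (c * v) := by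
    intro c u v; simp only [C_mul]; ring
  rw [polyA_eq x, polyB_eq x]
  refine ⟨⟨(h 0).1.congr_coeff ?_ ?_ (hc _ _ _), (h 0).2.congr_coeff ?_ ?_ (hc _ _ _)⟩,
    ⟨(h 1).1.congr_coeff ?_ ?_ hz, (h 1).2.congr_coeff ?_ ?_ rfl⟩,
    ⟨(h 2).1.congr_coeff ?_ ?_ rfl, (h 2).2.congr_coeff ?_ ?_ hz⟩⟩ <;>
  simp only [(lin_row_mul _ _ x).1, (lin_row_mul _ _ x).2, lin_rowZ, lin_rowW, m0, m1, m2, lin_smul,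
    lin_add, lin_sub, a1, a2, a3, a4, b1, b2, b3, b4, c1, c2, c3, c4] <;>
  ring_nf <;> simp only [Complex.I_sq, show Complex.I ^ 3 = -Complex.I from Complex.I_pow_three] <;> ring

end

/-! ### Ladder relations -/

theorem sqrt_mul_of_nonneg {t c : ℝ} (ht : 0 ≤ t) (hc : 0 ≤ c) : √t * c = √(t * c ^ 2) := by
  rw [Real.sqrt_mul ht, Real.sqrt_sq hc]

/-- The squared norms at `p + 1` and `p` have ratio `(p + 1) / (n - p)`. This turns the asymmetric
factors `p + 1` and `n - p` of the polynomial action into the common factor `√((n - p)(p + 1))`. -/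
theorem wignerNorm_raise_left {n p : ℕ} (hp : p < n) (q : ℕ) :
    wignerNorm n p q * (p + 1) = Real.sqrt ((n - p) * (p + 1)) * wignerNorm n (p + 1) q ∧
    wignerNorm n (p + 1) q * (n - p) = Real.sqrt ((n - p) * (p + 1)) * wignerNorm n p q := by
  -- Writing `n = p + k + 1` removes the truncated subtractions from the factorials.
  obtain ⟨k, rfl⟩ := Nat.exists_eq_add_of_lt hp
  have e1 : p + k + 1 - p = k + 1 := by omega
  have e2 : p + k + 1 - (p + 1) = k := by omega
  simp only [wignerNorm, e1, e2]
  have hk : (0 : ℝ) ≤ k + 1 := by positivity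
  have hp : (0 : ℝ) ≤ p + 1 := by positivity
  push_cast [Nat.factorial_succ]
  rw [show (p + k + 1 - p : ℝ) = k + 1 by ring, ← Real.sqrt_mul (by positivity), ← Real.sqrt_mul (by positivity)]
  constructor
  · rw [sqrt_mul_of_nonneg (by positivity) hp]
    congr 1; ring
  · rw [sqrt_mul_of_nonneg (by positivity) hk]
    congr 1; ring

theorem wignerNorm_raise_right {n q : ℕ} (hq : q < n) (p : ℕ) :
    wignerNorm n p q * (n - q) = Real.sqrt ((n - q) * (q + 1)) * wignerNorm n p (q + 1) ∧
    wignerNorm n p (q + 1) * (q + 1) = Real.sqrt ((n - q) * (q + 1)) * wignerNorm n p q := by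
  obtain ⟨k, rfl⟩ := Nat.exists_eq_add_of_lt hq
  have e1 : q + k + 1 - q = k + 1 := by omega
  have e2 : q + k + 1 - (q + 1) = k := by omega
  simp only [wignerNorm, e1, e2]
  have hk : (0 : ℝ) ≤ k + 1 := by positivity
  have hq : (0 : ℝ) ≤ q + 1 := by positivity
  have f1 : (q.factorial : ℝ) ≠ 0 := by positivity
  have f2 : (k.factorial : ℝ) ≠ 0 := by positivity
  push_cast [Nat.factorial_succ]
  rw [show (q + k + 1 - q : ℝ) = k + 1 by ring, ← Real.sqrt_mul (by positivity), ← Real.sqrt_mul (by positivity)]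
  constructor
  · rw [sqrt_mul_of_nonneg (by positivity) hk]
    congr 1; field_simp
  · rw [sqrt_mul_of_nonneg (by positivity) hq]
    congr 1; field_simp

/-- Needed at the top of the ladder: raising from `p = n` reads the coefficient `n + 1`, which is
zero. -/
theorem natDegree_poly_le (x : Pt) {n q : ℕ} (hq : q ≤ n) :
    (polyA x ^ q * polyB x ^ (n - q)).natDegree ≤ n := by
  have hA : (polyA x).natDegree ≤ 1 := natDegree_linear_le
  have hB : (polyB x).natDegree ≤ 1 := natDegree_linear_le
  refine natDegree_mul_le.trans ?_
  have h1 := natDegree_pow_le_of_le q hA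
  have h2 := natDegree_pow_le_of_le (n - q) hB
  omega

theorem mul_pow_pred (A : ℂ[X]) (q : ℕ) : (q : ℂ[X]) * A ^ (q - 1) * A = q * A ^ q := by
  rcases q with _ | q
  · simp
  · rw [Nat.add_sub_cancel, mul_assoc, ← pow_succ]

section

variable {x : Pt} (n p q : ℕ)

theorem derivative_generating : derivative (polyA x ^ q * polyB x ^ (n - q)) =
    (q * polyA x ^ (q - 1) * derivative (polyA x)) * polyB x ^ (n - q)
      + polyA x ^ q * (((n - q : ℕ) : ℂ[X]) * polyB x ^ (n - q - 1) * derivative (polyB x)) := by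
  rw [derivative_mul, derivative_pow, derivative_pow]
  simp

theorem vecAct_matW_weight (hx : 0 < rad x) (hq : q ≤ n) :
    vecAct (lin (matW 0)) (wignerNat n p q) x = (p - n / 2 : ℂ) * wignerNat n p q x := by
  obtain ⟨⟨hA, hB⟩, -, -⟩ := hasPolyDeriv_matW hx
  have e : ((q : ℂ[X]) * polyA x ^ (q - 1) * (X * derivative (polyA x) - C (1 / 2) * polyA x))
      * polyB x ^ (n - q) + polyA x ^ q * (((n - q : ℕ) : ℂ[X]) * polyB x ^ (n - q - 1)
        * (X * derivative (polyB x) - C (1 / 2) * polyB x)) =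
      X * derivative (polyA x ^ q * polyB x ^ (n - q))
        - C (n / 2 : ℂ) * (polyA x ^ q * polyB x ^ (n - q)) := by
    have h1 := mul_pow_pred (polyA x) q
    have h2 := mul_pow_pred (polyB x) (n - q)
    -- Each of the `q + (n - q) = n` linear factors contributes `1/2` to the shift of the weight.
    have h3 : C (n / 2 : ℂ) = C (1 / 2) * ((q : ℂ[X]) + ((n - q : ℕ) : ℂ[X])) := by
      rw [← Nat.cast_add, Nat.add_sub_cancel' hq, div_eq_mul_one_div, mul_comm, C_mul]
      simp
    rw [derivative_generating, h3]
    linear_combination -C (1 / 2 : ℂ) * polyB x ^ (n - q) * h1 - C (1 / 2 : ℂ) * polyA x ^ q * h2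
  rw [vecAct_wignerNat hA hB, e, wignerNat_eq, coeff_sub, coeff_C_mul]
  rcases p with _ | p
  · simp; ring
  · rw [coeff_X_mul, coeff_derivative]; push_cast; ring

theorem vecAct_matW_raise (hx : 0 < rad x) :
    vecAct (lin (matW 1)) (wignerNat n p q) x = wignerNorm n p q *
      ((p + 1) * (polyA x ^ q * polyB x ^ (n - q)).coeff (p + 1)) := by
  obtain ⟨-, ⟨hA, hB⟩, -⟩ := hasPolyDeriv_matW hx
  rw [vecAct_wignerNat hA hB, ← derivative_generating, coeff_derivative]
  ring

/-- By the Leibniz rule the operator `X - X² d/dX` on one factor becomes `n X - X² d/dX` on a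
product of `n` factors. -/
theorem vecAct_matW_lower (hx : 0 < rad x) (hq : q ≤ n) :
    vecAct (lin (matW 2)) (wignerNat n p q) x = wignerNorm n p q *
      (C (n : ℂ) * (X * (polyA x ^ q * polyB x ^ (n - q)))
        - X ^ 2 * derivative (polyA x ^ q * polyB x ^ (n - q))).coeff p := by
  obtain ⟨-, -, hA, hB⟩ := hasPolyDeriv_matW hx
  rw [vecAct_wignerNat hA hB, derivative_generating]
  congr 2
  have h1 := mul_pow_pred (polyA x) q
  have h2 := mul_pow_pred (polyB x) (n - q)
  have h3 : C (n : ℂ) = (q : ℂ[X]) + ((n - q : ℕ) : ℂ[X]) := by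
    rw [← Nat.cast_add, Nat.add_sub_cancel' hq]; simp
  rw [h3]
  linear_combination X * polyB x ^ (n - q) * h1 + X * polyA x ^ q * h2

theorem vecAct_matL_weight (hx : 0 < rad x) (hq : q ≤ n) :
    vecAct (lin (matL 0)) (wignerNat n p q) x = (q - n / 2 : ℂ) * wignerNat n p q x := by
  obtain ⟨⟨hA, hB⟩, -, -⟩ := hasPolyDeriv_matL hx
  have e : ((q : ℂ[X]) * polyA x ^ (q - 1) * (C (1 / 2) * polyA x)) * polyB x ^ (n - q)
      + polyA x ^ q * (((n - q : ℕ) : ℂ[X]) * polyB x ^ (n - q - 1) * (C (-1 / 2) * polyB x)) =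
      C (q - n / 2 : ℂ) * (polyA x ^ q * polyB x ^ (n - q)) := by
    have h1 := mul_pow_pred (polyA x) q
    have h2 := mul_pow_pred (polyB x) (n - q)
    have h3 : C (q - n / 2 : ℂ) = C (1 / 2) * (q : ℂ[X]) + C (-1 / 2) * ((n - q : ℕ) : ℂ[X]) := by
      rw [← C_eq_natCast, ← C_eq_natCast, ← C_mul, ← C_mul, ← C_add, Nat.cast_sub hq]
      congr 1; ring
    rw [h3]
    linear_combination C (1 / 2 : ℂ) * polyB x ^ (n - q) * h1 + C (-1 / 2 : ℂ) * polyA x ^ q * h2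
  rw [vecAct_wignerNat hA hB, e, wignerNat_eq, coeff_C_mul]
  ring

/-- One factor `polyB` is exchanged for `polyA`, in `n - q` ways. -/
theorem vecAct_matL_raise (hx : 0 < rad x) :
    vecAct (lin (matL 1)) (wignerNat n p q) x = wignerNorm n p q *
      (((n - q : ℕ) : ℂ) * (polyA x ^ (q + 1) * polyB x ^ (n - (q + 1))).coeff p) := by
  obtain ⟨-, ⟨hA, hB⟩, -⟩ := hasPolyDeriv_matL hx
  have e : ((q : ℂ[X]) * polyA x ^ (q - 1) * 0) * polyB x ^ (n - q)
      + polyA x ^ q * (((n - q : ℕ) : ℂ[X]) * polyB x ^ (n - q - 1) * polyA x) =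
      C ((n - q : ℕ) : ℂ) * (polyA x ^ (q + 1) * polyB x ^ (n - (q + 1))) := by
    rw [C_eq_natCast, show n - (q + 1) = n - q - 1 by omega]
    ring
  rw [vecAct_wignerNat hA hB, e, coeff_C_mul]

theorem vecAct_matL_lower (hx : 0 < rad x) (hq : q < n) :
    vecAct (lin (matL 2)) (wignerNat n p (q + 1)) x = wignerNorm n p (q + 1) *
      ((q + 1) * (polyA x ^ q * polyB x ^ (n - q)).coeff p) := by
  obtain ⟨-, -, hA, hB⟩ := hasPolyDeriv_matL hx
  have e : (((q + 1 : ℕ) : ℂ[X]) * polyA x ^ (q + 1 - 1) * polyB x) * polyB x ^ (n - (q + 1))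
      + polyA x ^ (q + 1) * (((n - (q + 1) : ℕ) : ℂ[X]) * polyB x ^ (n - (q + 1) - 1) * 0) =
      C ((q + 1 : ℕ) : ℂ) * (polyA x ^ q * polyB x ^ (n - q)) := by
    rw [C_eq_natCast, show n - q = n - (q + 1) + 1 by omega, Nat.add_sub_cancel]
    ring
  rw [vecAct_wignerNat hA hB, e, coeff_C_mul]
  push_cast
  ring

theorem vecAct_matL_lower_zero (hx : 0 < rad x) :
    vecAct (lin (matL 2)) (wignerNat n p 0) x = 0 := by
  obtain ⟨-, -, hA, hB⟩ := hasPolyDeriv_matL hx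
  rw [vecAct_wignerNat hA hB]
  simp

end

end

/-! ### The Wigner functions with real labels -/

theorem isLabel_nat {n p q : ℕ} (hp : p ≤ n) (hq : q ≤ n) :
    IsLabel ((n : ℝ) / 2) (p - (n : ℝ) / 2) (q - (n : ℝ) / 2) := ⟨n, p, q, hp, hq, rfl, rfl, rfl⟩

theorem wignerD_nat {n p q : ℕ} (hp : p ≤ n) (hq : q ≤ n) :
    wignerD ((n : ℝ) / 2) (p - (n : ℝ) / 2) (q - (n : ℝ) / 2) = wignerNat n p q := by
  ext x
  rw [wignerD, if_pos (isLabel_nat hp hq)]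
  simp [mul_div_cancel₀]

theorem wignerD_of_not {J K M : ℝ} (h : ¬IsLabel J K M) : wignerD J K M = fun _ => 0 := by
  ext x
  rw [wignerD, if_neg h]

/-- Here `K + 1 = -J` is the bottom label, just below which the ladder coefficient vanishes. This
makes the raising relation consistent with the convention `𝔻 = 0` outside the labels. -/
theorem isLabel_raise_left {J K M : ℝ} (h : IsLabel J (K + 1) M) (h' : ¬IsLabel J K M) :
    J * (J + 1) - K * (K + 1) = 0 := by
  obtain ⟨n, p, q, hp, hq, rfl, hK, rfl⟩ := h
  rcases p with _ | p
  · rw [eq_sub_of_add_eq hK]; push_cast; ring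
  · refine absurd ?_ h'
    rw [show K = p - (n : ℝ) / 2 by push_cast at hK; linarith]
    exact isLabel_nat (by omega) hq

theorem isLabel_lower_left {J K M : ℝ} (h : IsLabel J (K - 1) M) (h' : ¬IsLabel J K M) :
    J * (J + 1) - K * (K - 1) = 0 := by
  obtain ⟨n, p, q, hp, hq, rfl, hK, rfl⟩ := h
  rcases hp.eq_or_lt with rfl | hp
  · rw [eq_add_of_sub_eq hK]; ring
  · refine absurd ?_ h'
    rw [show K = (p + 1 : ℕ) - (n : ℝ) / 2 by push_cast; linarith]
    exact isLabel_nat hp hq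

theorem IsLabel.swap {J K M : ℝ} (h : IsLabel J K M) : IsLabel J M K := by
  obtain ⟨n, p, q, hp, hq, rfl, rfl, rfl⟩ := h
  exact isLabel_nat hq hp

section

variable {x : Pt}

theorem vecAct_W (F : Pt → ℂ) :
    vecAct (W 2) F x = vecAct (lin (matW 0)) F x ∧
    vecAct (W 0) F x + Complex.I * vecAct (W 1) F x = vecAct (lin (matW 1)) F x ∧
    vecAct (W 0) F x - Complex.I * vecAct (W 1) F x = vecAct (lin (matW 2)) F x := by
  have m0 : matW 0 = (Complex.I / 2) • matS 2 := rfl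
  have m1 : matW 1 = (Complex.I / 2) • (matS 0 + Complex.I • matS 1) := rfl
  have m2 : matW 2 = (Complex.I / 2) • (matS 0 - Complex.I • matS 1) := rfl
  simp only [vecAct, W_eq, m0, m1, m2, lin_smul, lin_add, lin_sub, Finset.mul_sum,
    ← Finset.sum_add_distrib, ← Finset.sum_sub_distrib, true_and]
  constructor <;> exact Finset.sum_congr rfl fun κ _ => by ring

theorem vecAct_L (F : Pt → ℂ) :
    vecAct (L 2) F x = vecAct (lin (matL 0)) F x ∧
    vecAct (L 0) F x + Complex.I * vecAct (L 1) F x = vecAct (lin (matL 1)) F x ∧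
    vecAct (L 0) F x - Complex.I * vecAct (L 1) F x = vecAct (lin (matL 2)) F x := by
  have m0 : matL 0 = (Complex.I / 2) • matXi 2 := rfl
  have m1 : matL 1 = (Complex.I / 2) • (matXi 0 + Complex.I • matXi 1) := rfl
  have m2 : matL 2 = (Complex.I / 2) • (matXi 0 - Complex.I • matXi 1) := rfl
  simp only [vecAct, L_eq, m0, m1, m2, lin_smul, lin_add, lin_sub, Finset.mul_sum,
    ← Finset.sum_add_distrib, ← Finset.sum_sub_distrib, true_and]
  constructor <;> exact Finset.sum_congr rfl fun κ _ => by ring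

theorem wignerD_W_weight (hx : 0 < rad x) (J K M : ℝ) :
    vecAct (lin (matW 0)) (wignerD J K M) x = K * wignerD J K M x := by
  by_cases h : IsLabel J K M
  · obtain ⟨n, p, q, hp, hq, rfl, rfl, rfl⟩ := h
    rw [wignerD_nat hp hq, vecAct_matW_weight n p q hx hq]
    push_cast
    ring
  · simp [wignerD_of_not h, vecAct_const]

theorem wignerD_L_weight (hx : 0 < rad x) (J K M : ℝ) :
    vecAct (lin (matL 0)) (wignerD J K M) x = M * wignerD J K M x := by
  by_cases h : IsLabel J K M
  · obtain ⟨n, p, q, hp, hq, rfl, rfl, rfl⟩ := h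
    rw [wignerD_nat hp hq, vecAct_matL_weight n p q hx hq]
    push_cast
    ring
  · simp [wignerD_of_not h, vecAct_const]

theorem ladder_arg (n p : ℝ) :
    n / 2 * (n / 2 + 1) - (p - n / 2) * (p - n / 2 + 1) = (n - p) * (p + 1) ∧
    n / 2 * (n / 2 + 1) - (p + 1 - n / 2) * (p + 1 - n / 2 - 1) = (n - p) * (p + 1) := by
  constructor <;> ring

theorem wignerD_W_raise (hx : 0 < rad x) (J K M : ℝ) : vecAct (lin (matW 1)) (wignerD J K M) x =
    (Real.sqrt (J * (J + 1) - K * (K + 1)) : ℂ) * wignerD J (K + 1) M x := by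
  by_cases h : IsLabel J K M
  · obtain ⟨n, p, q, hp, hq, rfl, rfl, rfl⟩ := h
    rw [wignerD_nat hp hq, vecAct_matW_raise n p q hx, (ladder_arg n p).1]
    rcases hp.eq_or_lt with rfl | hp
    · rw [Polynomial.coeff_eq_zero_of_natDegree_lt
        ((natDegree_poly_le x hq).trans_lt (Nat.lt_succ_self p))]
      simp
    · rw [show (p : ℝ) - n / 2 + 1 = (p + 1 : ℕ) - n / 2 by push_cast; ring, wignerD_nat hp hq,
        wignerNat_eq, ← mul_assoc, ← mul_assoc]
      congr 1
      exact_mod_cast congrArg (fun r : ℝ => (r : ℂ)) (wignerNorm_raise_left hp q).1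
  · rw [wignerD_of_not h, vecAct_const]
    -- The left side is zero; on the right either the ladder coefficient or the Wigner function
    -- vanishes.
    by_cases h' : IsLabel J (K + 1) M
    · rw [isLabel_raise_left h' h]; simp
    · simp [wignerD_of_not h']

theorem wignerD_W_lower (hx : 0 < rad x) (J K M : ℝ) : vecAct (lin (matW 2)) (wignerD J K M) x =
    (Real.sqrt (J * (J + 1) - K * (K - 1)) : ℂ) * wignerD J (K - 1) M x := by
  by_cases h : IsLabel J K M
  · obtain ⟨n, p, q, hp, hq, rfl, rfl, rfl⟩ := h
    rw [wignerD_nat hp hq, vecAct_matW_lower n p q hx hq]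
    rcases p with _ | p
    · rw [show (n : ℝ) / 2 * (n / 2 + 1) - (((0 : ℕ) : ℝ) - n / 2) * (((0 : ℕ) : ℝ) - n / 2 - 1) = 0 by
        push_cast; ring]
      simp [Polynomial.mul_coeff_zero]
    · have hc : (Polynomial.C (n : ℂ) * (Polynomial.X * (polyA x ^ q * polyB x ^ (n - q)))
          - Polynomial.X ^ 2 * Polynomial.derivative (polyA x ^ q * polyB x ^ (n - q))).coeff (p + 1) =
          (n - p) * (polyA x ^ q * polyB x ^ (n - q)).coeff p := by
        rw [Polynomial.coeff_sub, Polynomial.coeff_C_mul, Polynomial.coeff_X_mul, pow_two, mul_assoc,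
          Polynomial.coeff_X_mul]
        rcases p with _ | p
        · simp
        · rw [Polynomial.coeff_X_mul, Polynomial.coeff_derivative]
          push_cast
          ring
      rw [hc, Nat.cast_succ, (ladder_arg n p).2,
        show (p : ℝ) + 1 - n / 2 - 1 = p - n / 2 by ring, wignerD_nat (by omega) hq,
        wignerNat_eq, ← mul_assoc, ← mul_assoc]
      congr 1
      exact_mod_cast congrArg (fun r : ℝ => (r : ℂ)) (wignerNorm_raise_left hp q).2
  · rw [wignerD_of_not h, vecAct_const]
    by_cases h' : IsLabel J (K - 1) M
    · rw [isLabel_lower_left h' h]; simp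
    · simp [wignerD_of_not h']

theorem wignerD_L_raise (hx : 0 < rad x) (J K M : ℝ) : vecAct (lin (matL 1)) (wignerD J K M) x =
    (Real.sqrt (J * (J + 1) - M * (M + 1)) : ℂ) * wignerD J K (M + 1) x := by
  by_cases h : IsLabel J K M
  · obtain ⟨n, p, q, hp, hq, rfl, rfl, rfl⟩ := h
    rw [wignerD_nat hp hq, vecAct_matL_raise n p q hx, (ladder_arg n q).1]
    rcases hq.eq_or_lt with rfl | hq
    · simp
    · rw [show (q : ℝ) - n / 2 + 1 = (q + 1 : ℕ) - n / 2 by push_cast; ring, wignerD_nat hp hq,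
        wignerNat_eq, ← mul_assoc, ← mul_assoc, Nat.cast_sub hq.le]
      congr 1
      exact_mod_cast congrArg (fun r : ℝ => (r : ℂ)) (wignerNorm_raise_right hq p).1
  · rw [wignerD_of_not h, vecAct_const]
    by_cases h' : IsLabel J K (M + 1)
    · rw [isLabel_raise_left h'.swap (mt IsLabel.swap h)]; simp
    · simp [wignerD_of_not h']

theorem wignerD_L_lower (hx : 0 < rad x) (J K M : ℝ) : vecAct (lin (matL 2)) (wignerD J K M) x =
    (Real.sqrt (J * (J + 1) - M * (M - 1)) : ℂ) * wignerD J K (M - 1) x := by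
  by_cases h : IsLabel J K M
  · obtain ⟨n, p, q, hp, hq, rfl, rfl, rfl⟩ := h
    rw [wignerD_nat hp hq]
    rcases q with _ | q
    · rw [show (n : ℝ) / 2 * (n / 2 + 1) - (((0 : ℕ) : ℝ) - n / 2) * (((0 : ℕ) : ℝ) - n / 2 - 1) = 0 by
        push_cast; ring, vecAct_matL_lower_zero n p hx]
      simp
    · rw [vecAct_matL_lower n p q hx hq, Nat.cast_succ, (ladder_arg n q).2,
        show (q : ℝ) + 1 - n / 2 - 1 = q - n / 2 by ring, wignerD_nat hp (by omega),
        wignerNat_eq, ← mul_assoc, ← mul_assoc]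
      congr 1
      exact_mod_cast congrArg (fun r : ℝ => (r : ℂ)) (wignerNorm_raise_right hq p).2
  · rw [wignerD_of_not h, vecAct_const]
    by_cases h' : IsLabel J K (M - 1)
    · rw [isLabel_lower_left h'.swap (mt IsLabel.swap h)]; simp
    · simp [wignerD_of_not h']

theorem differentiableAt_wignerD (hx : 0 < rad x) (J K M : ℝ) :
    DifferentiableAt ℝ (wignerD J K M) x := by
  by_cases h : IsLabel J K M
  · obtain ⟨n, p, q, hp, hq, rfl, rfl, rfl⟩ := h
    rw [wignerD_nat hp hq]
    exact differentiableAt_wignerNat hx n p q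
  · rw [wignerD_of_not h]
    exact differentiableAt_const _

/-! ### Action of the frame on the Wigner functions -/

/-- Fields along which the linear forms in the Wigner functions are constant. -/
theorem vecAct_wignerD_eq_zero (hx : 0 < rad x) {Y : VField} (hZ : ∀ ε,
    vecAct Y (fun y => 0 + lin (rowZ ε) y 0 * ((rad y : ℂ) ^ 1)⁻¹) x = 0) (hW : ∀ ε,
    vecAct Y (fun y => 0 + lin (rowW ε) y 0 * ((rad y : ℂ) ^ 1)⁻¹) x = 0) (J K M : ℝ) :
    vecAct Y (wignerD J K M) x = 0 := by
  by_cases h : IsLabel J K M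
  · obtain ⟨n, p, q, hp, hq, rfl, rfl, rfl⟩ := h
    have hA := hasPolyDeriv_polyA hx Y
    have hB := hasPolyDeriv_polyB hx Y
    rw [hZ, hW] at hA hB
    rw [wignerD_nat hp hq, vecAct_wignerNat hA hB]
    simp
  · rw [wignerD_of_not h, vecAct_const]

theorem vecAct_frame_wignerD_zero (hx : 0 < rad x) (J K M : ℝ) :
    vecAct (frame 0) (wignerD J K M) x = 0 := by
  refine vecAct_wignerD_eq_zero hx (fun ε => ?_) (fun ε => ?_) J K M <;>
    simp only [vecAct, pd_lin_mul_inv_pow _ _ _ hx, frame_zero_apply] <;>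
    simp [rowZ, rowW, lin, matP, Fin.sum_univ_five]

/-- `z` and `w` are linear forms divided by `r̃`, hence homogeneous of degree zero and constant
along rays. -/
theorem vecAct_frame_wignerD_one (hx : 0 < rad x) (J K M : ℝ) :
    vecAct (frame 1) (wignerD J K M) x = 0 := by
  have h0 : (rad x : ℂ) ≠ 0 := by exact_mod_cast hx.ne'
  have hr := radC_sq x
  refine vecAct_wignerD_eq_zero hx (fun ε => ?_) (fun ε => ?_) J K M <;>
    simp only [vecAct, pd_lin_mul_inv_pow _ _ _ hx, frame] <;>
    simp [rowZ, rowW, lin, matP, matV, expV, Fin.sum_univ_five] <;> field_simp <;>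
    rw [hr] <;> ring

/-- Factors by which the frame acts on the Wigner functions. -/
def frameFactor (J K : ℝ) : Fin 5 → ℂ :=
  ![0, 0, -2 * Complex.I * rt * Real.sqrt (J * (J + 1) - K * (K - 1)),
    -2 * Complex.I * rt * Real.sqrt (J * (J + 1) - K * (K + 1)), -2 * Complex.I * K]

theorem vecAct_smul {Y Z : VField} {F : Pt → ℂ} (c : ℂ) (h : ∀ κ, Y x κ = c * Z x κ) :
    vecAct Y F x = c * vecAct Z F x := by
  simp only [vecAct, h, Finset.mul_sum, mul_assoc]

/-- Up to the factor `-2i` (and `rt` for the first two), `e_+`, `e_-`, `e_3` are `W₋`, `W₊`, `W₃`: a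
frame vector of charge `q` lowers `K` by `q`. -/
theorem vecAct_frame_wignerD (hx : 0 < rad x) (J K M : ℝ) (i : Fin 5) :
    vecAct (frame i) (wignerD J K M) x = frameFactor J K i * wignerD J (K - charge i) M x := by
  have m0 : matW 0 = (Complex.I / 2) • matS 2 := rfl
  have m1 : matW 1 = (Complex.I / 2) • (matS 0 + Complex.I • matS 1) := rfl
  have m2 : matW 2 = (Complex.I / 2) • (matS 0 - Complex.I • matS 1) := rfl
  obtain ⟨e0, e1, e2, e3, e4⟩ := matV_apply
  obtain ⟨n0, n1, n2, n3, n4⟩ := expV_apply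
  have hI := Complex.I_sq
  match i with
  | 0 => simp [vecAct_frame_wignerD_zero hx, frameFactor]
  | 1 => simp [vecAct_frame_wignerD_one hx, frameFactor]
  | 2 =>
    rw [vecAct_smul (Z := lin (matW 2)) (-2 * Complex.I * rt) fun κ => ?_, wignerD_W_lower hx]
    · simp [frameFactor, charge, mul_assoc]
    · simp [frame, e2, n2, m2, lin_smul]
      linear_combination (lin (matS 0 - Complex.I • matS 1) x κ) * rt * hI
  | 3 =>
    rw [vecAct_smul (Z := lin (matW 1)) (-2 * Complex.I * rt) fun κ => ?_, wignerD_W_raise hx]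
    · simp [frameFactor, charge, mul_assoc]
    · simp [frame, e3, n3, m1, lin_smul, -smul_add]
      linear_combination (lin (matS 0 + Complex.I • matS 1) x κ) * rt * hI
  | 4 =>
    rw [vecAct_smul (Z := lin (matW 0)) (-2 * Complex.I) fun κ => ?_, wignerD_W_weight hx]
    · simp [frameFactor, charge, mul_assoc]
    · simp [frame, e4, n4, m0, lin_smul]
      linear_combination (lin (matS 2) x κ) * hI

/-! ### Modes -/

/-- Derivatives of functions of `(t, r̃)`. -/
theorem vecAct_frame_comp (hx : 0 < rad x) {f : ℝ × ℝ → ℂ} (hf : DifferentiableAt ℝ f (x 0, rad x))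
    (i : Fin 5) : DifferentiableAt ℝ (fun y : Pt => f (y 0, rad y)) x ∧
    vecAct (frame i) (fun y : Pt => f (y 0, rad y)) x =
      (if i = 0 then fderiv ℝ f (x 0, rad x) (1, 0) else 0)
        + if i = 1 then fderiv ℝ f (x 0, rad x) (0, 1) else 0 := by
  have h0 : HasFDerivAt (fun y : Pt => y 0)
      (ContinuousLinearMap.proj (R := ℝ) (φ := fun _ : Fin 5 => ℝ) 0) x :=
    (ContinuousLinearMap.proj (R := ℝ) (φ := fun _ : Fin 5 => ℝ) 0).hasFDerivAt
  have hr : HasFDerivAt rad (fderiv ℝ rad x) x := (hasFDerivAt_rad hx).differentiableAt.hasFDerivAt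
  have h := hf.hasFDerivAt.comp x (h0.prodMk hr)
  refine ⟨h.differentiableAt, ?_⟩
  have hrad : ∀ κ, ((fderiv ℝ rad x (Pi.single κ 1) : ℝ) : ℂ) = dr x κ := by
    intro κ
    have := pd_comp_rad hx (f := fun r => (r : ℂ)) Complex.ofRealCLM.differentiableAt κ
    have h1 : deriv (fun r : ℝ => (r : ℂ)) (rad x) = 1 := (HasDerivAt.ofReal_comp (hasDerivAt_id _)).deriv
    rw [h1, one_mul] at this
    rw [← this, pd]
    have h2 := (Complex.ofRealCLM.hasFDerivAt (x := rad x)).comp x hr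
    rw [show (fun y => ((rad y : ℝ) : ℂ)) = Complex.ofRealCLM ∘ rad from rfl, h2.fderiv]
    simp
  have hpd : ∀ κ, pd κ (fun y : Pt => f (y 0, rad y)) x =
      fderiv ℝ f (x 0, rad x) (1, 0) * dt x κ + fderiv ℝ f (x 0, rad x) (0, 1) * dr x κ := by
    intro κ
    have hl : ∀ s r : ℝ, fderiv ℝ f (x 0, rad x) (s, r) =
        s * fderiv ℝ f (x 0, rad x) (1, 0) + r * fderiv ℝ f (x 0, rad x) (0, 1) := by
      intro s r
      rw [show ((s, r) : ℝ × ℝ) = s • (1, 0) + r • (0, 1) by simp, map_add, map_smul, map_smul]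
      simp
    have ht : (((Pi.single κ 1 : Pt) 0 : ℝ) : ℂ) = dt x κ := by
      fin_cases κ <;> simp [dt]
    rw [pd, show (fun y : Pt => f (y 0, rad y)) = f ∘ fun y : Pt => (y 0, rad y) from rfl, h.fderiv]
    simp only [ContinuousLinearMap.comp_apply, ContinuousLinearMap.prod_apply,
      ContinuousLinearMap.proj_apply]
    rw [hl, hrad, ht]
    ring
  have f0 := frame_coframe hx i 0
  have f1 := frame_coframe hx i 1
  simp only [vecAct, hpd, mul_add, Finset.sum_add_distrib]
  have e0 : ∀ c : ℂ, ∑ κ, frame i x κ * (c * dt x κ) = c * ∑ κ, frame i x κ * coframe 0 x κ := by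
    intro c
    rw [Finset.mul_sum]
    exact Finset.sum_congr rfl fun κ _ => by simp only [coframe, Matrix.cons_val]; ring
  have e1 : ∀ c : ℂ, ∑ κ, frame i x κ * (c * dr x κ) = c * ∑ κ, frame i x κ * coframe 1 x κ := by
    intro c
    rw [Finset.mul_sum]
    exact Finset.sum_congr rfl fun κ _ => by simp only [coframe, Matrix.cons_val]; ring
  rw [e0, e1, f0, f1]
  simp

/-- Frame derivatives of the components of a mode, with the Wigner functions stripped off. -/
def modeDeriv (J K : ℝ) (H : ℝ × ℝ → Fin 5 → Fin 5 → ℂ) (s : ℝ × ℝ) (i b c : Fin 5) : ℂ :=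
  (if i = 0 then fderiv ℝ (fun s => H s b c) s (1, 0) else 0)
    + (if i = 1 then fderiv ℝ (fun s => H s b c) s (0, 1) else 0)
    + H s b c * frameFactor J (K - charge b - charge c) i

/-- The new coefficients are `symFrame` applied to the old ones with the Wigner functions stripped
off. They contain first derivatives only, which costs one order of regularity. -/
theorem isMode_symOp (μ a J K M : ℝ) (k : ℕ∞) (h : Tensor2) (hh : IsMode μ a (k + 1) J K M h) :
    IsMode μ a k J K M (symOp μ a h) := by
  obtain ⟨H, hH, -, hm⟩ := hh
  have hO := isOpen_orbitSpace μ a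
  have hk : ((k : ℕ∞) : WithTop ℕ∞) + 1 ≤ ((k + 1 : ℕ∞) : WithTop ℕ∞) := by
    rw [WithTop.coe_add]; rfl
  have hHc : ∀ b c, ContDiffOn ℝ ((k + 1 : ℕ∞) : WithTop ℕ∞) (fun s => H s b c) (orbitSpace μ a) :=
    fun b c => contDiffOn_pi.1 (contDiffOn_pi.1 hH b) c
  have hH' : ∀ b c, ContDiffOn ℝ k (fun s => H s b c) (orbitSpace μ a) := fun b c =>
    (hHc b c).of_le (le_trans le_self_add hk)
  have hHd : ∀ s ∈ orbitSpace μ a, ∀ b c, DifferentiableAt ℝ (fun s => H s b c) s := fun s hs b c =>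
    ((hHc b c).contDiffAt (hO.mem_nhds hs)).differentiableAt (by
      intro h0; simp at h0)
  have hfd : ∀ (v : ℝ × ℝ) b c,
      ContDiffOn ℝ k (fun s => fderiv ℝ (fun s => H s b c) s v) (orbitSpace μ a) := fun v b c =>
    ((hHc b c).fderiv_of_isOpen hO hk).clm_apply contDiffOn_const
  have hsnd : ∀ {f : ℝ → ℂ}, ContDiffOn ℝ ∞ f (radii μ a) →
      ContDiffOn ℝ k (fun s : ℝ × ℝ => f s.2) (orbitSpace μ a) := fun hf =>
    (hf.of_le (by exact_mod_cast le_top)).comp contDiff_snd.contDiffOn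
      fun s hs => ⟨(abs_nonneg a).trans_lt hs.1, hs.2⟩
  have hD : ∀ i b c, ContDiffOn ℝ k (fun s => modeDeriv J K H s i b c) (orbitSpace μ a) := by
    intro i b c
    refine ((ContDiffOn.add ?_ ?_).add ((hH' b c).mul contDiffOn_const))
    · split_ifs
      exacts [hfd _ b c, contDiffOn_const]
    · split_ifs
      exacts [hfd _ b c, contDiffOn_const]
  refine ⟨fun s => symFrame μ a s.2 (modeDeriv J K H s) (H s), ?_, ?_, ?_⟩
  · refine contDiffOn_pi.2 fun l => contDiffOn_pi.2 fun m => ?_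
    have hφ := fun l c d => hsnd (contDiffOn_yanoUpCoeff μ a l c d)
    have hω := fun l c d => hsnd (contDiffOn_connCoeff μ a l c d)
    have hin : ∀ m c d, ContDiffOn ℝ k (fun s => modeDeriv J K H s c m d
        + ∑ e, (H s e d * connCoeff μ a s.2 e c m + H s m e * connCoeff μ a s.2 e c d))
        (orbitSpace μ a) := fun m c d => (hD c m d).add (ContDiffOn.sum fun e _ =>
      ((hH' e d).mul (hω e c m)).add ((hH' m e).mul (hω e c d)))
    exact ContDiffOn.sum fun c _ => ContDiffOn.sum fun d _ =>
      ((hφ l c d).mul (hin m c d)).add ((hφ m c d).mul (hin l c d))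
  · intro s _ b c
    exact symFrame_comm _ _ _ _ _ _ _
  · intro x hx
    have hr := rad_pos_of_mem hx
    have hdf := fun b c => vecAct_frame_comp hr (hHd _ hx b c)
    have hw := fun b c => differentiableAt_wignerD hr J (K - charge b - charge c) M
    have hmode : ∀ (H' : ℝ × ℝ → Fin 5 → Fin 5 → ℂ) (y : Pt) ρ τ, modeTensor J K M H' y ρ τ =
        lo y ρ fun b => lo y τ fun c => H' (y 0, rad y) b c * wignerD J (K - charge b - charge c) M y := by
      intro H' y ρ τ
      simp only [modeTensor, low, Finset.sum_mul]
      exact Finset.sum_congr rfl fun b _ => Finset.sum_congr rfl fun c _ => by ring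
    ext ρ τ
    rw [hmode, symOp_eq hr hx.2
      (H := fun y b c => H (y 0, rad y) b c * wignerD J (K - charge b - charge c) M y)
      (fun b c => (hdf b c 0).1.fun_mul (hw b c))
      (eventually_eq_lo hx fun y hy ρ τ => by rw [hm y hy, hmode])]
    refine congrArg _ (funext fun l => congrArg _ (funext fun m => ?_))
    -- Component `(l, m)` of a mode carries the Wigner function with `K` lowered by its total
    -- charge, so `u q` is the Wigner function at `K - q`.
    have hc := symFrame_charge μ a (rad x) (modeDeriv J K H (x 0, rad x)) (H (x 0, rad x))
      (fun q => wignerD J (K - q) M x) l m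
    rw [sub_sub, ← hc]
    congr 1
    · ext i b c
      rw [vecAct_mul (hdf b c i).1 (hw b c), (hdf b c i).2, vecAct_frame_wignerD hr, modeDeriv,
        show K - charge b - charge c - charge i = K - (charge i + charge b + charge c) by ring]
      -- Along `t` and `r̃` the coefficients are differentiated, but the charge is zero and the
      -- label does not move; along the other directions only the Wigner function is differentiated.
      have hi : i = 0 ∨ i = 1 ∨ i ≠ 0 ∧ i ≠ 1 := by tauto
      rcases hi with rfl | rfl | ⟨h0, h1⟩
      · simp only [charge, Matrix.cons_val, zero_add, sub_sub]
        ring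
      · simp only [charge, Matrix.cons_val, zero_add, sub_sub]
        ring
      · simp only [h0, h1, if_false]
        ring
    · ext b c
      rw [sub_sub]

end

end MyersPerry

end

/-! ### The main theorem -/

theorem mainTheorem2 (μ a : ℝ) :
    -- the Wigner functions satisfy their defining relations on the three-sphere
    (∀ (J K M : ℝ) (x : Pt), 0 < rad x →
      vecAct (W 2) (wignerD J K M) x = K * wignerD J K M x ∧
      vecAct (L 2) (wignerD J K M) x = M * wignerD J K M x ∧
      (vecAct (W 0) (wignerD J K M) x + Complex.I * vecAct (W 1) (wignerD J K M) x
        = (Real.sqrt (J * (J + 1) - K * (K + 1)) : ℂ) * wignerD J (K + 1) M x) ∧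
      (vecAct (W 0) (wignerD J K M) x - Complex.I * vecAct (W 1) (wignerD J K M) x
        = (Real.sqrt (J * (J + 1) - K * (K - 1)) : ℂ) * wignerD J (K - 1) M x) ∧
      (vecAct (L 0) (wignerD J K M) x + Complex.I * vecAct (L 1) (wignerD J K M) x
        = (Real.sqrt (J * (J + 1) - M * (M + 1)) : ℂ) * wignerD J K (M + 1) x) ∧
      (vecAct (L 0) (wignerD J K M) x - Complex.I * vecAct (L 1) (wignerD J K M) x
        = (Real.sqrt (J * (J + 1) - M * (M - 1)) : ℂ) * wignerD J K (M - 1) x)) ∧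
    -- the symmetry operator preserves the labels of every single mode
    (∀ (J K M : ℝ) (k : ℕ∞) (h : Tensor2),
      IsMode μ a (k + 1) J K M h → IsMode μ a k J K M (symOp μ a h)) ∧
    -- the symmetry operator commutes with the Lie derivatives along `W₃`, `L₁`, `L₂`, `L₃`, `i ∂_t`,
    -- and these commute as stated
    (∀ h : Tensor2, ContDiffOn ℝ 2 h (spacetime μ a) → IsSymmOn h (spacetime μ a) →
      IsSymmOn (symOp μ a h) (spacetime μ a) ∧
      ∀ x ∈ spacetime μ a,
        symOp μ a (lieD (W 2) h) x = lieD (W 2) (symOp μ a h) x ∧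
        (∀ i, symOp μ a (lieD (L i) h) x = lieD (L i) (symOp μ a h) x) ∧
        symOp μ a (lieD T h) x = lieD T (symOp μ a h) x ∧
        (∀ i, lieD (W 2) (lieD (L i) h) x = lieD (L i) (lieD (W 2) h) x) ∧
        lieD (W 2) (lieD T h) x = lieD T (lieD (W 2) h) x ∧
        (∀ i, lieD (L i) (lieD T h) x = lieD T (lieD (L i) h) x)) := by
  -- Vanishing time columns: the components of `W₃` and `L_i` do not depend on `t`, so these fields
  -- commute with `i ∂_t`.
  have hT : ∀ κ, ((Complex.I / 2) • matS 2) κ 0 = 0 := by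
    intro κ; fin_cases κ <;> simp [matS]
  have hTL : ∀ i κ, ((Complex.I / 2) • matXi i) κ 0 = 0 := by
    intro i κ; fin_cases i <;> fin_cases κ <;> simp [matXi]
  refine ⟨fun J K M x hx => ?_, fun J K M k h hh => isMode_symOp μ a J K M k h hh,
    fun h hh hs => ⟨?_, fun x hx => ⟨?_, fun i => ?_, ?_, fun i => ?_, ?_, fun i => ?_⟩⟩⟩
  · obtain ⟨hW, hWp, hWm⟩ := vecAct_W (x := x) (wignerD J K M)
    obtain ⟨hL, hLp, hLm⟩ := vecAct_L (x := x) (wignerD J K M)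
    rw [hW, hWp, hWm, hL, hLp, hLm]
    exact ⟨wignerD_W_weight hx J K M, wignerD_L_weight hx J K M, wignerD_W_raise hx J K M,
      wignerD_W_lower hx J K M, wignerD_L_raise hx J K M, wignerD_L_lower hx J K M⟩
  · intro x _ ρ τ
    simp only [symOp]
    exact Finset.sum_congr rfl fun _ _ => Finset.sum_congr rfl fun _ _ => add_comm _ _
  · exact isGenerator_W.symOp_lieD hh hx
  · exact (isGenerator_L i).symOp_lieD hh hx
  · exact isGenerator_T.symOp_lieD hh hx
  · exact isGenerator_W.lieD_comm (isGenerator_L i) (fun x κ => vecAct_W_L i x κ) hh hx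
  · exact isGenerator_W.lieD_comm isGenerator_T
      (vecAct_lin_T _ hT fun x κ => by rw [W_eq]) hh hx
  · exact (isGenerator_L i).lieD_comm isGenerator_T
      (vecAct_lin_T _ (hTL i) fun x κ => by rw [L_eq]) hh hx
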